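/- Let $G=(V,E)$ be a finite simple graph and $M$ a matching in $G$. Edges in $M$ are *matched*, the others *unmatched*; a vertex is unmatched if no matched edge is incident at it. An *alternating path* is a simple path whose edges alternate between $M$ and $E\setminus M$; an *augmenting path* is an alternating path between two distinct unmatched vertices, and $l_m$ is the minimum length of an augmenting path ($\infty$ if there is none). Let $\mathrm{evenlevel}(v)$ ($\mathrm{oddlevel}(v)$) be the minimum length of an alternating path of even (odd) length from an unmatched vertex to $v$ ($\infty$ if none); $\mathrm{minlevel}(v)$ and $\mathrm{maxlevel}(v)$ are the smaller and the larger of the two, and the tenacity of $v$ is $t(v)=\mathrm{evenlevel}(v)+\mathrm{oddlevel}(v)$. The tenacity of an edge $uv$ is $\mathrm{evenlevel}(u)+\mathrm{evenlevel}(v)+1$ if it is unmatched and $\mathrm{oddlevel}(u)+\mathrm{oddlevel}(v)+1$ if it is matched. If $uv$ is the last edge of an alternating path of length $\mathrm{minlevel}(v)$ from an unmatched vertex to $v$, then $u$ is a *predecessor* of $v$ and $uv$ is a *prop*; an edge that is not a prop is a *bridge*. Consider the following algorithm. Initially unmatched vertices have minlevel $0$ and nothing else is assigned. All choices below are arbitrary.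 An assigned minlevel or maxlevel of $v$ counts as its evenlevel or oddlevel according to its parity; the tenacity of an edge is *known* when both levels entering its definition are assigned. For search levels $i=0,1,2,\dots$ the algorithm runs MIN and then MAX. *MIN.* For each vertex $u$ with an assigned level equal to $i$ and each unmatched (if $i$ is even) or matched (if $i$ is odd) edge $uv$ that has not been scanned before, scan $uv$: if $v$ has no assigned minlevel or has the assigned minlevel $i+1$, let the minlevel of $v$ be $i+1$, record $u$ as a predecessor of $v$, and declare $uv$ a prop; otherwise declare $uv$ a bridge and, if its tenacity $t$ is known, insert it in the list $Br(t)$. *MAX.* Process each edge $xy\in Br(2i+1)$ once. Let $\mathrm{bud}(v)$ be the bud of the petal containing $v$, or $v$ if $v$ is in no petal, and let $\mathrm{bud}^*(v)$ be the result of iterating $\mathrm{bud}$ until it is stationary. Let $r=\mathrm{bud}^*(x)$, $g=\mathrm{bud}^*(y)$. If $r=g$, do nothing. Otherwise run *double depth first search* (DDFS) from $r$ and $g$ on the directed graph $H$ with edges $(v,\mathrm{bud}^*(u))$, $u$ a recorded predecessor of $v$, the layer of a vertex being its minlevel (smaller is deeper). DDFS grows a red tree from $r$ and a green tree from $g$,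 with centers of activity $C_r$ (initially $r$) and $C_g$ (initially $g$); the roots are visited, and Barrier is $r$. As long as the centers have not met, $C_r$ moves if its layer is at least that of $C_g$, and otherwise $C_g$ moves; a move goes along an edge of $H$ to an unvisited vertex, which joins the tree, or to the other center. When the centers meet at a vertex $z$, the vertex is given to the green tree, and the red tree backtracks from $z$ and continues as a depth first search through unvisited vertices until it visits a vertex at least as deep as $z$, whereupon the coordinated search resumes. If instead it has backtracked to Barrier and has no edge left to an unvisited vertex there, $z$ is given to the red tree with $C_r=z$, Barrier becomes $z$, and the green tree backtracks from $z$ and searches likewise for a vertex at least as deep as $z$; if it finds one the coordinated search resumes, and if it has backtracked to its root $g$ and has no edge left there, DDFS ends with bottleneck $b=z$. If the centers are at distinct vertices of layer $0$, DDFS ends without a bottleneck; the assignment of levels is then over, and augmenting paths are to be extracted. If DDFS ends with bottleneck $b$, all visited vertices $w\ne b$ form a new petal with bud $b$, each of them is assigned the maxlevel $2i+1-\mathrm{minlevel}(w)$, and, for each of them whose minlevel is odd, every incident edge that has not been declared a prop and whose tenacity $t$ is now known is inserted in $Br(t)$. **Theorem.** In every execution of this algorithm: 1. Every vertex $v$ with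 $t(v)<l_m$ is, after finitely many steps, assigned its correct $\mathrm{minlevel}(v)$ and $\mathrm{maxlevel}(v)$, and these values are not changed afterwards. 2. For every $i\ge 0$ with $2i+1\le l_m$, the end of MIN at search level $i$ is reached after finitely many steps. At that point exactly the vertices with minlevel at most $i+1$ have an assigned minlevel, and it is correct (so MIN at search level $i$ assigns the minlevel $i+1$ to exactly the vertices that have it); the recorded predecessors and declared props are exactly the predecessors of, and the props that lead to, vertices of minlevel at most $i+1$; and $Br(2i+1)$ is the set of all bridges of tenacity $2i+1$. 3. For every $i\ge 0$ with $2i+1<l_m$, the end of MAX at search level $i$ is reached after finitely many steps. At that point exactly the vertices of tenacity at most $2i+1$ have an assigned maxlevel, and it is correct (so MAX at search level $i$ finds exactly the vertices of tenacity $2i+1$ and assigns them their maxlevels). -/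

import Mathlib

namespace MV

variable {V : Type*} {G : SimpleGraph V}

/-! ### Alternating paths, levels, tenacity, props and bridges

Throughout, the matching is a subgraph `M` of `G` with `M.IsMatching`. -/

/-- `v` has no incident matched edge. -/
def Unmatched (M : G.Subgraph) (v : V) : Prop := ∀ w, ¬ M.Adj v w

/-- A simple path whose edges are alternately in `M` and outside `M`. -/
def IsAlternatingPath (M : G.Subgraph) {u v : V} (p : G.Walk u v) : Prop :=
  p.IsPath ∧ p.edges.IsChain (fun e e' => (e ∈ M.edgeSet ↔ e' ∉ M.edgeSet))

/-- The length of a shortest augmenting path, `⊤` if there is none. (The endpoints of an augmenting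
path are distinct, which excludes the path of length `0` at an unmatched vertex.) -/
noncomputable def minAugLength (M : G.Subgraph) : ℕ∞ :=
  ⨅ (f : V) (f' : V) (p : G.Walk f f')
    (_ : Unmatched M f ∧ Unmatched M f' ∧ f ≠ f' ∧ IsAlternatingPath M p), (p.length : ℕ∞)

/-- Length of a shortest alternating path of even length from an unmatched vertex to `v`. -/
noncomputable def evenlevel (M : G.Subgraph) (v : V) : ℕ∞ :=
  ⨅ (f : V) (p : G.Walk f v)
    (_ : Unmatched M f ∧ IsAlternatingPath M p ∧ Even p.length), (p.length : ℕ∞)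

/-- Length of a shortest alternating path of odd length from an unmatched vertex to `v`. -/
noncomputable def oddlevel (M : G.Subgraph) (v : V) : ℕ∞ :=
  ⨅ (f : V) (p : G.Walk f v)
    (_ : Unmatched M f ∧ IsAlternatingPath M p ∧ Odd p.length), (p.length : ℕ∞)

noncomputable def minlevel (M : G.Subgraph) (v : V) : ℕ∞ := min (evenlevel M v) (oddlevel M v)

noncomputable def maxlevel (M : G.Subgraph) (v : V) : ℕ∞ := max (evenlevel M v) (oddlevel M v)

noncomputable def tenacity (M : G.Subgraph) (v : V) : ℕ∞ := evenlevel M v + oddlevel M v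

open Classical in
/-- Tenacity of the edge `uv`. -/
noncomputable def edgeTenacity (M : G.Subgraph) (u v : V) : ℕ∞ :=
  if M.Adj u v then oddlevel M u + oddlevel M v + 1 else evenlevel M u + evenlevel M v + 1

/-- `u` is a predecessor of `v`: `uv` is the last edge of some `minlevel(v)` path. -/
def IsPredecessor (M : G.Subgraph) (u v : V) : Prop :=
  ∃ (f : V) (p : G.Walk f v), Unmatched M f ∧ IsAlternatingPath M p ∧
    (p.length : ℕ∞) = minlevel M v ∧ ¬ p.Nil ∧ p.penultimate = u

def IsProp (M : G.Subgraph) (u v : V) : Prop := IsPredecessor M u v ∨ IsPredecessor M v u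

/-- An edge that is not a prop. -/
def IsBridge (M : G.Subgraph) (u v : V) : Prop := G.Adj u v ∧ ¬ IsProp M u v

/-! ### The data maintained by the algorithm during a phase -/

/-- The value `⊤` of `minLevel v` or `maxLevel v` means "not (yet) assigned". -/
structure Labels (V : Type*) where
  minLevel : V → ℕ∞
  maxLevel : V → ℕ∞
  /-- lists of predecessors -/
  preds : V → Set V
  scanned : Set (Sym2 V)
  /-- edges declared props -/
  props : Set (Sym2 V)
  /-- edges declared bridges -/
  bridges : Set (Sym2 V)
  /-- `br t` is the list of bridges of tenacity `t` -/
  br : ℕ → Set (Sym2 V)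
  /-- the bud of the petal containing `v`, and `v` itself if `v` is in no petal -/
  bud : V → V

open Classical in
noncomputable def initLabels (M : G.Subgraph) : Labels V where
  minLevel v := if Unmatched M v then 0 else ⊤
  maxLevel _ := ⊤
  preds _ := ∅
  scanned := ∅
  props := ∅
  bridges := ∅
  br _ := ∅
  bud v := v

namespace Labels

/-- `k` is one of the levels of `v` assigned so far; it is the evenlevel or the oddlevel of `v`
according to its parity. -/
def HasLevel (L : Labels V) (v : V) (k : ℕ) : Prop := L.minLevel v = k ∨ L.maxLevel v = k

/-- From the levels assigned so far, the tenacity of the edge `uv` is known, and equal to `t`. -/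
def KnownTenacity (L : Labels V) (M : G.Subgraph) (u v : V) (t : ℕ) : Prop :=
  ∃ j k : ℕ, L.HasLevel u j ∧ L.HasLevel v k ∧
    ((M.Adj u v ∧ Odd j ∧ Odd k) ∨ (¬ M.Adj u v ∧ Even j ∧ Even k)) ∧ t = j + k + 1

/-- `v` has been recognized as an inner vertex. -/
def Inner (L : Labels V) (v : V) : Prop := ∃ k : ℕ, Odd k ∧ L.minLevel v = k

/-- `L.BudStar v b` means `bud*(v) = b`. -/
inductive BudStar (L : Labels V) : V → V → Prop
  | self (v : V) : L.bud v = v → BudStar L v v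
  | next (v b : V) : L.bud v ≠ v → BudStar L (L.bud v) b → BudStar L v b

/-- The directed edges `(v, bud*(u))`, `u` a predecessor of `v`, of the layered graph `H`. The
layer of a vertex of `H` is its `minLevel`. -/
def HEdge (L : Labels V) (v w : V) : Prop := ∃ u ∈ L.preds v, L.BudStar u w

end Labels

/-! ### Double depth first search -/

inductive Colour
  | red
  | green

/-- `normal`: the two trees grow by the rule that keeps the centers of activity level.
`redSeeks`: the centers have met at the vertex `cG`, and `T_r` looks for another vertex at least as
deep. `greenSeeks`: `T_r` has failed, the meeting vertex `cR` has been given to `T_r`, and `T_g`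
looks for another vertex at least as deep. -/
inductive Mode
  | normal
  | redSeeks
  | greenSeeks

structure DDFS (V : Type*) where
  /-- `none` for an unvisited vertex -/
  colour : V → Option Colour
  parentR : V → Option V
  parentG : V → Option V
  /-- center of activity of `T_r` -/
  cR : V
  /-- center of activity of `T_g` -/
  cG : V
  /-- the root of `T_g` -/
  rootG : V
  barrier : V
  mode : Mode

namespace DDFS

open Classical in
/-- The start of a DDFS with the distinct roots `r` and `g`. -/
noncomputable def start (r g : V) : DDFS V where
  colour v := if v = r then some .red else if v = g then some .green else none
  parentR _ := none
  parentG _ := none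
  cR := r
  cG := g
  rootG := g
  barrier := r
  mode := .normal

/-- `T_r` cannot go on from its center of activity while it looks for an alternative to the meeting
vertex `cG`: it does not search from the meeting vertex itself, and elsewhere it is out of edges. -/
def RedStuck (L : Labels V) (D : DDFS V) : Prop :=
  D.cR = D.cG ∨ ∀ u, L.HEdge D.cR u → D.colour u ≠ none

/-- The same for `T_g`, with the meeting vertex `cR`. -/
def GreenStuck (L : Labels V) (D : DDFS V) : Prop :=
  D.cG = D.cR ∨ ∀ u, L.HEdge D.cG u → D.colour u ≠ none

open Classical in
/-- One step of DDFS, with the edge to be explored chosen arbitrarily. An explored edge leads to a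
visited vertex, and edges to visited vertices are passed over (unless the centers meet), so that
explored edges need no marks of their own. -/
inductive Step (L : Labels V) : DDFS V → DDFS V → Prop
  | redMove (D : DDFS V) (u : V) (hm : D.mode = .normal)
      (hl : L.minLevel D.cG ≤ L.minLevel D.cR) (he : L.HEdge D.cR u) (hu : D.colour u = none) :
      Step L D { D with
        colour := Function.update D.colour u (some .red)
        parentR := Function.update D.parentR u (some D.cR)
        cR := u }
  | greenMove (D : DDFS V) (u : V) (hm : D.mode = .normal)
      (hl : L.minLevel D.cR < L.minLevel D.cG) (he : L.HEdge D.cG u) (hu : D.colour u = none) :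
      Step L D { D with
        colour := Function.update D.colour u (some .green)
        parentG := Function.update D.parentG u (some D.cG)
        cG := u }
  /- The centers meet; the meeting vertex is first given to `T_g`. -/
  | redMeets (D : DDFS V) (hm : D.mode = .normal)
      (hl : L.minLevel D.cG ≤ L.minLevel D.cR) (he : L.HEdge D.cR D.cG) :
      Step L D { D with
        colour := Function.update D.colour D.cG (some .green)
        parentR := Function.update D.parentR D.cG (some D.cR)
        cR := D.cG
        mode := .redSeeks }
  | greenMeets (D : DDFS V) (hm : D.mode = .normal)
      (hl : L.minLevel D.cR < L.minLevel D.cG) (he : L.HEdge D.cG D.cR) :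
      Step L D { D with
        colour := Function.update D.colour D.cR (some .green)
        parentG := Function.update D.parentG D.cR (some D.cG)
        cG := D.cR
        mode := .redSeeks }
  | redSeek (D : DDFS V) (u : V) (hm : D.mode = .redSeeks) (hc : D.cR ≠ D.cG)
      (he : L.HEdge D.cR u) (hu : D.colour u = none) :
      Step L D { D with
        colour := Function.update D.colour u (some .red)
        parentR := Function.update D.parentR u (some D.cR)
        cR := u
        mode := if L.minLevel u ≤ L.minLevel D.cG then .normal else .redSeeks }
  | redBacktrack (D : DDFS V) (x : V) (hm : D.mode = .redSeeks) (hs : D.RedStuck L)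
      (hb : D.cR ≠ D.barrier) (hx : D.parentR D.cR = some x) :
      Step L D { D with cR := x }
  /- `T_r` has backtracked to its barrier: the meeting vertex goes to `T_r`. -/
  | redFail (D : DDFS V) (hm : D.mode = .redSeeks) (hs : D.RedStuck L)
      (hb : D.cR = D.barrier) :
      Step L D { D with
        colour := Function.update D.colour D.cG (some .red)
        cR := D.cG
        barrier := D.cG
        mode := .greenSeeks }
  | greenSeek (D : DDFS V) (u : V) (hm : D.mode = .greenSeeks) (hc : D.cG ≠ D.cR)
      (he : L.HEdge D.cG u) (hu : D.colour u = none) :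
      Step L D { D with
        colour := Function.update D.colour u (some .green)
        parentG := Function.update D.parentG u (some D.cG)
        cG := u
        mode := if L.minLevel u ≤ L.minLevel D.cR then .normal else .greenSeeks }
  | greenBacktrack (D : DDFS V) (x : V) (hm : D.mode = .greenSeeks) (hs : D.GreenStuck L)
      (hb : D.cG ≠ D.rootG) (hx : D.parentG D.cG = some x) :
      Step L D { D with cG := x }

/-- DDFS ends with the highest bottleneck `b`: both trees have failed to find a vertex other than
the meeting vertex `b` at least as deep. -/
def EndsAt (L : Labels V) (D : DDFS V) (b : V) : Prop :=
  D.mode = .greenSeeks ∧ D.GreenStuck L ∧ D.cG = D.rootG ∧ b = D.cR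

/-- DDFS ends without a bottleneck: the centers are at distinct vertices of the lowest layer. -/
def EndsDisjoint (L : Labels V) (D : DDFS V) : Prop :=
  D.mode = .normal ∧ D.cR ≠ D.cG ∧ L.minLevel D.cR = 0 ∧ L.minLevel D.cG = 0

/-- The vertices other than the bottleneck `b` found by the search. -/
def found (D : DDFS V) (b : V) : Set V := {w | D.colour w ≠ none ∧ w ≠ b}

end DDFS

/-! ### The procedures MIN and MAX -/

/-- What MIN has to scan at search level `i`: pairs `(u, v)` such that `i` is a level of `u` and `uv`
is an edge that is unmatched if `i` is even and matched if `i` is odd. -/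
def minQueue (M : G.Subgraph) (i : ℕ) (L : Labels V) : Set (V × V) :=
  {d | L.HasLevel d.1 i ∧ G.Adj d.1 d.2 ∧ (M.Adj d.1 d.2 ↔ Odd i)}

open Classical in
/-- MIN, at search level `i`, searches from `u` along the edge `uv`. -/
noncomputable def scan (M : G.Subgraph) (i : ℕ) (u v : V) (L : Labels V) : Labels V :=
  if s(u, v) ∈ L.scanned then L
  else if (i + 1 : ℕ∞) ≤ L.minLevel v then
    { L with
      minLevel := Function.update L.minLevel v (i + 1)
      preds := Function.update L.preds v (insert u (L.preds v))
      scanned := insert s(u, v) L.scanned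
      props := insert s(u, v) L.props }
  else
    { L with
      scanned := insert s(u, v) L.scanned
      bridges := insert s(u, v) L.bridges
      br := fun t => L.br t ∪ {e | e = s(u, v) ∧ L.KnownTenacity M u v t} }

open Classical in
/-- The vertices of `P` get their maxlevels at search level `i` and form a petal with bud `b`. -/
noncomputable def assignPetal (i : ℕ) (P : Set V) (b : V) (L : Labels V) : Labels V :=
  { L with
    maxLevel := fun w => if w ∈ P then (2 * i + 1 : ℕ∞) - L.minLevel w else L.maxLevel w
    bud := fun w => if w ∈ P then b else L.bud w }

/-- Insert into the lists `br` all edges of known tenacity that are not props and are incident at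
an inner vertex of `P`. -/
def insertBridges (M : G.Subgraph) (P : Set V) (L : Labels V) : Labels V :=
  { L with
    br := fun t => L.br t ∪ {e | ∃ v w, e = s(v, w) ∧ v ∈ P ∧ L.Inner v ∧ G.Adj v w ∧
      e ∉ L.props ∧ L.KnownTenacity M v w t} }

/-! ### The algorithm for a phase as a transition system -/

/-- Control: `min todo` is MIN with the pairs `todo` still to be scanned; `max done` is MAX, between
two calls of DDFS, with the bridges in `done` already processed; `ddfs done D` is MAX in the course of
a call of DDFS; `augment` means that DDFS has found two disjoint paths to unmatched vertices, so that
the assignment of levels is over and augmenting paths are to be extracted. -/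
inductive Control (V : Type*)
  | min (todo : Set (V × V))
  | max (done : Set (Sym2 V))
  | ddfs (done : Set (Sym2 V)) (D : DDFS V)
  | augment

structure State (V : Type*) where
  /-- the search level -/
  level : ℕ
  labels : Labels V
  control : Control V

/-- Start of the phase. -/
noncomputable def init (M : G.Subgraph) : State V :=
  ⟨0, initLabels M, .min (minQueue M 0 (initLabels M))⟩

/-- One step of the algorithm. The pairs to be scanned by MIN, the bridges to be processed by MAX,
the endpoint of a bridge that is called red, and the edges explored by DDFS are chosen
arbitrarily. -/
inductive Step (M : G.Subgraph) : State V → State V → Prop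
  | scan (i : ℕ) (L : Labels V) (todo : Set (V × V)) (u v : V) (h : (u, v) ∈ todo) :
      Step M ⟨i, L, .min todo⟩ ⟨i, scan M i u v L, .min (todo \ {(u, v)})⟩
  | startMax (i : ℕ) (L : Labels V) : Step M ⟨i, L, .min ∅⟩ ⟨i, L, .max ∅⟩
  /- Both endpoints of the bridge have the same `bud*`: DDFS aborts. -/
  | abortDDFS (i : ℕ) (L : Labels V) (done : Set (Sym2 V)) (x y b : V)
      (h : s(x, y) ∈ L.br (2 * i + 1)) (hd : s(x, y) ∉ done)
      (hx : L.BudStar x b) (hy : L.BudStar y b) :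
      Step M ⟨i, L, .max done⟩ ⟨i, L, .max (insert s(x, y) done)⟩
  | startDDFS (i : ℕ) (L : Labels V) (done : Set (Sym2 V)) (x y r g : V)
      (h : s(x, y) ∈ L.br (2 * i + 1)) (hd : s(x, y) ∉ done)
      (hx : L.BudStar x r) (hy : L.BudStar y g) (hrg : r ≠ g) :
      Step M ⟨i, L, .max done⟩ ⟨i, L, .ddfs (insert s(x, y) done) (DDFS.start r g)⟩
  | stepDDFS (i : ℕ) (L : Labels V) (done : Set (Sym2 V)) (D D' : DDFS V) (h : D.Step L D') :
      Step M ⟨i, L, .ddfs done D⟩ ⟨i, L, .ddfs done D'⟩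
  | endDDFS (i : ℕ) (L : Labels V) (done : Set (Sym2 V)) (D : DDFS V) (b : V)
      (h : D.EndsAt L b) :
      Step M ⟨i, L, .ddfs done D⟩
        ⟨i, insertBridges M (D.found b) (assignPetal i (D.found b) b L), .max done⟩
  | foundPaths (i : ℕ) (L : Labels V) (done : Set (Sym2 V)) (D : DDFS V)
      (h : D.EndsDisjoint L) :
      Step M ⟨i, L, .ddfs done D⟩ ⟨i, L, .augment⟩
  | nextLevel (i : ℕ) (L : Labels V) (done : Set (Sym2 V)) (h : L.br (2 * i + 1) ⊆ done) :
      Step M ⟨i, L, .max done⟩ ⟨i + 1, L, .min (minQueue M (i + 1) L)⟩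

/-- `s` occurs in some execution of the phase. -/
def Reachable (M : G.Subgraph) (s : State V) : Prop := Relation.ReflTransGen (Step M) (init M) s

/-- Every execution from `s` arrives, after finitely many steps and without getting stuck before, at
a state satisfying `P`. -/
inductive Inevitably (M : G.Subgraph) (P : State V → Prop) : State V → Prop
  | now (s : State V) : P s → Inevitably M P s
  | later (s : State V) : (∃ s', Step M s s') → (∀ s', Step M s s' → Inevitably M P s') →
      Inevitably M P s

/-- End of MIN at search level `i`. -/
def EndOfMin (i : ℕ) (s : State V) : Prop := s.level = i ∧ s.control = .min ∅

/-- End of MAX at search level `i`. -/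
def EndOfMax (i : ℕ) (s : State V) : Prop :=
  s.level = i ∧ ∃ done, s.control = .max done ∧ s.labels.br (2 * i + 1) ⊆ done

/-! ### What is achieved at search level `i` -/

open Classical in
/-- Exactly the vertices with minlevel at most `i + 1` have an assigned minlevel, which is the correct
one; the predecessors recorded and the edges declared props are exactly those that give a
minlevel of at most `i + 1`. -/
def MinCorrect (M : G.Subgraph) (i : ℕ) (L : Labels V) : Prop :=
  (∀ v, L.minLevel v = if minlevel M v ≤ (i + 1 : ℕ∞) then minlevel M v else ⊤) ∧
  (∀ u v, u ∈ L.preds v ↔ IsPredecessor M u v ∧ minlevel M v ≤ (i + 1 : ℕ∞)) ∧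
  (∀ u v, s(u, v) ∈ L.props ↔
    (IsPredecessor M u v ∧ minlevel M v ≤ (i + 1 : ℕ∞)) ∨
    (IsPredecessor M v u ∧ minlevel M u ≤ (i + 1 : ℕ∞)))

/-- The list `br (2 i + 1)` consists of all bridges of tenacity `2 i + 1`. -/
def BridgesCollected (M : G.Subgraph) (i : ℕ) (L : Labels V) : Prop :=
  ∀ u v, s(u, v) ∈ L.br (2 * i + 1) ↔ IsBridge M u v ∧ edgeTenacity M u v = (2 * i + 1 : ℕ∞)

open Classical in
/-- Exactly the vertices of tenacity at most `2 i + 1` have an assigned maxlevel, which is the correct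
one. -/
def MaxCorrect (M : G.Subgraph) (i : ℕ) (L : Labels V) : Prop :=
  ∀ v, L.maxLevel v = if tenacity M v ≤ (2 * i + 1 : ℕ∞) then maxlevel M v else ⊤

end MV

/-!
Blossoms are recorded by the map `β` that sends a vertex to the base of its blossom, which is
`bud*`. A double depth first search either finds two disjoint paths to unmatched vertices, and hence
an augmenting path through the bridge, or a bottleneck `b`; in the latter case every vertex found
has an alternating path that runs through the bridge, of length `2 i + 1` minus its minlevel. So
levels assigned by MAX are attained. That no vertex of tenacity `2 i + 1` is missed and that no
assigned level is too large follows from duality: the depths of the vertices at search level `i`,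
corrected by the blossoms, form a solution of the dual of the linear program of matching theory.
Along an alternating path the dual constraints add up to a lower bound on its length, because a path
enters a blossom through its base or through an unmatched edge.
-/

namespace MV

variable {V : Type*} {G : SimpleGraph V} {M : G.Subgraph}

/-! ### Alternating paths with recorded vertex sets -/

/-- `AltPath M a l v k S`: there is a simple path from `a` to `v` with vertex set `S`, whose
vertices are numbered consecutively from `l` to `k`, and an edge leaving the vertex with number `j`
is matched if and only if `j` is odd. Starting at an unmatched vertex with `l = 0`, these are the
alternating paths; other values of `l` describe their final segments. -/
inductive AltPath (M : G.Subgraph) (a : V) (l : ℕ) : V → ℕ → Set V → Prop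
  | nil : AltPath M a l a l {a}
  | snoc {u v : V} {k : ℕ} {S : Set V} (h : AltPath M a l u k S) (hadj : G.Adj u v)
      (hpar : M.Adj u v ↔ k % 2 = 1) (hv : v ∉ S) : AltPath M a l v (k + 1) (insert v S)

namespace AltPath

variable {a u v w : V} {l k m : ℕ} {S S' : Set V}

theorem start_mem (h : AltPath M a l v k S) : a ∈ S := by
  induction h with
  | nil => rfl
  | snoc _ _ _ _ ih => exact Set.mem_insert_of_mem _ ih

theorem end_mem (h : AltPath M a l v k S) : v ∈ S := by
  cases h with
  | nil => rfl
  | snoc => exact Set.mem_insert _ _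

theorem le (h : AltPath M a l v k S) : l ≤ k := by
  induction h with
  | nil => rfl
  | snoc _ _ _ _ ih => omega

theorem eq_of_level_eq (h : AltPath M a l v l S) : v = a := by
  generalize hk : l = k at h
  cases h with
  | nil => rfl
  | snoc h => subst hk; have := h.le; omega

theorem level_eq_of_eq (h : AltPath M a l a k S) : k = l := by
  cases h with
  | nil => rfl
  | snoc h _ _ hv => exact absurd h.start_mem hv

theorem exists_initial_path (h : AltPath M a l v k S) {s : V} (hs : s ∈ S) :
    ∃ j S', AltPath M a l s j S' ∧ j ≤ k ∧ (s ≠ v → j < k) := by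
  induction h with
  | nil => cases hs; exact ⟨_, _, .nil, le_rfl, fun h => absurd rfl h⟩
  | @snoc u v k S h hadj hpar hv ih =>
    rcases hs with rfl | hs
    · exact ⟨_, _, h.snoc hadj hpar hv, le_rfl, fun h => absurd rfl h⟩
    · obtain ⟨j, S', hj, hjk, -⟩ := ih hs
      exact ⟨j, S', hj, by omega, fun _ => by omega⟩

theorem trans (h : AltPath M a l u k S) (h' : AltPath M u k w m S')
    (hd : ∀ s ∈ S, s ∈ S' → s = u) : AltPath M a l w m (S ∪ S') := by
  induction h' with
  | nil => rwa [Set.union_singleton, Set.insert_eq_of_mem h.end_mem]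
  | @snoc u' v' k' S'' h' hadj' hpar' hv' ih =>
    rw [Set.union_insert]
    refine (ih fun s hs hs' => hd s hs (Set.mem_insert_of_mem _ hs')).snoc hadj' hpar' ?_
    rintro (hs | hs)
    · exact hv' (hd _ hs (Set.mem_insert _ _) ▸ h'.start_mem)
    · exact hv' hs

theorem append (h : AltPath M a l u k S) (hadj : G.Adj u v) (hpar : M.Adj u v ↔ k % 2 = 1)
    (h' : AltPath M v (k + 1) w m S') (hd : ∀ s ∈ S, s ∉ S') :
    AltPath M a l w m (S ∪ S') := by
  have hv : v ∉ S := fun hv => hd v hv h'.start_mem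
  have := (h.snoc hadj hpar hv).trans h' fun s hs hs' =>
    hs.resolve_right fun hsS => hd s hsS hs'
  rwa [Set.insert_union, Set.insert_eq_of_mem (Set.mem_union_right S h'.start_mem)] at this

theorem reverse (h : AltPath M a l v k S) {n : ℕ} (hn : (n + k) % 2 = 1) :
    AltPath M v n a (n + (k - l)) S := by
  induction h generalizing n with
  | nil => simpa using AltPath.nil
  | @snoc u v k S h hadj hpar hv ih =>
    have hle := h.le
    have hpath := AltPath.nil.append hadj.symm (by rw [M.adj_comm, hpar]; omega)
      (ih (n := n + 1) (by omega)) (by rintro s rfl; exact hv)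
    rwa [show n + (k + 1 - l) = n + 1 + (k - l) by omega, Set.insert_eq]

theorem exists_mate_mem (h : AltPath M a l v k S) (hne : a ≠ v) (hl : l % 2 = 1) :
    ∃ c ∈ S, M.Adj a c := by
  induction h with
  | nil => exact absurd rfl hne
  | @snoc u v k S h hadj hpar _ ih =>
    by_cases hu : a = u
    · subst hu
      obtain rfl := h.level_eq_of_eq
      exact ⟨v, Set.mem_insert _ _, hpar.2 hl⟩
    · obtain ⟨c, hc, hac⟩ := ih hu
      exact ⟨c, Set.mem_insert_of_mem _ hc, hac⟩

/-- The mate of the last vertex is on the path only if the last edge is matched, which explains the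
parity conditions. -/
theorem mate_mem (hM : M.IsMatching) {f : V} (hf : Unmatched M f)
    (h : AltPath M f 0 v k S) {s c : V} (hs : s ∈ S) (hsv : s ≠ v ∨ k % 2 = 0)
    (hsc : M.Adj s c) : c ∈ S ∧ (c ≠ v ∨ k % 2 = 0) := by
  induction h generalizing s c with
  | nil => cases hs; exact absurd hsc (hf c)
  | @snoc u v k S h hadj hpar hv ih =>
    rcases Nat.mod_two_eq_zero_or_one k with hk | hk
    · have hsS : s ∈ S := hs.resolve_left fun hs => hsv.elim (absurd hs) (by omega)
      obtain ⟨hcS, -⟩ := ih hsS (Or.inr hk) hsc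
      exact ⟨Set.mem_insert_of_mem _ hcS, Or.inl fun hcv => hv (hcv ▸ hcS)⟩
    · refine ⟨?_, Or.inr (by omega)⟩
      have huv := hpar.2 hk
      rcases hs with rfl | hs
      · obtain rfl := hM.eq_of_adj_left huv.symm hsc
        exact Set.mem_insert_of_mem _ h.end_mem
      · by_cases hsu : s = u
        · subst hsu
          obtain rfl := hM.eq_of_adj_left huv hsc
          exact Set.mem_insert _ _
        · exact Set.mem_insert_of_mem _ (ih hs (Or.inl hsu) hsc).1

end AltPath

/-- The edges of `p`, numbered from `l`, are matched exactly at the odd numbers. -/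
def AlternatesFrom (M : G.Subgraph) (l : ℕ) {a v : V} (p : G.Walk a v) : Prop :=
  ∀ (j : ℕ) (hj : j < p.edges.length), p.edges[j] ∈ M.edgeSet ↔ (l + j) % 2 = 1

section Walks

variable {a f u v : V} {l k : ℕ} {S : Set V}

theorem alternatesFrom_concat {p : G.Walk a u} {hadj : G.Adj u v} :
    AlternatesFrom M l (p.concat hadj) ↔
      AlternatesFrom M l p ∧ (M.Adj u v ↔ (l + p.length) % 2 = 1) := by
  simp only [AlternatesFrom, SimpleGraph.Walk.edges_concat, List.concat_eq_append,
    List.length_append, List.length_singleton, SimpleGraph.Walk.length_edges]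
  refine ⟨fun h => ⟨fun j hj => ?_, ?_⟩, fun h j hj => ?_⟩
  · simpa [List.getElem_append, hj] using h j (by omega)
  · simpa [List.getElem_append] using h p.length (by omega)
  · rcases Nat.lt_succ_iff_lt_or_eq.1 hj with hj | rfl
    · simpa [List.getElem_append, hj] using h.1 j hj
    · simpa [List.getElem_append] using h.2

theorem AlternatesFrom.isChain {p : G.Walk a v} (h : AlternatesFrom M l p) :
    p.edges.IsChain (fun e e' => (e ∈ M.edgeSet ↔ e' ∉ M.edgeSet)) :=
  List.isChain_iff_getElem.2 fun j hj => by
    rw [h j (by omega), h (j + 1) hj]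
    omega

theorem isAlternatingPath_iff (hf : Unmatched M f) {p : G.Walk f v} :
    IsAlternatingPath M p ↔ p.IsPath ∧ AlternatesFrom M 0 p := by
  refine and_congr_right fun _ => ⟨fun hc j hj => ?_, AlternatesFrom.isChain⟩
  induction j with
  | zero =>
    cases p with
    | nil => simp at hj
    | cons _ p => simpa using hf _
  | succ j ih =>
    have halt := List.isChain_iff_getElem.1 hc j hj
    have := ih (by omega)
    by_cases hmem : p.edges[j + 1] ∈ M.edgeSet <;> grind

theorem AltPath.exists_walk (h : AltPath M a l v k S) :
    ∃ p : G.Walk a v, p.IsPath ∧ l + p.length = k ∧ (∀ x, x ∈ p.support ↔ x ∈ S) ∧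
      AlternatesFrom M l p := by
  induction h with
  | nil => exact ⟨.nil, by simp [AlternatesFrom]⟩
  | @snoc u v k S h hadj hpar hv ih =>
    obtain ⟨p, hp, rfl, hsupp, halt⟩ := ih
    exact ⟨p.concat hadj, hp.concat (by rwa [hsupp]) hadj, by rw [p.length_concat, add_assoc],
      by simp [SimpleGraph.Walk.support_concat, hsupp, or_comm],
      alternatesFrom_concat.2 ⟨halt, hpar⟩⟩

theorem AltPath.of_walk (p : G.Walk a v) (hp : p.IsPath) (hc : AlternatesFrom M l p) :
    AltPath M a l v (l + p.length) {x | x ∈ p.support} := by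
  induction p using SimpleGraph.Walk.concatRec with
  | Hnil => simpa using AltPath.nil
  | Hconcat p hadj ih =>
    rw [SimpleGraph.Walk.concat_isPath_iff] at hp
    rw [alternatesFrom_concat] at hc
    convert (ih hp.1 hc.1).snoc hadj hc.2 hp.2 using 1
    · rw [p.length_concat, add_assoc]
    · ext x
      simp [SimpleGraph.Walk.support_concat, or_comm]

theorem IsAlternatingPath.altPath {p : G.Walk f v} (hp : IsAlternatingPath M p)
    (hf : Unmatched M f) : AltPath M f 0 v p.length {x | x ∈ p.support} := by
  obtain ⟨hpath, halt⟩ := (isAlternatingPath_iff hf).1 hp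
  simpa using AltPath.of_walk p hpath halt

end Walks

/-! ### Levels as natural numbers -/

/-- There is an alternating path of length `k` from an unmatched vertex to `v`. -/
def HasAltPath (M : G.Subgraph) (v : V) (k : ℕ) : Prop :=
  ∃ f S, Unmatched M f ∧ AltPath M f 0 v k S

/-- `k` is the evenlevel or the oddlevel of `v`, according to its parity. In particular this level
is finite. -/
def IsLevel (M : G.Subgraph) (v : V) (k : ℕ) : Prop :=
  IsLeast {j | HasAltPath M v j ∧ j % 2 = k % 2} k

/-- `m` is the minlevel of `v`, which is finite. -/
def IsMinlevel (M : G.Subgraph) (v : V) (m : ℕ) : Prop := IsLeast {j | HasAltPath M v j} m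

/-- `t` is the tenacity of `v`, which is finite. -/
def HasTenacity (M : G.Subgraph) (v : V) (t : ℕ) : Prop :=
  ∃ a b, IsLevel M v a ∧ IsLevel M v b ∧ a % 2 ≠ b % 2 ∧ a + b = t

/-- `t` is the tenacity of the edge `uv`, which is finite. -/
def HasEdgeTenacity (M : G.Subgraph) (u v : V) (t : ℕ) : Prop :=
  ∃ a b, IsLevel M u a ∧ IsLevel M v b ∧ (M.Adj u v ↔ a % 2 = 1) ∧ (M.Adj u v ↔ b % 2 = 1) ∧
    a + b + 1 = t

section Levels

variable {u v : V} {a b j k m n t : ℕ}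

theorem Unmatched.hasAltPath_zero (h : Unmatched M v) : HasAltPath M v 0 := ⟨v, _, h, .nil⟩

theorem HasAltPath.unmatched (h : HasAltPath M v 0) : Unmatched M v := by
  obtain ⟨f, S, hf, hp⟩ := h
  rwa [hp.eq_of_level_eq]

theorem IsLevel.hasAltPath (h : IsLevel M v k) : HasAltPath M v k := h.1.1

theorem IsLevel.le (h : IsLevel M v k) (hj : HasAltPath M v j) (hjk : j % 2 = k % 2) : k ≤ j :=
  h.2 ⟨hj, hjk⟩

theorem IsMinlevel.hasAltPath (h : IsMinlevel M v m) : HasAltPath M v m := h.1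

theorem IsMinlevel.le (h : IsMinlevel M v m) (hj : HasAltPath M v j) : m ≤ j := h.2 hj

theorem HasAltPath.exists_isMinlevel (h : HasAltPath M v k) : ∃ m, IsMinlevel M v m ∧ m ≤ k := by
  classical
  have hm := Nat.isLeast_find ⟨k, h⟩
  exact ⟨_, hm, hm.2 h⟩

theorem HasAltPath.exists_isLevel (h : HasAltPath M v k) :
    ∃ m, IsLevel M v m ∧ m % 2 = k % 2 ∧ m ≤ k := by
  classical
  have hm : IsLeast {j | HasAltPath M v j ∧ j % 2 = k % 2} _ := Nat.isLeast_find ⟨k, h, rfl⟩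
  exact ⟨_, by rwa [IsLevel, hm.1.2], hm.1.2, hm.2 ⟨h, rfl⟩⟩

theorem IsMinlevel.isLevel (h : IsMinlevel M v m) : IsLevel M v m :=
  ⟨⟨h.hasAltPath, rfl⟩, fun _ hj => h.le hj.1⟩

theorem IsMinlevel.unique (h : IsMinlevel M v m) (h' : IsMinlevel M v n) : m = n :=
  IsLeast.unique h h'

theorem IsLevel.unique (h : IsLevel M v a) (h' : IsLevel M v b) (hab : a % 2 = b % 2) : a = b :=
  le_antisymm (h.le h'.hasAltPath hab.symm) (h'.le h.hasAltPath hab)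

theorem IsLevel.exists_isMinlevel (h : IsLevel M v k) :
    ∃ m, IsMinlevel M v m ∧ (m = k ∨ m < k ∧ m % 2 ≠ k % 2 ∧ HasTenacity M v (m + k)) := by
  obtain ⟨m, hm, hmk⟩ := h.hasAltPath.exists_isMinlevel
  refine ⟨m, hm, ?_⟩
  by_cases hp : m % 2 = k % 2
  · exact Or.inl (hm.isLevel.unique h hp)
  · exact Or.inr ⟨by omega, hp, m, k, hm.isLevel, h, hp, rfl⟩

theorem HasTenacity.unique (h : HasTenacity M v t) (h' : HasTenacity M v n) : t = n := by
  obtain ⟨a, b, ha, hb, hab, rfl⟩ := h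
  obtain ⟨c, d, hc, hd, hcd, rfl⟩ := h'
  by_cases hac : a % 2 = c % 2
  · rw [ha.unique hc hac, hb.unique hd (by omega)]
  · rw [ha.unique hd (by omega), hb.unique hc (by omega), add_comm]

theorem HasTenacity.odd (h : HasTenacity M v t) : t % 2 = 1 := by
  obtain ⟨a, b, -, -, hab, rfl⟩ := h
  omega

theorem HasEdgeTenacity.symm (h : HasEdgeTenacity M u v t) : HasEdgeTenacity M v u t := by
  obtain ⟨a, b, ha, hb, hpa, hpb, rfl⟩ := h
  exact ⟨b, a, hb, ha, by rw [M.adj_comm, hpb], by rw [M.adj_comm, hpa], by omega⟩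

theorem HasEdgeTenacity.odd (h : HasEdgeTenacity M u v t) : t % 2 = 1 := by
  obtain ⟨a, b, -, -, hpa, hpb, rfl⟩ := h
  have : a % 2 = 1 ↔ b % 2 = 1 := hpa.symm.trans hpb
  omega

theorem AltPath.exists_hasAltPath {f : V} {S : Set V} (hf : Unmatched M f)
    (h : AltPath M f 0 v k S) {s : V} (hs : s ∈ S) :
    ∃ j, HasAltPath M s j ∧ j ≤ k ∧ (s ≠ v → j < k) := by
  obtain ⟨j, S', hpath, hjk, hlt⟩ := h.exists_initial_path hs
  exact ⟨j, ⟨f, S', hf, hpath⟩, hjk, hlt⟩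

theorem HasAltPath.extend (h : HasAltPath M u k) (hadj : G.Adj u v)
    (hpar : M.Adj u v ↔ k % 2 = 1) : HasAltPath M v (k + 1) ∨ ∃ j ≤ k, HasAltPath M v j := by
  obtain ⟨f, S, hf, hp⟩ := h
  by_cases hv : v ∈ S
  · obtain ⟨j, hj, hjk, -⟩ := hp.exists_hasAltPath hf hv
    exact Or.inr ⟨j, hjk, hj⟩
  · exact Or.inl ⟨f, _, hf, hp.snoc hadj hpar hv⟩

theorem HasAltPath.exists_isMinlevel_of_adj (h : HasAltPath M u k) (hadj : G.Adj u v)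
    (hpar : M.Adj u v ↔ k % 2 = 1) : ∃ m ≤ k + 1, IsMinlevel M v m := by
  rcases h.extend hadj hpar with h | ⟨j, hj, h⟩ <;> obtain ⟨m, hm, hmk⟩ := h.exists_isMinlevel
  · exact ⟨m, hmk, hm⟩
  · exact ⟨m, by omega, hm⟩

theorem HasAltPath.exists_last (h : HasAltPath M v (k + 1)) :
    ∃ u, HasAltPath M u k ∧ G.Adj u v ∧ (M.Adj u v ↔ k % 2 = 1) := by
  obtain ⟨f, S, hf, hp⟩ := h
  cases hp with
  | snoc hp hadj hpar hv => exact ⟨_, ⟨f, _, hf, hp⟩, hadj, hpar⟩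

theorem HasAltPath.mate (hM : M.IsMatching) (huv : M.Adj u v) (h : HasAltPath M u k)
    (hk : k % 2 = 1) : HasAltPath M v (k + 1) := by
  obtain ⟨f, S, hf, hp⟩ := h
  refine ⟨f, _, hf, hp.snoc huv.adj_sub (by simp [huv, hk]) fun hv => ?_⟩
  have := (hp.mate_mem hM hf hv (Or.inl huv.ne.symm) huv.symm).2
  exact this.elim (absurd rfl) (by omega)

theorem HasAltPath.mate_of_even (hM : M.IsMatching) (huv : M.Adj u v) (h : HasAltPath M v k)
    (hk : k % 2 = 0) : ∃ j, k = j + 1 ∧ HasAltPath M u j := by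
  cases k with
  | zero => exact absurd huv.symm (h.unmatched u)
  | succ k =>
    obtain ⟨w, hw, -, hpar⟩ := h.exists_last
    have := hM.eq_of_adj_right (hpar.2 (by omega)) huv
    exact ⟨k, rfl, this ▸ hw⟩

theorem IsLevel.mate (hM : M.IsMatching) (huv : M.Adj u v) (h : IsLevel M u k) (hk : k % 2 = 1) :
    IsLevel M v (k + 1) := by
  refine ⟨⟨h.hasAltPath.mate hM huv hk, rfl⟩, fun j ⟨hj, hjk⟩ => ?_⟩
  obtain ⟨j, rfl, hj'⟩ := hj.mate_of_even hM huv (by omega)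
  have := h.le hj' (by omega)
  omega

theorem IsLevel.mate_of_even (hM : M.IsMatching) (huv : M.Adj u v) (h : IsLevel M v k)
    (hk : k % 2 = 0) : ∃ j, k = j + 1 ∧ IsLevel M u j := by
  obtain ⟨j, rfl, hj⟩ := h.hasAltPath.mate_of_even hM huv hk
  refine ⟨j, rfl, ⟨hj, rfl⟩, fun n ⟨hn, hnj⟩ => ?_⟩
  have := h.le (hn.mate hM huv (by omega)) (by omega)
  omega

theorem HasTenacity.mate (hM : M.IsMatching) (huv : M.Adj u v) (h : HasTenacity M u t) :
    HasTenacity M v t := by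
  obtain ⟨a, b, ha, hb, hab, rfl⟩ := h
  rcases Nat.mod_two_eq_zero_or_one a with ha0 | ha1
  · obtain ⟨j, rfl, hj⟩ := ha.mate_of_even hM huv.symm ha0
    exact ⟨j, b + 1, hj, hb.mate hM huv (by omega), by omega, by omega⟩
  · obtain ⟨j, rfl, hj⟩ := hb.mate_of_even hM huv.symm (by omega)
    exact ⟨a + 1, j, ha.mate hM huv ha1, hj, by omega, by omega⟩

theorem IsMinlevel.isLevel_of_adj (h : IsMinlevel M v (k + 1)) (hu : HasAltPath M u k)
    (hadj : G.Adj u v) (hpar : M.Adj u v ↔ k % 2 = 1) : IsLevel M u k := by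
  refine ⟨⟨hu, rfl⟩, fun j ⟨hj, hjk⟩ => ?_⟩
  rcases hj.extend hadj (by rw [hpar, hjk]) with hv | ⟨n, hn, hv⟩ <;>
  · have := h.le hv
    omega

theorem IsMinlevel.exists_adj (h : IsMinlevel M v (k + 1)) :
    ∃ u, IsLevel M u k ∧ G.Adj u v ∧ (M.Adj u v ↔ k % 2 = 1) := by
  obtain ⟨u, hu, hadj, hpar⟩ := h.hasAltPath.exists_last
  exact ⟨u, h.isLevel_of_adj hu hadj hpar, hadj, hpar⟩

theorem hasAltPath_iff : HasAltPath M v k ↔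
    ∃ f, ∃ p : G.Walk f v, Unmatched M f ∧ IsAlternatingPath M p ∧ p.length = k := by
  constructor
  · rintro ⟨f, S, hf, hp⟩
    obtain ⟨p, hpath, hlen, -, halt⟩ := hp.exists_walk
    exact ⟨f, p, hf, (isAlternatingPath_iff hf).2 ⟨hpath, halt⟩, by omega⟩
  · rintro ⟨f, p, hf, hp, rfl⟩
    exact ⟨f, _, hf, hp.altPath hf⟩

theorem le_evenlevel_iff {c : ℕ∞} :
    c ≤ evenlevel M v ↔ ∀ k, HasAltPath M v k → k % 2 = 0 → c ≤ k := by
  simp only [evenlevel, le_iInf_iff, hasAltPath_iff, ← Nat.even_iff]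
  grind

theorem le_oddlevel_iff {c : ℕ∞} :
    c ≤ oddlevel M v ↔ ∀ k, HasAltPath M v k → k % 2 = 1 → c ≤ k := by
  simp only [oddlevel, le_iInf_iff, hasAltPath_iff, ← Nat.odd_iff]
  grind

theorem le_minlevel_iff {c : ℕ∞} : c ≤ minlevel M v ↔ ∀ k, HasAltPath M v k → c ≤ k := by
  rw [minlevel, le_min_iff, le_evenlevel_iff, le_oddlevel_iff]
  refine ⟨fun h k hk => ?_, fun h => ⟨fun k hk _ => h k hk, fun k hk _ => h k hk⟩⟩
  exact (Nat.mod_two_eq_zero_or_one k).elim (h.1 k hk) (h.2 k hk)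

theorem eq_natCast_iff_isLeast {x : ℕ∞} {s : Set ℕ} (hx : ∀ c, c ≤ x ↔ ∀ j ∈ s, c ≤ (j : ℕ∞)) :
    x = k ↔ IsLeast s k := by
  have hle : ∀ j ∈ s, x ≤ j := (hx x).1 le_rfl
  constructor
  · rintro rfl
    have hlb : k ∈ lowerBounds s := fun j hj => by exact_mod_cast hle j hj
    refine ⟨?_, hlb⟩
    by_contra hk
    have hsucc : ((k + 1 : ℕ) : ℕ∞) ≤ k := (hx _).2 fun j hj => by
      exact_mod_cast (hlb hj).lt_of_ne fun hkj => hk (hkj ▸ hj)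
    have : k + 1 ≤ k := by exact_mod_cast hsucc
    omega
  · exact fun h => le_antisymm (hle k h.1) ((hx k).2 fun j hj => by exact_mod_cast h.2 hj)

theorem evenlevel_eq_iff : evenlevel M v = k ↔ IsLevel M v k ∧ k % 2 = 0 := by
  rw [eq_natCast_iff_isLeast (s := {j | HasAltPath M v j ∧ j % 2 = 0}) fun c => by
    simp [le_evenlevel_iff]]
  exact ⟨fun h => ⟨by rw [IsLevel, h.1.2]; exact h, h.1.2⟩,
    fun ⟨h, hk⟩ => by rwa [IsLevel, hk] at h⟩

theorem oddlevel_eq_iff : oddlevel M v = k ↔ IsLevel M v k ∧ k % 2 = 1 := by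
  rw [eq_natCast_iff_isLeast (s := {j | HasAltPath M v j ∧ j % 2 = 1}) fun c => by
    simp [le_oddlevel_iff]]
  exact ⟨fun h => ⟨by rw [IsLevel, h.1.2]; exact h, h.1.2⟩,
    fun ⟨h, hk⟩ => by rwa [IsLevel, hk] at h⟩

theorem minlevel_eq_iff : minlevel M v = m ↔ IsMinlevel M v m :=
  eq_natCast_iff_isLeast fun _ => le_minlevel_iff

theorem exists_natCast_of_add_eq {x y : ℕ∞} {c : ℕ} (h : x + y = c) :
    ∃ a b : ℕ, x = a ∧ y = b ∧ a + b = c := by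
  lift x to ℕ using fun hx => by simp [hx] at h
  lift y to ℕ using fun hy => by simp [hy] at h
  exact ⟨x, y, rfl, rfl, by exact_mod_cast h⟩

theorem tenacity_eq_iff : tenacity M v = t ↔ HasTenacity M v t := by
  constructor
  · intro h
    obtain ⟨a, b, ha, hb, rfl⟩ := exists_natCast_of_add_eq h
    obtain ⟨ha, ha0⟩ := evenlevel_eq_iff.1 ha
    obtain ⟨hb, hb1⟩ := oddlevel_eq_iff.1 hb
    exact ⟨a, b, ha, hb, by omega, rfl⟩
  · rintro ⟨a, b, ha, hb, hab, rfl⟩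
    rcases Nat.mod_two_eq_zero_or_one a with ha0 | ha1
    · rw [tenacity, evenlevel_eq_iff.2 ⟨ha, ha0⟩, oddlevel_eq_iff.2 ⟨hb, by omega⟩, Nat.cast_add]
    · rw [tenacity, evenlevel_eq_iff.2 ⟨hb, by omega⟩, oddlevel_eq_iff.2 ⟨ha, ha1⟩, add_comm,
        Nat.cast_add]

theorem edgeTenacity_eq_iff : edgeTenacity M u v = t ↔ HasEdgeTenacity M u v t := by
  unfold edgeTenacity
  constructor
  · intro h
    split_ifs at h with huv <;> obtain ⟨c, d, hc, hd, rfl⟩ := exists_natCast_of_add_eq h <;>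
      obtain ⟨a, b, ha, hb, rfl⟩ := exists_natCast_of_add_eq hc <;>
      obtain rfl : 1 = d := by exact_mod_cast hd
    · obtain ⟨ha, ha1⟩ := oddlevel_eq_iff.1 ha
      obtain ⟨hb, hb1⟩ := oddlevel_eq_iff.1 hb
      exact ⟨a, b, ha, hb, by simp [huv, ha1], by simp [huv, hb1], rfl⟩
    · obtain ⟨ha, ha0⟩ := evenlevel_eq_iff.1 ha
      obtain ⟨hb, hb0⟩ := evenlevel_eq_iff.1 hb
      exact ⟨a, b, ha, hb, by simp [huv, ha0], by simp [huv, hb0], rfl⟩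
  · rintro ⟨a, b, ha, hb, hpa, hpb, rfl⟩
    split_ifs with huv
    · rw [oddlevel_eq_iff.2 ⟨ha, hpa.1 huv⟩, oddlevel_eq_iff.2 ⟨hb, hpb.1 huv⟩]
      norm_cast
    · rw [hpa] at huv
      rw [evenlevel_eq_iff.2 ⟨ha, by omega⟩, evenlevel_eq_iff.2 ⟨hb, by grind⟩]
      norm_cast

theorem maxlevel_eq (hm : IsMinlevel M v m) (ha : IsLevel M v a) (hma : m % 2 ≠ a % 2) :
    maxlevel M v = a := by
  have hle : (m : ℕ∞) ≤ a := by exact_mod_cast hm.le ha.hasAltPath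
  rcases Nat.mod_two_eq_zero_or_one a with ha0 | ha1
  · rw [maxlevel, evenlevel_eq_iff.2 ⟨ha, ha0⟩, oddlevel_eq_iff.2 ⟨hm.isLevel, by omega⟩,
      max_eq_left hle]
  · rw [maxlevel, oddlevel_eq_iff.2 ⟨ha, ha1⟩, evenlevel_eq_iff.2 ⟨hm.isLevel, by omega⟩,
      max_eq_right hle]

theorem IsPredecessor.exists_isMinlevel (h : IsPredecessor M u v) :
    ∃ k, IsMinlevel M v (k + 1) ∧ HasAltPath M u k ∧ G.Adj u v ∧ (M.Adj u v ↔ k % 2 = 1) := by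
  obtain ⟨f, p, hf, hp, hlen, hnil, rfl⟩ := h
  have hadj := p.adj_penultimate hnil
  have hmin := minlevel_eq_iff.1 hlen.symm
  rw [← SimpleGraph.Walk.length_dropLast_add_one hnil] at hmin
  rw [isAlternatingPath_iff hf, ← SimpleGraph.Walk.concat_dropLast hadj,
    SimpleGraph.Walk.concat_isPath_iff, alternatesFrom_concat, zero_add] at hp
  exact ⟨_, hmin, ⟨f, _, hf,
    ((isAlternatingPath_iff hf).2 ⟨hp.1.1, hp.2.1⟩).altPath hf⟩, hadj, hp.2.2⟩

theorem isPredecessor_iff : IsPredecessor M u v ↔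
    ∃ k, IsMinlevel M v (k + 1) ∧ IsLevel M u k ∧ G.Adj u v ∧ (M.Adj u v ↔ k % 2 = 1) := by
  constructor
  · intro h
    obtain ⟨k, hv, hu, hadj, hpar⟩ := h.exists_isMinlevel
    exact ⟨k, hv, hv.isLevel_of_adj hu hadj hpar, hadj, hpar⟩
  · rintro ⟨k, hmin, ⟨⟨⟨f, S, hf, hp⟩, -⟩, -⟩, hadj, hpar⟩
    have hv : v ∉ S := fun hv => by
      obtain ⟨j, hj, hjk, -⟩ := hp.exists_hasAltPath hf hv
      have := hmin.le hj
      omega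
    obtain ⟨p, hpath, rfl, hsupp, halt⟩ := hp.exists_walk
    refine ⟨f, p.concat hadj, hf, (isAlternatingPath_iff hf).2
      ⟨hpath.concat (by rwa [hsupp]) hadj, alternatesFrom_concat.2 ⟨halt, hpar⟩⟩, ?_, ?_, by simp⟩
    · rw [minlevel_eq_iff.2 hmin, p.length_concat, zero_add]
    · rw [SimpleGraph.Walk.not_nil_iff_lt_length, p.length_concat]
      omega

end Levels

/-! ### Lower bounds on the lengths of alternating paths -/

section Bridges

variable {u v : V} {a b i t : ℕ}

/-- The level `a` of `v` is known when the search at level `i` begins. -/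
def KnownBefore (M : G.Subgraph) (i : ℕ) (v : V) (a : ℕ) : Prop :=
  (IsMinlevel M v a ∧ a ≤ i) ∨ ∃ t, HasTenacity M v t ∧ t + 1 ≤ 2 * i

theorem IsLevel.knownBefore (h : IsLevel M v a) (hai : a ≤ i) : KnownBefore M i v a := by
  obtain ⟨m, hm, rfl | ⟨hma, -, ht⟩⟩ := h.exists_isMinlevel
  · exact Or.inl ⟨hm, hai⟩
  · exact Or.inr ⟨_, ht, by omega⟩

theorem IsBridge.symm (h : IsBridge M u v) : IsBridge M v u := ⟨h.1.symm, fun h' => h.2 h'.symm⟩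

theorem IsBridge.not_isMinlevel_succ (h : IsBridge M u v) (ha : IsLevel M u a)
    (hpar : M.Adj u v ↔ a % 2 = 1) : ¬ IsMinlevel M v (a + 1) := fun hm =>
  h.2 (Or.inl (isPredecessor_iff.2 ⟨a, hm, ha, h.1, hpar⟩))

theorem IsBridge.exists_isMinlevel_lt (h : IsBridge M u v) (ha : IsLevel M u a)
    (hb : IsLevel M v b) (hua : M.Adj u v ↔ a % 2 = 1) (hub : M.Adj u v ↔ b % 2 = 1)
    (hab : a < b) : ∃ m, IsMinlevel M v m ∧ m < a ∧ m % 2 ≠ b % 2 := by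
  have hpar : a % 2 = 1 ↔ b % 2 = 1 := hua.symm.trans hub
  obtain ⟨m, hma, hm⟩ := ha.hasAltPath.exists_isMinlevel_of_adj h.1 hua
  have hmb : m % 2 ≠ b % 2 := fun hmb => by
    have := hm.isLevel.unique hb hmb
    omega
  have hne : m ≠ a + 1 := by
    rintro rfl
    exact h.not_isMinlevel_succ ha hua hm
  exact ⟨m, hm, by omega, hmb⟩

theorem IsBridge.not_lt_of_matched (hM : M.IsMatching) (h : IsBridge M u v) (huv : M.Adj u v)
    (ha : IsLevel M u a) (hb : IsLevel M v b) (ha1 : a % 2 = 1) (hb1 : b % 2 = 1) : ¬ a < b := by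
  intro hab
  obtain ⟨m, hm, hma, hmb⟩ :=
    h.exists_isMinlevel_lt ha hb (by simp [huv, ha1]) (by simp [huv, hb1]) hab
  have := hm.isLevel.unique (ha.mate hM huv ha1) (by omega)
  omega

theorem IsBridge.eq_of_matched (hM : M.IsMatching) (h : IsBridge M u v) (huv : M.Adj u v)
    (ha : IsLevel M u a) (hb : IsLevel M v b) (ha1 : a % 2 = 1) (hb1 : b % 2 = 1) : a = b := by
  have hab := h.not_lt_of_matched hM huv ha hb ha1 hb1
  have hba := h.symm.not_lt_of_matched hM huv.symm hb ha hb1 ha1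
  omega

theorem IsBridge.knownBefore (h : IsBridge M u v) (ha : IsLevel M u a) (hb : IsLevel M v b)
    (hua : M.Adj u v ↔ a % 2 = 1) (hub : M.Adj u v ↔ b % 2 = 1) (hab : a + b = 2 * i) :
    KnownBefore M i u a := by
  by_cases hai : a ≤ i
  · exact ha.knownBefore hai
  · obtain ⟨m, hm, hma, hmb⟩ := h.symm.exists_isMinlevel_lt hb ha (by rw [M.adj_comm, hub])
      (by rw [M.adj_comm, hua]) (by omega)
    exact Or.inr ⟨m + a, ⟨m, a, hm.isLevel, ha, hmb, rfl⟩, by omega⟩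

end Bridges

section Dual

open Classical in
/-- The indicator of `u` and `v` lying in the same class of the partition into fibres of `β`. -/
noncomputable def sameClass (β : V → V) (u v : V) : ℤ := if β u = β v then 1 else 0

/-- The number of `j < n` such that `u` and `v` are in the same class of `β j`. -/
noncomputable def common (β : ℕ → V → V) (n : ℕ) (u v : V) : ℤ :=
  ∑ j ∈ Finset.range n, sameClass (β j) u v

theorem sameClass_of_eq {β : V → V} {u v : V} (h : β u = β v) : sameClass β u v = 1 := if_pos h

theorem sameClass_of_ne {β : V → V} {u v : V} (h : β u ≠ β v) : sameClass β u v = 0 := if_neg h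

theorem sameClass_nonneg (β : V → V) (u v : V) : 0 ≤ sameClass β u v := by
  unfold sameClass
  split_ifs <;> norm_num

theorem sameClass_le_one (β : V → V) (u v : V) : sameClass β u v ≤ 1 := by
  unfold sameClass
  split_ifs <;> norm_num

theorem common_nonneg (β : ℕ → V → V) (n : ℕ) (u v : V) : 0 ≤ common β n u v :=
  Finset.sum_nonneg fun _ _ => sameClass_nonneg _ _ _

theorem common_succ (β : ℕ → V → V) (n : ℕ) (u v : V) :
    common β (n + 1) u v = common β n u v + sameClass (β n) u v := Finset.sum_range_succ _ _

theorem common_le {β : ℕ → V → V} {n m : ℕ} {u v : V} (hmn : m ≤ n)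
    (h : ∀ j < m, β j u ≠ β j v) : common β n u v ≤ n - m := by
  induction n, hmn using Nat.le_induction with
  | base =>
    rw [sub_self]
    exact (Finset.sum_eq_zero fun j hj => sameClass_of_ne (h j (Finset.mem_range.1 hj))).le
  | succ n _ ih =>
    have := sameClass_le_one (β n) u v
    rw [common_succ]
    push_cast
    linarith

theorem le_common {β : ℕ → V → V} {n m : ℕ} {u v : V} (hmn : m ≤ n)
    (h : ∀ j, m ≤ j → j < n → β j u = β j v) : (n : ℤ) - m ≤ common β n u v := by
  induction n, hmn using Nat.le_induction with
  | base => simpa using common_nonneg β m u v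
  | succ n hmn ih =>
    have := ih fun j hmj hjn => h j hmj (by omega)
    rw [common_succ, sameClass_of_eq (h n hmn (by omega))]
    push_cast
    linarith

/-- A solution of the dual of the linear program that bounds the lengths of alternating paths:
`E` assigns a value to each vertex, and the classes of each of the `n` partitions `β j` contribute
twice their number of common memberships. -/
structure IsDualSolution (M : G.Subgraph) (n : ℕ) (β : ℕ → V → V) (E : V → ℤ) (T : ℤ) : Prop where
  mate : ∀ j < n, ∀ v w, β j v ≠ v → M.Adj v w → β j w = β j v ∧ β j w ≠ w
  unmatched_edge : ∀ u v, G.Adj u v → ¬ M.Adj u v → T ≤ E u + E v + 1 + 2 * common β n u v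
  matched_edge : ∀ u v, M.Adj u v → E u + E v + 2 * common β n u v ≤ T + 1

/-- The bounds on the number `s` of unmatched minus matched edges inside the classes of `β` on an
alternating path of length `k` to `v` with vertex set `S`. Such a path enters each class through its
base, or through an unmatched edge. -/
def ExcessBound (β : V → V) (S : Set V) (v : V) (k : ℕ) (s : ℤ) : Prop :=
  (k % 2 = 0 → s ≤ 0 ∧ (β v ∉ S → s ≤ -1)) ∧
    (k % 2 = 1 → s ≤ 1 ∧ (β v = v ∨ β v ∉ S → s ≤ 0))

variable {b : V → V} {u v : V} {k n : ℕ} {s : ℤ} {S : Set V}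

theorem ExcessBound.nonpos (h : ExcessBound b S v k s) (hv : b v = v) : s ≤ 0 := by
  rcases Nat.mod_two_eq_zero_or_one k with hk | hk
  · exact (h.1 hk).1
  · exact (h.2 hk).2 (Or.inl hv)

theorem ExcessBound.snoc_unmatched (h : ExcessBound b S u k s) (hk : k % 2 = 0) (hv : v ∉ S) :
    ExcessBound b (insert v S) v (k + 1) (s + sameClass b u v) := by
  obtain ⟨hs, hs_neg⟩ := h.1 hk
  refine ⟨by omega, fun _ => ?_⟩
  by_cases huv : b u = b v
  · rw [sameClass_of_eq huv]
    refine ⟨by omega, fun hbv => ?_⟩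
    have hbu : b u ∉ S := by
      rw [huv]
      rcases hbv with hbv | hbv
      · rwa [hbv]
      · exact fun hmem => hbv (Set.mem_insert_of_mem _ hmem)
    have := hs_neg hbu
    omega
  · rw [sameClass_of_ne huv]
    exact ⟨by omega, fun _ => by omega⟩

theorem ExcessBound.snoc_matched (h : ExcessBound b S u k s) (hk : k % 2 = 1) (huv : M.Adj u v)
    (hmate : ∀ v w, b v ≠ v → M.Adj v w → b w = b v ∧ b w ≠ w) :
    ExcessBound b (insert v S) v (k + 1) (s - sameClass b u v) := by
  obtain ⟨hs, hs_nonpos⟩ := h.2 hk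
  refine ⟨fun _ => ?_, by omega⟩
  by_cases hu : b u = u
  · have hv : b v = v := by
      by_contra hv
      exact (hmate v u hv huv.symm).2 hu
    rw [sameClass_of_ne (by rw [hu, hv]; exact huv.ne), hv]
    have := hs_nonpos (Or.inl hu)
    exact ⟨by omega, absurd (Set.mem_insert v S)⟩
  · rw [sameClass_of_eq (hmate u v hu huv).1.symm]
    refine ⟨by omega, fun hbv => ?_⟩
    have hbu : b u ∉ S := fun hbu =>
      hbv (Set.mem_insert_of_mem _ ((hmate u v hu huv).1 ▸ hbu))
    have := hs_nonpos (Or.inr hbu)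
    omega

variable {β : ℕ → V → V} {E : V → ℤ} {T : ℤ} {f : V}

theorem IsDualSolution.exists_excessBound (h : IsDualSolution M n β E T)
    (hfree : ∀ j < n, β j f = f) (hE : E f = 0) (hp : AltPath M f 0 v k S) :
    ∃ s : ℕ → ℤ, (∀ j < n, ExcessBound (β j) S v k (s j)) ∧
      (k % 2 = 0 → E v - 2 * ∑ j ∈ Finset.range n, s j ≤ k) ∧
      (k % 2 = 1 → T - 2 * ∑ j ∈ Finset.range n, s j ≤ k + E v) := by
  induction hp with
  | nil =>
    refine ⟨0, fun j hj => ⟨fun _ => ⟨le_rfl, fun hf => ?_⟩, by omega⟩, by simp [hE], by omega⟩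
    exact absurd (hfree j hj) hf
  | @snoc u v k S _ hadj hpar hv ih =>
    obtain ⟨s, hs, heven, hodd⟩ := ih
    rcases Nat.mod_two_eq_zero_or_one k with hk | hk
    · refine ⟨fun j => s j + sameClass (β j) u v, fun j hj => (hs j hj).snoc_unmatched hk hv,
        by omega, fun _ => ?_⟩
      have hle := heven hk
      have hedge := h.unmatched_edge u v hadj (by rw [hpar]; omega)
      rw [Finset.sum_add_distrib, ← common]
      push_cast
      linarith
    · have huv := hpar.2 hk
      refine ⟨fun j => s j - sameClass (β j) u v,
        fun j hj => (hs j hj).snoc_matched hk huv (h.mate j hj), fun _ => ?_, by omega⟩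
      have hle := hodd hk
      have hedge := h.matched_edge u v huv
      rw [Finset.sum_sub_distrib, ← common]
      push_cast
      linarith

theorem IsDualSolution.le_length (h : IsDualSolution M n β E T) (hfree : ∀ j < n, β j f = f)
    (hE : E f = 0) (hp : AltPath M f 0 v k S) (hv : ∀ j < n, β j v = v) :
    (k % 2 = 0 → E v ≤ k) ∧ (k % 2 = 1 → T ≤ k + E v) := by
  obtain ⟨s, hs, heven, hodd⟩ := h.exists_excessBound hfree hE hp
  have hsum : ∑ j ∈ Finset.range n, s j ≤ 0 := Finset.sum_nonpos fun j hj => by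
    have hj := Finset.mem_range.1 hj
    exact (hs j hj).nonpos (hv j hj)
  exact ⟨fun hk => by linarith [heven hk], fun hk => by linarith [hodd hk]⟩

end Dual

/-- `β` maps every vertex to the base of its blossom, where the blossoms are those of
tenacity at most `2 j + 1`. -/
structure IsBlossomBase (M : G.Subgraph) (j : ℕ) (β : V → V) : Prop where
  mate : ∀ v w, β v ≠ v → M.Adj v w → β w = β v ∧ β w ≠ w
  ne_iff : ∀ v, β v ≠ v ↔ ∃ t, HasTenacity M v t ∧ t ≤ 2 * j + 1
  edge : ∀ u v t, G.Adj u v → ¬ M.Adj u v → HasEdgeTenacity M u v t → t ≤ 2 * j + 1 → β u = β v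

/-- What is immediate about the bases `β` of the blossoms found up to search level `i`: all blossoms
are genuine, and the only way to violate `IsBlossomBase M i β` is to miss a vertex of tenacity
`2 i + 1`. -/
structure IsSoundBase (M : G.Subgraph) (i : ℕ) (β : V → V) : Prop where
  exists_mate : ∀ v, β v ≠ v → ∃ w, M.Adj v w
  mate : ∀ v w, β v ≠ v → M.Adj v w → β w = β v ∧ β w ≠ w
  tenacity_le : ∀ v, β v ≠ v → ∃ t, HasTenacity M v t ∧ t ≤ 2 * i + 1
  ne_of_tenacity : ∀ v t, HasTenacity M v t → t + 1 ≤ 2 * i → β v ≠ v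
  bridge : ∀ u v, IsBridge M u v → HasEdgeTenacity M u v (2 * i + 1) → β u = β v
  predecessor : ∀ u v, β v ≠ v → IsPredecessor M u v → β u = β v
  edge : ∀ u v t, G.Adj u v → ¬ M.Adj u v → HasEdgeTenacity M u v t → t + 1 ≤ 2 * i → β u = β v

/-- `e` is the dual variable of `v` after the search at level `i`, shifted so that it is `0` at the
unmatched vertices. Apart from the vertices in blossoms, the cases are those of Edmonds' algorithm:
outer vertices, inner vertices, and vertices that the search has not reached. -/
inductive DualValue (M : G.Subgraph) (i : ℕ) (β : V → V) (v : V) (e : ℕ) : Prop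
  | blossom (hv : β v ≠ v) (he : IsLevel M v e) (he0 : e % 2 = 0)
  | outer (hv : β v = v) (he : IsMinlevel M v e) (he0 : e % 2 = 0) (hle : e ≤ i + 1)
  | inner (o : ℕ) (hv : β v = v) (ho : IsMinlevel M v o) (ho1 : o % 2 = 1) (hle : o ≤ i + 1)
      (hsum : e + o = 2 * i + 3)
  | unreached (hv : β v = v) (hle : ∀ k, HasAltPath M v k → i + 2 ≤ k) (he : e = i + 2)

section DualValue

variable {β : V → V} {i a b o e e' m k : ℕ} {u v : V}

theorem exists_dualValue (h : β v ≠ v → ∃ t, HasTenacity M v t) : ∃ e, DualValue M i β v e := by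
  by_cases hv : β v = v
  · by_cases hex : ∃ k ≤ i + 1, HasAltPath M v k
    · obtain ⟨k, hk, hpath⟩ := hex
      obtain ⟨m, hm, hmk⟩ := hpath.exists_isMinlevel
      rcases Nat.mod_two_eq_zero_or_one m with hm0 | hm1
      · exact ⟨m, .outer hv hm hm0 (by omega)⟩
      · exact ⟨2 * i + 3 - m, .inner m hv hm hm1 (by omega) (by omega)⟩
    · refine ⟨i + 2, .unreached hv (fun k hk => ?_) rfl⟩
      by_contra hlt
      exact hex ⟨k, by omega, hk⟩
  · obtain ⟨t, a, b, ha, hb, hab, -⟩ := h hv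
    rcases Nat.mod_two_eq_zero_or_one a with ha0 | ha1
    · exact ⟨a, .blossom hv ha ha0⟩
    · exact ⟨b, .blossom hv hb (by omega)⟩

theorem DualValue.isLevel_or_add_eq (h : DualValue M i β v e) :
    (IsLevel M v e ∧ e % 2 = 0 ∧ (β v ≠ v ∨ IsMinlevel M v e)) ∨
      (i + 2 ≤ e ∧ ∀ m, IsMinlevel M v m → m ≤ i + 1 → e + m = 2 * i + 3) := by
  rcases h with ⟨hv, he, he0⟩ | ⟨-, he, he0, -⟩ | ⟨o, -, ho, ho1, hle, hsum⟩ | ⟨-, hle, he⟩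
  · exact Or.inl ⟨he, he0, Or.inl hv⟩
  · exact Or.inl ⟨he.isLevel, he0, Or.inr he⟩
  · refine Or.inr ⟨by omega, fun m hm _ => ?_⟩
    obtain rfl := hm.unique ho
    exact hsum
  · refine Or.inr ⟨by omega, fun m hm hmi => ?_⟩
    have := hle m hm.hasAltPath
    omega

theorem DualValue.isLevel_of_ne (h : DualValue M i β v e) (hv : β v ≠ v) :
    IsLevel M v e ∧ e % 2 = 0 := by
  rcases h with ⟨-, he, he0⟩ | ⟨hv', -⟩ | ⟨-, hv', -⟩ | ⟨hv', -⟩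
  · exact ⟨he, he0⟩
  all_goals exact absurd hv' hv

theorem DualValue.eq_zero (h : DualValue M i β v e) (hv : β v = v) (hf : Unmatched M v) :
    e = 0 := by
  have hmin : IsMinlevel M v 0 := ⟨hf.hasAltPath_zero, fun _ _ => Nat.zero_le _⟩
  rcases h with ⟨hv', -⟩ | ⟨-, he, -⟩ | ⟨o, -, ho, ho1, -⟩ | ⟨-, hle, -⟩
  · exact absurd hv hv'
  · exact he.unique hmin
  · have := ho.unique hmin
    omega
  · have := hle 0 hmin.hasAltPath
    omega

theorem DualValue.le_add_of_not_adj (hv : DualValue M i β v e') (hadj : G.Adj u v)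
    (huv : ¬ M.Adj u v) (hle : i + 2 ≤ e)
    (hmin : ∀ m, IsMinlevel M u m → m ≤ i + 1 → e + m = 2 * i + 3) : 2 * i + 2 ≤ e + e' := by
  by_cases hi : i ≤ e'
  · omega
  · rcases hv.isLevel_or_add_eq with ⟨he', he'0, -⟩ | ⟨hle', -⟩
    · obtain ⟨m, hm, hmu⟩ := he'.hasAltPath.exists_isMinlevel_of_adj hadj.symm
        (iff_of_false (fun h => huv h.symm) (by omega))
      have := hmin m hmu (by omega)
      omega
    · omega

theorem isBridge_of_isMinlevel (huv : M.Adj u v) (hu : IsMinlevel M u a) (hv : IsMinlevel M v b)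
    (ha : a % 2 = 1) (hb : b % 2 = 1) : IsBridge M u v := by
  refine ⟨huv.adj_sub, ?_⟩
  rintro (h | h) <;> obtain ⟨k, hk, -, -, hpar⟩ := isPredecessor_iff.1 h
  · have := hk.unique hv
    have := hpar.1 huv
    omega
  · have := hk.unique hu
    have := hpar.1 huv.symm
    omega

theorem IsMinlevel.le_of_unreached_mate (hM : M.IsMatching) (huv : M.Adj u v)
    (hu : IsMinlevel M u o) (ho : o % 2 = 1) (hv : ∀ k, HasAltPath M v k → i + 2 ≤ k) :
    i + 1 ≤ o := by
  have := hv _ (hu.hasAltPath.mate hM huv ho)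
  omega

namespace IsSoundBase

theorem eq_of_unmatched (h : IsSoundBase M i β) (hv : Unmatched M v) : β v = v := by
  by_contra hne
  obtain ⟨w, hw⟩ := h.exists_mate v hne
  exact hv w hw

theorem eq_of_isPredecessor (h : IsSoundBase M i β) (hpred : IsPredecessor M u v)
    (huv : ¬ M.Adj u v) (hb0 : b % 2 = 0) (hv : β v ≠ v ∨ IsMinlevel M v b) : β u = β v := by
  refine h.predecessor u v (hv.elim id fun hv => ?_) hpred
  obtain ⟨k, hk, -, -, hpar⟩ := isPredecessor_iff.1 hpred
  have := hk.unique hv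
  have : ¬ k % 2 = 1 := fun hk1 => huv (hpar.2 hk1)
  omega

theorem eq_of_edge (h : IsSoundBase M i β) (hadj : G.Adj u v) (huv : ¬ M.Adj u v)
    (ha : IsLevel M u a) (ha0 : a % 2 = 0) (hu : β u ≠ u ∨ IsMinlevel M u a)
    (hb : IsLevel M v b) (hb0 : b % 2 = 0) (hv : β v ≠ v ∨ IsMinlevel M v b)
    (hab : a + b ≤ 2 * i) : β u = β v := by
  have hten : HasEdgeTenacity M u v (a + b + 1) :=
    ⟨a, b, ha, hb, iff_of_false huv (by omega), iff_of_false huv (by omega), rfl⟩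
  by_cases hlt : a + b + 1 + 1 ≤ 2 * i
  · exact h.edge u v _ hadj huv hten hlt
  · by_cases hprop : IsProp M u v
    · rcases hprop with hpred | hpred
      · exact h.eq_of_isPredecessor hpred huv hb0 hv
      · exact (h.eq_of_isPredecessor hpred (fun h => huv h.symm) ha0 hu).symm
    · exact h.bridge u v ⟨hadj, hprop⟩ (by rwa [show 2 * i + 1 = a + b + 1 by omega])

theorem add_le_of_outer (h : IsSoundBase M i β) (hM : M.IsMatching) (huv : M.Adj u v)
    (hbv : β v = v) (hu : IsMinlevel M u e) (he0 : e % 2 = 0) (hle : e ≤ i + 1)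
    (hv : DualValue M i β v e') : e + e' ≤ 2 * i + 4 := by
  obtain ⟨j, rfl, hj⟩ := hu.isLevel.mate_of_even hM huv.symm he0
  rcases hv with ⟨hv, -⟩ | ⟨-, he', he'0, -⟩ | ⟨o, -, ho, ho1, -, hsum⟩ | ⟨-, hle', -⟩
  · exact absurd hbv hv
  · have := he'.le hj.hasAltPath
    exact absurd hbv (h.ne_of_tenacity v (e' + j) ⟨e', j, he'.isLevel, hj, by omega, rfl⟩
      (by omega))
  · have := ho.isLevel.unique hj (by omega)
    omega
  · have := hle' j hj.hasAltPath
    omega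

theorem le_add_of_inner (h : IsSoundBase M i β) (hM : M.IsMatching) (huv : M.Adj u v)
    (hbu : β u = u) (hbv : β v = v) (hu : IsMinlevel M u a) (ha1 : a % 2 = 1)
    (hv : IsMinlevel M v b) (hb1 : b % 2 = 1) : 2 * i + 1 < a + b + 1 := by
  have hten : HasTenacity M u (a + (b + 1)) :=
    ⟨a, b + 1, hu.isLevel, hv.isLevel.mate hM huv.symm hb1, by omega, rfl⟩
  by_contra hlt
  by_cases hold : a + (b + 1) + 1 ≤ 2 * i
  · exact h.ne_of_tenacity u _ hten hold hbu
  · have hedge : HasEdgeTenacity M u v (2 * i + 1) :=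
      ⟨a, b, hu.isLevel, hv.isLevel, by simp [huv, ha1], by simp [huv, hb1], by omega⟩
    have := h.bridge u v (isBridge_of_isMinlevel huv hu hv ha1 hb1) hedge
    rw [hbu, hbv] at this
    exact huv.ne this

theorem add_le_of_matched (h : IsSoundBase M i β) (hM : M.IsMatching) (huv : M.Adj u v)
    (hu : DualValue M i β u e) (hv : DualValue M i β v e') (hbu : β u = u) (hbv : β v = v) :
    e + e' ≤ 2 * i + 4 := by
  cases hu with
  | blossom hu => exact absurd hbu hu
  | outer _ he he0 hle => exact h.add_le_of_outer hM huv hbv he he0 hle hv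
  | inner o _ ho ho1 hle hsum =>
    cases hv with
    | blossom hv => exact absurd hbv hv
    | outer _ he' he'0 hle' =>
      have := h.add_le_of_outer hM huv.symm hbu he' he'0 hle' (.inner o hbu ho ho1 hle hsum)
      omega
    | inner o' _ ho' ho'1 hle' hsum' =>
      have := h.le_add_of_inner hM huv hbu hbv ho ho1 ho' ho'1
      omega
    | unreached _ hle' he' =>
      have := ho.le_of_unreached_mate hM huv ho1 hle'
      omega
  | unreached _ hle he =>
    cases hv with
    | blossom hv => exact absurd hbv hv
    | outer _ he' he'0 hle' =>
      have := h.add_le_of_outer hM huv.symm hbu he' he'0 hle' (.unreached hbu hle he)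
      omega
    | inner o' _ ho' ho'1 hle' hsum' =>
      have := ho'.le_of_unreached_mate hM huv.symm ho'1 hle
      omega
    | unreached _ hle' he' => omega

end IsSoundBase

end DualValue

/-- The bases of the blossoms of the tenacities below `2 i + 1`, followed by those of the blossoms
found up to search level `i`. -/
structure IsBlossomTower (M : G.Subgraph) (i : ℕ) (δ : ℕ → V → V) : Prop where
  base : ∀ j < i, IsBlossomBase M j (δ j)
  last : IsSoundBase M i (δ i)

namespace IsBlossomTower

variable {δ : ℕ → V → V} {i j a b m k t : ℕ} {u v w : V} {E : V → ℕ}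

theorem mate (h : IsBlossomTower M i δ) (hj : j < i + 1) (hv : δ j v ≠ v) (hvw : M.Adj v w) :
    δ j w = δ j v ∧ δ j w ≠ w := by
  rcases Nat.lt_succ_iff_lt_or_eq.1 hj with hj | rfl
  · exact (h.base j hj).mate v w hv hvw
  · exact h.last.mate v w hv hvw

theorem apply_eq (h : IsBlossomTower M i δ) (hv : δ i v = v) (hj : j < i + 1) : δ j v = v := by
  rcases Nat.lt_succ_iff_lt_or_eq.1 hj with hj | rfl
  · by_contra hne
    obtain ⟨t, ht, hle⟩ := ((h.base j hj).ne_iff v).1 hne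
    exact h.last.ne_of_tenacity v t ht (by omega) hv
  · exact hv

theorem apply_eq_of_lt (h : IsBlossomTower M i δ) (hv : HasTenacity M v t) (hj : j < i)
    (hjt : 2 * j + 1 < t) : δ j v = v := by
  by_contra hne
  obtain ⟨s, hs, hle⟩ := ((h.base j hj).ne_iff v).1 hne
  have := hs.unique hv
  omega

theorem le_of_isLevel (h : IsBlossomTower M i δ) (hadj : G.Adj u v) (huv : ¬ M.Adj u v)
    (ha : IsLevel M u a) (ha0 : a % 2 = 0) (hu : δ i u ≠ u ∨ IsMinlevel M u a)
    (hb : IsLevel M v b) (hb0 : b % 2 = 0) (hv : δ i v ≠ v ∨ IsMinlevel M v b) :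
    (2 * i + 3 : ℤ) ≤ a + b + 1 + 2 * common δ (i + 1) u v := by
  have hnonneg := common_nonneg δ (i + 1) u v
  by_cases hlt : a + b ≤ 2 * i
  · have hten : HasEdgeTenacity M u v (a + b + 1) :=
      ⟨a, b, ha, hb, iff_of_false huv (by omega), iff_of_false huv (by omega), rfl⟩
    have hcommon := le_common (β := δ) (n := i + 1) (m := (a + b) / 2) (u := u) (v := v) (by omega)
      fun j hmj hji => by
        rcases Nat.lt_succ_iff_lt_or_eq.1 hji with hji | rfl
        · exact (h.base j hji).edge u v _ hadj huv hten (by omega)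
        · exact h.last.eq_of_edge hadj huv ha ha0 hu hb hb0 hv hlt
    omega
  · omega

theorem le_of_not_adj (h : IsBlossomTower M i δ) (hE : ∀ v, DualValue M i (δ i) v (E v))
    (hadj : G.Adj u v) (huv : ¬ M.Adj u v) :
    (2 * i + 3 : ℤ) ≤ E u + E v + 1 + 2 * common δ (i + 1) u v := by
  have hnonneg := common_nonneg δ (i + 1) u v
  rcases (hE u).isLevel_or_add_eq with ⟨ha, ha0, hu⟩ | ⟨hle, hmin⟩
  · rcases (hE v).isLevel_or_add_eq with ⟨hb, hb0, hv⟩ | ⟨hle, hmin⟩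
    · exact h.le_of_isLevel hadj huv ha ha0 hu hb hb0 hv
    · have := (hE u).le_add_of_not_adj hadj.symm (fun h => huv h.symm) hle hmin
      omega
  · have := (hE v).le_add_of_not_adj hadj huv hle hmin
    omega

theorem add_le_of_matched (h : IsBlossomTower M i δ) (hM : M.IsMatching)
    (hE : ∀ v, DualValue M i (δ i) v (E v)) (huv : M.Adj u v) :
    (E u + E v + 2 * common δ (i + 1) u v : ℤ) ≤ 2 * i + 3 + 1 := by
  by_cases hu : δ i u = u
  · have hv : δ i v = v := by
      by_contra hv
      exact (h.last.mate v u hv huv.symm).2 hu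
    have hle := h.last.add_le_of_matched hM huv (hE u) (hE v) hu hv
    have hcommon := common_le (β := δ) (n := i + 1) (m := i + 1) (u := u) (v := v) le_rfl
      fun j hj => by rw [h.apply_eq hu hj, h.apply_eq hv hj]; exact huv.ne
    omega
  · have hv := (h.last.mate u v hu huv).2
    obtain ⟨hEu, hEu0⟩ := (hE u).isLevel_of_ne hu
    obtain ⟨hEv, hEv0⟩ := (hE v).isLevel_of_ne hv
    obtain ⟨o, hEo, ho⟩ := hEu.mate_of_even hM huv.symm hEu0
    have htv : HasTenacity M v (o + E v) := ⟨o, E v, ho, hEv, by omega, rfl⟩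
    have htu : HasTenacity M u (o + E v) := htv.mate hM huv.symm
    obtain ⟨t, ht, hti⟩ := h.last.tenacity_le v hv
    obtain rfl := ht.unique htv
    have hcommon := common_le (β := δ) (n := i + 1) (m := (o + E v) / 2) (u := u) (v := v)
      (by omega) fun j hj => by
        rw [h.apply_eq_of_lt htu (by omega) (by omega), h.apply_eq_of_lt htv (by omega) (by omega)]
        exact huv.ne
    omega

theorem isDualSolution (h : IsBlossomTower M i δ) (hM : M.IsMatching)
    (hE : ∀ v, DualValue M i (δ i) v (E v)) :
    IsDualSolution M (i + 1) δ (fun v => E v) (2 * i + 3) where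
  mate _ hj _ _ := h.mate hj
  unmatched_edge _ _ := h.le_of_not_adj hE
  matched_edge _ _ := h.add_le_of_matched hM hE

theorem lt_minlevel_add (h : IsBlossomTower M i δ) (hM : M.IsMatching) (hv : δ i v = v)
    (hm : IsMinlevel M v m) (hk : HasAltPath M v k) (hmk : m % 2 ≠ k % 2) :
    2 * i + 1 < m + k := by
  have hex : ∀ v, ∃ e, DualValue M i (δ i) v e := fun v =>
    exists_dualValue fun hne => (h.last.tenacity_le v hne).imp fun _ ht => ht.1
  choose E hE using hex
  obtain ⟨f, S, hf, hp⟩ := id hk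
  have hbf := h.last.eq_of_unmatched hf
  obtain ⟨heven, hodd⟩ := (h.isDualSolution hM hE).le_length (fun j hj => h.apply_eq hbf hj)
    (by exact_mod_cast (hE f).eq_zero hbf hf) hp fun j hj => h.apply_eq hv hj
  have hle := hm.le hk
  cases hE v with
  | blossom hne => exact absurd hv hne
  | outer _ he he0 =>
    have := he.unique hm
    have := hodd (by omega)
    omega
  | inner o _ ho ho1 _ hsum =>
    have := ho.unique hm
    have := heven (by omega)
    omega
  | unreached _ hle' =>
    have := hle' m hm.hasAltPath
    omega

theorem ne_of_hasTenacity (h : IsBlossomTower M i δ) (hM : M.IsMatching) (ht : HasTenacity M v t)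
    (hti : t ≤ 2 * i + 1) : δ i v ≠ v := by
  intro hv
  obtain ⟨a, b, ha, hb, hab, rfl⟩ := ht
  obtain ⟨m, hm, rfl | ⟨-, hpar, -⟩⟩ := ha.exists_isMinlevel
  · have := h.lt_minlevel_add hM hv hm hb.hasAltPath hab
    omega
  · obtain rfl := hm.isLevel.unique hb (by omega)
    have := h.lt_minlevel_add hM hv hm ha.hasAltPath hpar
    omega

end IsBlossomTower

theorem IsSoundBase.ne_of_hasTenacity (hM : M.IsMatching) {i t : ℕ} {β : V → V}
    (h : IsSoundBase M i β) (hprev : ∀ j < i, ∃ β, IsBlossomBase M j β) {v : V}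
    (ht : HasTenacity M v t) (hti : t ≤ 2 * i + 1) : β v ≠ v := by
  have : Nonempty (V → V) := ⟨id⟩
  choose! γ hγ using hprev
  have htower : IsBlossomTower M i (Function.update γ i β) :=
    ⟨fun j hj => by rw [Function.update_of_ne hj.ne]; exact hγ j hj, by rwa [Function.update_self]⟩
  simpa only [Function.update_self] using htower.ne_of_hasTenacity hM ht hti

theorem IsSoundBase.isBlossomBase (hM : M.IsMatching) {i : ℕ} {β : V → V} (h : IsSoundBase M i β)
    (hprev : ∀ j < i, ∃ β, IsBlossomBase M j β) : IsBlossomBase M i β := by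
  refine ⟨h.mate, fun v => ⟨h.tenacity_le v, fun ⟨t, ht, hti⟩ =>
    h.ne_of_hasTenacity hM hprev ht hti⟩, ?_⟩
  rintro u v _ hadj huv ⟨a, b, ha, hb, hpa, hpb, rfl⟩ hti
  have ne_or_isMinlevel : ∀ {u v : V} {a b : ℕ}, G.Adj u v → (M.Adj u v ↔ a % 2 = 1) →
      IsLevel M u a → IsLevel M v b → a + b ≤ 2 * i → β v ≠ v ∨ IsMinlevel M v b := by
    intro u v a b hadj hpar ha hb hab
    obtain ⟨m, hm, rfl | ⟨-, -, ht⟩⟩ := hb.exists_isMinlevel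
    · exact Or.inr hm
    · obtain ⟨n, hn, hmin⟩ := ha.hasAltPath.exists_isMinlevel_of_adj hadj hpar
      have := hmin.unique hm
      exact Or.inl (h.ne_of_hasTenacity hM hprev ht (by omega))
  have ha0 : ¬ a % 2 = 1 := fun ha1 => huv (hpa.2 ha1)
  have hb0 : ¬ b % 2 = 1 := fun hb1 => huv (hpb.2 hb1)
  exact h.eq_of_edge hadj huv
    ha (by omega) (ne_or_isMinlevel hadj.symm (by rw [M.adj_comm, hpb]) hb ha (by omega))
    hb (by omega) (ne_or_isMinlevel hadj hpa ha hb (by omega)) (by omega)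

/-! ### Double depth first search finds disjoint paths or a bottleneck -/

/-- The minlevel as a natural number (`0` if it is infinite): the layer of a vertex in the graph
`H` of a double depth first search. -/
noncomputable def layer (M : G.Subgraph) (v : V) : ℕ := (minlevel M v).toNat

theorem IsMinlevel.layer_eq {v : V} {m : ℕ} (h : IsMinlevel M v m) : layer M v = m := by
  rw [layer, minlevel_eq_iff.2 h, ENat.toNat_natCast]

theorem IsMinlevel.isMinlevel_layer {v : V} {m : ℕ} (h : IsMinlevel M v m) :
    IsMinlevel M v (layer M v) := by
  rwa [h.layer_eq]

/-- `v` is the base of its blossom and has minlevel at most `i`. These are the vertices of `H`. -/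
def Live (M : G.Subgraph) (β : V → V) (i : ℕ) (v : V) : Prop :=
  β v = v ∧ IsMinlevel M v (layer M v) ∧ layer M v ≤ i

/-- The properties of the graph `H` on which double depth first search relies: its edges lead from
live vertices down to live vertices and are realized by alternating paths through blossoms, and
only the vertices of layer `0` are sinks. -/
structure IsLayered (M : G.Subgraph) (L : Labels V) (β : V → V) (i : ℕ) : Prop where
  minLevel : ∀ w, Live M β i w → L.minLevel w = layer M w
  step : ∀ w w', Live M β i w → L.HEdge w w' → Live M β i w' ∧ layer M w' < layer M w ∧
    ∃ u S, AltPath M w' (layer M w') u (layer M w - 1) S ∧ (∀ s ∈ S, β s = w') ∧ G.Adj u w ∧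
      (M.Adj u w ↔ (layer M w - 1) % 2 = 1)
  exists_step : ∀ w, Live M β i w → 0 < layer M w → ∃ w', L.HEdge w w'

/-- There is an alternating path upwards from `w` to the vertex `x` at its level `lx` through
blossoms, with bases satisfying `P`, that lie above `w`. -/
def TreePath (M : G.Subgraph) (β : V → V) (P : V → Prop) (w x : V) (lx : ℕ) : Prop :=
  ∃ S, AltPath M w (layer M w) x lx S ∧ ∀ s ∈ S, P (β s) ∧ (β s = w ∨ layer M w < layer M (β s))

section TreePath

variable {L : Labels V} {β : V → V} {i lx : ℕ} {P Q : V → Prop} {w w' x : V}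

theorem TreePath.mono (h : TreePath M β P w x lx)
    (hPQ : ∀ b, P b → b = w ∨ layer M w < layer M b → Q b) : TreePath M β Q w x lx := by
  obtain ⟨S, hS, hP⟩ := h
  exact ⟨S, hS, fun s hs => ⟨hPQ _ (hP s hs).1 (hP s hs).2, (hP s hs).2⟩⟩

theorem TreePath.step (hL : IsLayered M L β i) (hw : Live M β i w) (he : L.HEdge w w')
    (h : TreePath M β P w x lx) (hP : P w') : TreePath M β P w' x lx := by
  obtain ⟨S, hS, hbase⟩ := h
  obtain ⟨-, hlt, u, S', hS', hbase', hadj, hpar⟩ := hL.step w w' hw he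
  have hS : AltPath M w (layer M w - 1 + 1) x lx S := by
    rwa [show layer M w - 1 + 1 = layer M w by omega]
  have habove : ∀ s ∈ S, layer M w ≤ layer M (β s) := fun s hs =>
    (hbase s hs).2.elim (fun h => h ▸ le_rfl) le_of_lt
  refine ⟨S' ∪ S, hS'.append hadj hpar hS fun s hs' hs => ?_, ?_⟩
  · have := habove s hs
    rw [hbase' s hs'] at this
    omega
  · rintro s (hs | hs)
    · rw [hbase' s hs]
      exact ⟨hP, Or.inl rfl⟩
    · exact ⟨(hbase s hs).1, Or.inr (hlt.trans_le (habove s hs))⟩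

end TreePath

/-- `A` is the set of vertices on the way from `c` up to `root` along the pointers `par`. -/
inductive Stack (M : G.Subgraph) (par : V → Option V) (root : V) : V → Set V → Prop
  | base : Stack M par root root {root}
  | push {c x : V} {A : Set V} (hpar : par c = some x) (hlt : layer M c < layer M x)
      (h : Stack M par root x A) : Stack M par root c (insert c A)

namespace Stack

variable {par : V → Option V} {root c : V} {A : Set V}

theorem mem (h : Stack M par root c A) : c ∈ A := by
  cases h with
  | base => rfl
  | push => exact Set.mem_insert _ _

theorem eq_or_layer_lt (h : Stack M par root c A) {a : V} (ha : a ∈ A) :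
    a = c ∨ layer M c < layer M a := by
  induction h with
  | base => exact Or.inl ha
  | push hpar hlt h ih =>
    rcases ha with rfl | ha
    · exact Or.inl rfl
    · rcases ih ha with rfl | hxa
      · exact Or.inr hlt
      · exact Or.inr (hlt.trans hxa)

theorem layer_le_root (h : Stack M par root c A) : layer M c ≤ layer M root := by
  induction h with
  | base => rfl
  | push _ hlt _ ih => exact hlt.le.trans ih

theorem eq_singleton (h : Stack M par root root A) : A = {root} := by
  generalize hc : root = c at h
  cases h with
  | base => rfl
  | push _ hlt h =>
    subst hc
    exact absurd h.layer_le_root hlt.not_ge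

theorem update [DecidableEq V] (h : Stack M par root c A) {z : V} (hz : z ∉ A) (o : Option V) :
    Stack M (Function.update par z o) root c A := by
  induction h with
  | base => exact .base
  | @push c x A hpar hlt _ ih =>
    have hcz : c ≠ z := fun h => hz (h ▸ Set.mem_insert _ _)
    exact .push (by rwa [Function.update_of_ne hcz]) hlt
      (ih fun hzA => hz (Set.mem_insert_of_mem _ hzA))

theorem exists_pop (h : Stack M par root c A) (hc : c ≠ root) :
    ∃ x B, par c = some x ∧ layer M c < layer M x ∧ Stack M par root x B ∧ A = insert c B := by
  cases h with
  | base => exact absurd rfl hc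
  | push hpar hlt h => exact ⟨_, _, hpar, hlt, h, rfl⟩

end Stack

section Update

variable [DecidableEq V] {colour : V → Option Colour} {u w : V} {c c' : Colour}

theorem update_eq_some (hu : colour u = none) (hw : colour w = some c) :
    Function.update colour u (some c') w = some c := by
  rwa [Function.update_of_ne]
  rintro rfl
  simp [hu] at hw

theorem update_ne_none (hw : w = u ∨ colour w ≠ none) :
    Function.update colour u (some c) w ≠ none := by
  by_cases h : w = u
  · simp [h]
  · rw [Function.update_of_ne h]
    exact hw.resolve_left h

theorem eq_or_ne_none_of_update (hw : Function.update colour u (some c) w ≠ none) :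
    w = u ∨ colour w ≠ none :=
  (eq_or_ne w u).imp_right fun h => by rwa [Function.update_of_ne h] at hw

end Update

/-- The coloured vertices form two trees. A vertex of colour `c` is joined, through the blossoms of
that tree, to the end `tip c` of the bridge at the level `len c`. Depth first search is still active
at the vertices of `T`. -/
structure IsForest (M : G.Subgraph) (L : Labels V) (β : V → V) (i : ℕ) (tip : Colour → V)
    (len : Colour → ℕ) (root : Colour → V) (colour : V → Option Colour) (T : Set V) : Prop where
  live : ∀ w, colour w ≠ none → Live M β i w
  tree : ∀ w c, colour w = some c → TreePath M β (colour · = some c) w (tip c) (len c)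
  visited : ∀ a ∈ T, colour a ≠ none
  root_visited : ∀ c, colour (root c) ≠ none
  closed : ∀ w, colour w ≠ none → w ∈ T ∨ ∀ u, L.HEdge w u → colour u ≠ none

/-- The trees grow with the centers of activity `z` (colour `c`, search path `S`) and `z'` (colour
`c'`, search path `S'`) in the lowest layers. -/
structure IsCoordinated (M : G.Subgraph) (colour : V → Option Colour) (c c' : Colour)
    (S S' : Set V) (z z' : V) : Prop where
  ne : z ≠ z'
  own : ∀ a ∈ S, colour a = some c
  other : ∀ b ∈ S', colour b = some c'
  low : ∀ w, colour w ≠ none → w = z ∨ w = z' ∨ (layer M z ≤ layer M w ∧ layer M z' ≤ layer M w)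

/-- The centers have met at `z`, which is the only vertex in the lowest layer and has been given to
the tree `c'`. The tree `c`, with search path `S`, could have had `z` as well and looks for a
substitute. -/
structure IsSeeking (M : G.Subgraph) (β : V → V) (colour : V → Option Colour) (c c' : Colour)
    (S S' : Set V) (z x : V) (lx : ℕ) : Prop where
  meet : colour z = some c'
  own : ∀ a ∈ S, a = z ∨ colour a = some c
  other : ∀ b ∈ S', colour b = some c'
  low : ∀ w, colour w ≠ none → w = z ∨ layer M z < layer M w
  path : TreePath M β (fun w => w = z ∨ colour w = some c) z x lx

section Forest

variable {L : Labels V} {β : V → V} {i : ℕ} {tip root : Colour → V} {len : Colour → ℕ}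
  {colour : V → Option Colour} {T T' : Set V} {u w z : V} {c : Colour}

theorem IsForest.update [DecidableEq V] (h : IsForest M L β i tip len root colour T)
    (hlive : Live M β i z)
    (hpath : TreePath M β (fun w => w = z ∨ colour w = some c) z (tip c) (len c))
    (hlow : colour z = none ∨ ∀ w, colour w ≠ none → w = z ∨ layer M z < layer M w) :
    IsForest M L β i tip len root (Function.update colour z (some c)) (insert z T) where
  live w hw := (eq_or_ne_none_of_update hw).elim (fun hwz => hwz ▸ hlive) (h.live w)
  tree w c' hw := by
    by_cases hwz : w = z
    · obtain rfl : c = c' := by simpa [hwz] using hw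
      rw [hwz]
      refine hpath.mono fun b hb _ => ?_
      by_cases hbz : b = z
      · simp [hbz]
      · rw [Function.update_of_ne hbz]
        exact hb.resolve_left hbz
    · rw [Function.update_of_ne hwz] at hw
      refine (h.tree w c' hw).mono fun b hb hbw => ?_
      rwa [Function.update_of_ne]
      rintro rfl
      rcases hlow with hnone | hlow
      · simp [hnone] at hb
      · have := (hlow w (by simp [hw])).resolve_left hwz
        exact hbw.elim (fun e => hwz e.symm) (by omega)
  visited a ha := update_ne_none (ha.imp_right (h.visited a))
  root_visited c' := update_ne_none (Or.inr (h.root_visited c'))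
  closed w hw := by
    rcases eq_or_ne_none_of_update hw with rfl | hw
    · exact Or.inl (Set.mem_insert _ _)
    · exact (h.closed w hw).imp (Set.mem_insert_of_mem _)
        fun hcl v hv => update_ne_none (Or.inr (hcl v hv))

theorem IsForest.visit [DecidableEq V] (h : IsForest M L β i tip len root colour T)
    (hL : IsLayered M L β i) (hw : colour w = some c) (he : L.HEdge w u) (hu : colour u = none) :
    IsForest M L β i tip len root (Function.update colour u (some c)) (insert u T) := by
  have hlive := h.live w (by simp [hw])
  exact h.update (hL.step w u hlive he).1 (.step hL hlive he
    ((h.tree w c hw).mono fun _ hb _ => Or.inr hb) (Or.inl rfl)) (Or.inl hu)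

theorem IsForest.shrink (h : IsForest M L β i tip len root colour T) (hsub : T' ⊆ T)
    (hdrop : ∀ w ∈ T, w ∉ T' → ∀ u, L.HEdge w u → colour u ≠ none) :
    IsForest M L β i tip len root colour T' where
  live := h.live
  tree := h.tree
  visited a ha := h.visited a (hsub ha)
  root_visited := h.root_visited
  closed w hw := (em (w ∈ T')).imp_right fun hwT' =>
    (h.closed w hw).elim (fun hwT => hdrop w hwT hwT') id

end Forest

section Modes

variable {β : V → V} {colour : V → Option Colour} {c c' : Colour} {S S' S₁ S₁' : Set V}
  {u x z z' : V} {lx : ℕ}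

theorem IsCoordinated.symm (h : IsCoordinated M colour c c' S S' z z') :
    IsCoordinated M colour c' c S' S z' z where
  ne := h.ne.symm
  own := h.other
  other := h.own
  low w hw := by
    have := h.low w hw
    tauto

theorem IsCoordinated.visit [DecidableEq V] (h : IsCoordinated M colour c c' S S' z z')
    (hz' : z' ∈ S') (hle : layer M z' ≤ layer M z) (hlt : layer M u < layer M z)
    (hu : colour u = none) :
    IsCoordinated M (Function.update colour u (some c)) c c' (insert u S) S' u z' where
  ne := by
    rintro rfl
    simp [h.other u hz'] at hu
  own := by
    rintro a (rfl | ha)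
    · exact Function.update_self ..
    · exact update_eq_some hu (h.own a ha)
  other b hb := update_eq_some hu (h.other b hb)
  low w hw := by
    rcases eq_or_ne_none_of_update hw with rfl | hw
    · exact Or.inl rfl
    · rcases h.low w hw with rfl | rfl | hzw
      · exact Or.inr (Or.inr ⟨hlt.le, hle⟩)
      · exact Or.inr (Or.inl rfl)
      · exact Or.inr (Or.inr ⟨hlt.le.trans hzw.1, hzw.2⟩)

theorem IsCoordinated.eq_or_layer_lt (h : IsCoordinated M colour c c' S S' z z')
    (hlt : layer M z' < layer M z) (w : V) (hw : colour w ≠ none) :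
    w = z' ∨ layer M z' < layer M w := by
  rcases h.low w hw with rfl | rfl | hzw
  · exact Or.inr hlt
  · exact Or.inl rfl
  · exact Or.inr (hlt.trans_le hzw.1)

theorem isSeeking_update [DecidableEq V] (own : ∀ a ∈ S, a = z ∨ colour a = some c)
    (other : ∀ b ∈ S', colour b = some c')
    (low : ∀ w, colour w ≠ none → w = z ∨ layer M z < layer M w)
    (path : TreePath M β (fun w => w = z ∨ colour w = some c) z x lx) :
    IsSeeking M β (Function.update colour z (some c')) c c' S (insert z S') z x lx where
  meet := Function.update_self ..
  own a ha := by
    by_cases haz : a = z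
    · exact Or.inl haz
    · rw [Function.update_of_ne haz]
      exact own a ha
  other b hb := by
    by_cases hbz : b = z
    · rw [hbz, Function.update_self]
    · rw [Function.update_of_ne hbz]
      exact other b (hb.resolve_left hbz)
  low w hw := (eq_or_ne_none_of_update hw).elim Or.inl (low w)
  path := path.mono fun b hb _ => by
    by_cases hbz : b = z
    · exact Or.inl hbz
    · rw [Function.update_of_ne hbz]
      exact hb

namespace IsSeeking

theorem mono (h : IsSeeking M β colour c c' S S' z x lx) (hS : S₁ ⊆ S) :
    IsSeeking M β colour c c' S₁ S' z x lx :=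
  { h with own := fun a ha => h.own a (hS ha) }

theorem own_of_stack (h : IsSeeking M β colour c c' S S' z x lx) {par : V → Option V} {top d : V}
    (hS : Stack M par top d S) (hd : colour d ≠ none) (hdz : d ≠ z) :
    ∀ a ∈ S, colour a = some c := by
  intro a ha
  refine (h.own a ha).resolve_left ?_
  rintro rfl
  have hlt := (h.low d hd).resolve_left hdz
  exact (hS.eq_or_layer_lt ha).elim (fun e => hdz e.symm) hlt.not_gt

theorem visit [DecidableEq V] (h : IsSeeking M β colour c c' S S' z x lx)
    (hlt : layer M z < layer M u) (hu : colour u = none) :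
    IsSeeking M β (Function.update colour u (some c)) c c' (insert u S) S' z x lx where
  meet := update_eq_some hu h.meet
  own := by
    rintro a (rfl | ha)
    · exact Or.inr (Function.update_self ..)
    · exact (h.own a ha).imp_right (update_eq_some hu)
  other b hb := update_eq_some hu (h.other b hb)
  low w hw := by
    rcases eq_or_ne_none_of_update hw with rfl | hw
    · exact Or.inr hlt
    · exact h.low w hw
  path := h.path.mono fun _ hb _ => hb.imp_right (update_eq_some hu)

theorem visit_of_le [DecidableEq V] (h : IsSeeking M β colour c c' S S' z x lx)
    (own : ∀ a ∈ S, colour a = some c) (hle : layer M u ≤ layer M z) (hu : colour u = none) :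
    IsCoordinated M (Function.update colour u (some c)) c c' (insert u S) S' u z where
  ne := by
    rintro rfl
    simp [h.meet] at hu
  own := by
    rintro a (rfl | ha)
    · exact Function.update_self ..
    · exact update_eq_some hu (own a ha)
  other b hb := update_eq_some hu (h.other b hb)
  low w hw := by
    rcases eq_or_ne_none_of_update hw with rfl | hw
    · exact Or.inl rfl
    · exact Or.inr ((h.low w hw).imp_right fun hlt => ⟨hle.trans hlt.le, hlt.le⟩)

end IsSeeking

end Modes

/-- The invariant of a double depth first search from the ends `tip c` of a bridge, with the roots
`root c`; `A` and `B` are the current search paths of the red and of the green tree. -/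
structure SearchInvariant (M : G.Subgraph) (L : Labels V) (β : V → V) (i : ℕ) (tip : Colour → V)
    (len : Colour → ℕ) (root : Colour → V) (D : DDFS V) (A B : Set V) : Prop where
  forest : IsForest M L β i tip len root D.colour (A ∪ B)
  stackR : Stack M D.parentR D.barrier D.cR A
  stackG : Stack M D.parentG D.rootG D.cG B
  normal : D.mode = .normal → IsCoordinated M D.colour .red .green A B D.cR D.cG
  redSeeks : D.mode = .redSeeks →
    IsSeeking M β D.colour .red .green A B D.cG (tip .red) (len .red)
  greenSeeks : D.mode = .greenSeeks → D.barrier = D.cR ∧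
    IsSeeking M β D.colour .green .red B A D.cR (tip .green) (len .green)

section SearchInvariant

variable {L : Labels V} {β : V → V} {i : ℕ} {tip root : Colour → V} {len : Colour → ℕ}
  {D D' : DDFS V} {A B : Set V} {u x : V}

namespace SearchInvariant

theorem visited_cR (h : SearchInvariant M L β i tip len root D A B) : D.colour D.cR ≠ none :=
  h.forest.visited _ (Or.inl h.stackR.mem)

theorem visited_cG (h : SearchInvariant M L β i tip len root D A B) : D.colour D.cG ≠ none :=
  h.forest.visited _ (Or.inr h.stackG.mem)

theorem live_cR (h : SearchInvariant M L β i tip len root D A B) : Live M β i D.cR :=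
  h.forest.live _ h.visited_cR

theorem live_cG (h : SearchInvariant M L β i tip len root D A B) : Live M β i D.cG :=
  h.forest.live _ h.visited_cG

theorem notMem_left (h : SearchInvariant M L β i tip len root D A B) (hu : D.colour u = none) :
    u ∉ A :=
  fun huA => h.forest.visited u (Or.inl huA) hu

theorem notMem_right (h : SearchInvariant M L β i tip len root D A B) (hu : D.colour u = none) :
    u ∉ B :=
  fun huB => h.forest.visited u (Or.inr huB) hu

theorem redMove [DecidableEq V] (hL : IsLayered M L β i)
    (h : SearchInvariant M L β i tip len root D A B) (hm : D.mode = .normal)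
    (hl : L.minLevel D.cG ≤ L.minLevel D.cR) (he : L.HEdge D.cR u) (hu : D.colour u = none) :
    SearchInvariant M L β i tip len root { D with
      colour := Function.update D.colour u (some .red)
      parentR := Function.update D.parentR u (some D.cR)
      cR := u } (insert u A) B where
  forest := Set.insert_union ▸ h.forest.visit hL ((h.normal hm).own _ h.stackR.mem) he hu
  stackR := .push (Function.update_self ..) (hL.step _ _ h.live_cR he).2.1
    (h.stackR.update (h.notMem_left hu) _)
  stackG := h.stackG
  normal _ := (h.normal hm).visit h.stackG.mem
    (by simpa only [hL.minLevel _ h.live_cR, hL.minLevel _ h.live_cG, Nat.cast_le] using hl)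
    (hL.step _ _ h.live_cR he).2.1 hu
  redSeeks h' := by simp [hm] at h'
  greenSeeks h' := by simp [hm] at h'

theorem greenMove [DecidableEq V] (hL : IsLayered M L β i)
    (h : SearchInvariant M L β i tip len root D A B) (hm : D.mode = .normal)
    (hl : L.minLevel D.cR < L.minLevel D.cG) (he : L.HEdge D.cG u) (hu : D.colour u = none) :
    SearchInvariant M L β i tip len root { D with
      colour := Function.update D.colour u (some .green)
      parentG := Function.update D.parentG u (some D.cG)
      cG := u } A (insert u B) where
  forest := Set.union_insert ▸ h.forest.visit hL ((h.normal hm).other _ h.stackG.mem) he hu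
  stackR := h.stackR
  stackG := .push (Function.update_self ..) (hL.step _ _ h.live_cG he).2.1
    (h.stackG.update (h.notMem_right hu) _)
  normal _ := ((h.normal hm).symm.visit h.stackR.mem
    (by simpa only [hL.minLevel _ h.live_cR, hL.minLevel _ h.live_cG, Nat.cast_le] using hl.le)
    (hL.step _ _ h.live_cG he).2.1 hu).symm
  redSeeks h' := by simp [hm] at h'
  greenSeeks h' := by simp [hm] at h'

theorem redMeets [DecidableEq V] (hL : IsLayered M L β i)
    (h : SearchInvariant M L β i tip len root D A B) (hm : D.mode = .normal)
    (he : L.HEdge D.cR D.cG) :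
    SearchInvariant M L β i tip len root { D with
      colour := Function.update D.colour D.cG (some .green)
      parentR := Function.update D.parentR D.cG (some D.cR)
      cR := D.cG
      mode := .redSeeks } (insert D.cG A) B := by
  have hC := h.normal hm
  have hlt := (hL.step _ _ h.live_cR he).2.1
  have hcG : D.colour D.cG = some .green := hC.other _ h.stackG.mem
  have hnotMem : D.cG ∉ A := fun hA => by simpa [hcG] using hC.own _ hA
  have hpath : TreePath M β (fun w => w = D.cG ∨ D.colour w = some .red) D.cG
      (tip .red) (len .red) :=
    .step hL h.live_cR he ((h.forest.tree _ _ (hC.own _ h.stackR.mem)).mono fun _ hb _ => Or.inr hb)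
      (Or.inl rfl)
  have hseek := isSeeking_update (S := insert D.cG A)
    (by rintro a (ha | ha); exacts [Or.inl ha, Or.inr (hC.own a ha)]) hC.other
    (hC.eq_or_layer_lt hlt) hpath
  rw [Set.insert_eq_of_mem h.stackG.mem] at hseek
  have hcolour : Function.update D.colour D.cG (some .green) = D.colour := by
    rw [← hcG, Function.update_eq_self]
  rw [hcolour] at hseek ⊢
  have hT : insert D.cG A ∪ B ⊆ A ∪ B := by
    rintro a ((rfl | ha) | ha)
    exacts [Or.inr h.stackG.mem, Or.inl ha, Or.inr ha]
  exact {
    forest := h.forest.shrink hT fun w hw hw' =>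
      absurd (hw.imp_left (Set.mem_insert_of_mem _)) hw'
    stackR := .push (Function.update_self ..) hlt (h.stackR.update hnotMem _)
    stackG := h.stackG
    normal := nofun
    redSeeks := fun _ => hseek
    greenSeeks := nofun }

theorem greenMeets [DecidableEq V] (hL : IsLayered M L β i)
    (h : SearchInvariant M L β i tip len root D A B) (hm : D.mode = .normal)
    (he : L.HEdge D.cG D.cR) :
    SearchInvariant M L β i tip len root { D with
      colour := Function.update D.colour D.cR (some .green)
      parentG := Function.update D.parentG D.cR (some D.cG)
      cG := D.cR
      mode := .redSeeks } A (insert D.cR B) := by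
  have hC := h.normal hm
  have hlt := (hL.step _ _ h.live_cG he).2.1
  have hcR : D.colour D.cR = some .red := hC.own _ h.stackR.mem
  have hnotMem : D.cR ∉ B := fun hB => by simpa [hcR] using hC.other _ hB
  have hlow := hC.symm.eq_or_layer_lt hlt
  have hpath : TreePath M β (fun w => w = D.cR ∨ D.colour w = some .green) D.cR
      (tip .green) (len .green) :=
    .step hL h.live_cG he
      ((h.forest.tree _ _ (hC.other _ h.stackG.mem)).mono fun _ hb _ => Or.inr hb) (Or.inl rfl)
  exact {
    forest := Set.union_insert ▸ h.forest.update h.live_cR hpath (Or.inr hlow)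
    stackR := h.stackR
    stackG := .push (Function.update_self ..) hlt (h.stackG.update hnotMem _)
    normal := nofun
    redSeeks := fun _ => isSeeking_update (fun a ha => Or.inr (hC.own a ha)) hC.other hlow
      ((h.forest.tree _ _ hcR).mono fun _ hb _ => Or.inr hb)
    greenSeeks := nofun }

theorem redSeek [DecidableEq V] (hL : IsLayered M L β i)
    (h : SearchInvariant M L β i tip len root D A B) (hm : D.mode = .redSeeks)
    (hne : D.cR ≠ D.cG) (he : L.HEdge D.cR u) (hu : D.colour u = none) :
    SearchInvariant M L β i tip len root { D with
      colour := Function.update D.colour u (some .red)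
      parentR := Function.update D.parentR u (some D.cR)
      cR := u
      mode := if L.minLevel u ≤ L.minLevel D.cG then .normal else .redSeeks } (insert u A) B := by
  have hS := h.redSeeks hm
  have hown := hS.own_of_stack h.stackR h.visited_cR hne
  obtain ⟨hlive, hlt, -⟩ := hL.step _ _ h.live_cR he
  have hle : L.minLevel u ≤ L.minLevel D.cG ↔ layer M u ≤ layer M D.cG := by
    rw [hL.minLevel _ hlive, hL.minLevel _ h.live_cG, Nat.cast_le]
  exact {
    forest := Set.insert_union ▸ h.forest.visit hL (hown _ h.stackR.mem) he hu
    stackR := .push (Function.update_self ..) hlt (h.stackR.update (h.notMem_left hu) _)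
    stackG := h.stackG
    normal := fun hm' => hS.visit_of_le hown (hle.1 (by by_contra hgt; simp [hgt] at hm')) hu
    redSeeks := fun hm' => hS.visit (by by_contra hgt; simp [hle.2 (not_lt.1 hgt)] at hm') hu
    greenSeeks := fun hm' => by split at hm' <;> contradiction }

theorem redBacktrack (h : SearchInvariant M L β i tip len root D A B) (hm : D.mode = .redSeeks)
    (hs : D.RedStuck L) (hb : D.cR ≠ D.barrier) (hx : D.parentR D.cR = some x) :
    ∃ A', SearchInvariant M L β i tip len root { D with cR := x } A' B := by
  obtain ⟨x', A', hx', -, hA', rfl⟩ := h.stackR.exists_pop hb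
  obtain rfl : x' = x := by simpa [hx] using hx'.symm
  refine ⟨A', {
    forest := h.forest.shrink (Set.union_subset_union_left _ (Set.subset_insert ..)) ?_
    stackR := hA'
    stackG := h.stackG
    normal := fun h' => by simp [hm] at h'
    redSeeks := fun _ => (h.redSeeks hm).mono (Set.subset_insert ..)
    greenSeeks := fun h' => by simp [hm] at h' }⟩
  rintro w ((rfl | hw) | hw) hw'
  · exact hs.resolve_left fun hmeet => hw' (Or.inr (hmeet ▸ h.stackG.mem))
  · exact absurd (Or.inl hw) hw'
  · exact absurd (Or.inr hw) hw'

theorem redFail [DecidableEq V] (h : SearchInvariant M L β i tip len root D A B)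
    (hm : D.mode = .redSeeks) (hs : D.RedStuck L) (hb : D.cR = D.barrier) :
    SearchInvariant M L β i tip len root { D with
      colour := Function.update D.colour D.cG (some .red)
      cR := D.cG
      barrier := D.cG
      mode := .greenSeeks } {D.cG} B := by
  have hS := h.redSeeks hm
  have hA : A = {D.cR} := by
    have hstack := h.stackR
    rw [← hb] at hstack
    rw [hstack.eq_singleton]
  have hforest : IsForest M L β i tip len root D.colour B := by
    refine h.forest.shrink Set.subset_union_right ?_
    rintro w (hw | hw) hw'
    · obtain rfl : w = D.cR := by rwa [hA] at hw
      exact hs.resolve_left fun hmeet => hw' (hmeet ▸ h.stackG.mem)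
    · exact absurd hw hw'
  have hseek := isSeeking_update (S := B) (S' := ∅) (c' := .red)
    (fun b hb => Or.inr (hS.other b hb)) nofun hS.low
    ((h.forest.tree _ _ hS.meet).mono fun _ hb _ => Or.inr hb)
  exact {
    forest := Set.singleton_union ▸ hforest.update h.live_cG hS.path (Or.inr hS.low)
    stackR := .base
    stackG := h.stackG
    normal := nofun
    redSeeks := nofun
    greenSeeks := fun _ => ⟨rfl, by rwa [insert_empty_eq] at hseek⟩ }

theorem greenSeek [DecidableEq V] (hL : IsLayered M L β i)
    (h : SearchInvariant M L β i tip len root D A B) (hm : D.mode = .greenSeeks)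
    (hne : D.cG ≠ D.cR) (he : L.HEdge D.cG u) (hu : D.colour u = none) :
    SearchInvariant M L β i tip len root { D with
      colour := Function.update D.colour u (some .green)
      parentG := Function.update D.parentG u (some D.cG)
      cG := u
      mode := if L.minLevel u ≤ L.minLevel D.cR then .normal else .greenSeeks } A (insert u B) := by
  obtain ⟨hbarrier, hS⟩ := h.greenSeeks hm
  have hown := hS.own_of_stack h.stackG h.visited_cG hne
  obtain ⟨hlive, hlt, -⟩ := hL.step _ _ h.live_cG he
  have hle : L.minLevel u ≤ L.minLevel D.cR ↔ layer M u ≤ layer M D.cR := by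
    rw [hL.minLevel _ hlive, hL.minLevel _ h.live_cR, Nat.cast_le]
  exact {
    forest := Set.union_insert ▸ h.forest.visit hL (hown _ h.stackG.mem) he hu
    stackR := h.stackR
    stackG := .push (Function.update_self ..) hlt (h.stackG.update (h.notMem_right hu) _)
    normal := fun hm' => (hS.visit_of_le hown (hle.1 (by by_contra hgt; simp [hgt] at hm')) hu).symm
    redSeeks := fun hm' => by split at hm' <;> contradiction
    greenSeeks := fun hm' =>
      ⟨hbarrier, hS.visit (by by_contra hgt; simp [hle.2 (not_lt.1 hgt)] at hm') hu⟩ }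

theorem greenBacktrack (h : SearchInvariant M L β i tip len root D A B)
    (hm : D.mode = .greenSeeks) (hs : D.GreenStuck L) (hb : D.cG ≠ D.rootG)
    (hx : D.parentG D.cG = some x) :
    ∃ B', SearchInvariant M L β i tip len root { D with cG := x } A B' := by
  obtain ⟨x', B', hx', -, hB', rfl⟩ := h.stackG.exists_pop hb
  obtain rfl : x' = x := by simpa [hx] using hx'.symm
  refine ⟨B', {
    forest := h.forest.shrink (Set.union_subset_union_right _ (Set.subset_insert ..)) ?_
    stackR := h.stackR
    stackG := hB'
    normal := fun h' => by simp [hm] at h'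
    redSeeks := fun h' => by simp [hm] at h'
    greenSeeks := fun _ => (h.greenSeeks hm).imp_right (·.mono (Set.subset_insert ..)) }⟩
  rintro w (hw | rfl | hw) hw'
  · exact absurd (Or.inl hw) hw'
  · exact hs.resolve_left fun hmeet => hw' (Or.inl (hmeet ▸ h.stackR.mem))
  · exact absurd (Or.inr hw) hw'

theorem step (hL : IsLayered M L β i) (h : SearchInvariant M L β i tip len root D A B)
    (hs : D.Step L D') : ∃ A' B', SearchInvariant M L β i tip len root D' A' B' := by
  classical
  cases hs with
  | redMove u hm hl he hu => exact ⟨_, _, h.redMove hL hm hl he hu⟩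
  | greenMove u hm hl he hu => exact ⟨_, _, h.greenMove hL hm hl he hu⟩
  | redMeets hm hl he => exact ⟨_, _, h.redMeets hL hm he⟩
  | greenMeets hm hl he => exact ⟨_, _, h.greenMeets hL hm he⟩
  | redSeek u hm hc he hu => exact ⟨_, _, h.redSeek hL hm hc he hu⟩
  | redBacktrack x hm hs hb hx => exact (h.redBacktrack hm hs hb hx).imp fun _ h => ⟨_, h⟩
  | redFail hm hs hb => exact ⟨_, _, h.redFail hm hs hb⟩
  | greenSeek u hm hc he hu => exact ⟨_, _, h.greenSeek hL hm hc he hu⟩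
  | greenBacktrack x hm hs hb hx => exact ⟨_, h.greenBacktrack hm hs hb hx⟩

theorem start (hlive : ∀ c, Live M β i (root c)) (hne : root .red ≠ root .green)
    (hpath : ∀ c, TreePath M β (· = root c) (root c) (tip c) (len c)) :
    SearchInvariant M L β i tip len root (DDFS.start (root .red) (root .green))
      {root .red} {root .green} := by
  set D : DDFS V := DDFS.start (root .red) (root .green)
  have hroot : ∀ c, D.colour (root c) = some c := by
    rintro (_ | _) <;> simp [D, DDFS.start, hne.symm]
  have heq : ∀ w c, D.colour w = some c → w = root c := by
    intro w c hw
    simp only [D, DDFS.start] at hw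
    split_ifs at hw with hr hg <;> cases hw <;> assumption
  have hvisited : ∀ w, D.colour w ≠ none → w = root .red ∨ w = root .green := by
    intro w hw
    obtain ⟨c | c, hc⟩ := Option.ne_none_iff_exists'.1 hw
    exacts [Or.inl (heq w _ hc), Or.inr (heq w _ hc)]
  exact {
    forest.live := fun w hw => (hvisited w hw).elim (fun e => e ▸ hlive _) fun e => e ▸ hlive _
    forest.tree := fun w c hw => by
      obtain rfl := heq w c hw
      exact (hpath c).mono fun b hb _ => by rw [hb, hroot]
    forest.visited := by rintro a (rfl | rfl) <;> simp [hroot]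
    forest.root_visited := by simp [hroot]
    forest.closed := fun w hw => Or.inl (hvisited w hw)
    stackR := .base
    stackG := .base
    normal := fun _ => {
      ne := hne
      own := by rintro a rfl; exact hroot _
      other := by rintro b rfl; exact hroot _
      low := fun w hw => (hvisited w hw).imp_right Or.inl }
    redSeeks := nofun
    greenSeeks := nofun }


theorem exists_step_of_normal (hL : IsLayered M L β i)
    (h : SearchInvariant M L β i tip len root D A B) (hm : D.mode = .normal) :
    (∃ D', D.Step L D') ∨ D.EndsDisjoint L := by
  classical
  have hC := h.normal hm
  have hR := hL.minLevel _ h.live_cR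
  have hG := hL.minLevel _ h.live_cG
  rcases le_or_gt (layer M D.cG) (layer M D.cR) with hle | hlt
  · have hl : L.minLevel D.cG ≤ L.minLevel D.cR := by rwa [hR, hG, Nat.cast_le]
    rcases Nat.eq_zero_or_pos (layer M D.cR) with hR0 | hpos
    · refine Or.inr ⟨hm, hC.ne, ?_, ?_⟩
      · rw [hR, hR0, Nat.cast_zero]
      · rw [hG, show layer M D.cG = 0 by omega, Nat.cast_zero]
    · obtain ⟨u, hu⟩ := hL.exists_step _ h.live_cR hpos
      obtain ⟨-, hlt, -⟩ := hL.step _ _ h.live_cR hu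
      left
      by_cases hcu : D.colour u = none
      · exact ⟨_, .redMove D u hm hl hu hcu⟩
      · rcases hC.low u hcu with rfl | rfl | hlow
        · exact absurd hlt (lt_irrefl _)
        · exact ⟨_, .redMeets D hm hl hu⟩
        · exact absurd hlt hlow.1.not_gt
  · have hl : L.minLevel D.cR < L.minLevel D.cG := by rwa [hR, hG, Nat.cast_lt]
    obtain ⟨u, hu⟩ := hL.exists_step _ h.live_cG (Nat.zero_lt_of_lt hlt)
    obtain ⟨-, hlt', -⟩ := hL.step _ _ h.live_cG hu
    left
    by_cases hcu : D.colour u = none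
    · exact ⟨_, .greenMove D u hm hl hu hcu⟩
    · rcases hC.low u hcu with rfl | rfl | hlow
      · exact ⟨_, .greenMeets D hm hl hu⟩
      · exact absurd hlt' (lt_irrefl _)
      · exact absurd hlt' hlow.2.not_gt

theorem exists_step_of_redSeeks (h : SearchInvariant M L β i tip len root D A B)
    (hm : D.mode = .redSeeks) : ∃ D', D.Step L D' := by
  classical
  by_cases hs : D.RedStuck L
  · by_cases hb : D.cR = D.barrier
    · exact ⟨_, .redFail D hm hs hb⟩
    · obtain ⟨x, -, hx, -⟩ := h.stackR.exists_pop hb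
      exact ⟨_, .redBacktrack D x hm hs hb hx⟩
  · simp only [DDFS.RedStuck, not_or, not_forall, not_not] at hs
    obtain ⟨hne, u, hu, hcu⟩ := hs
    exact ⟨_, .redSeek D u hm hne hu hcu⟩

theorem exists_step_of_greenSeeks (h : SearchInvariant M L β i tip len root D A B)
    (hm : D.mode = .greenSeeks) : (∃ D', D.Step L D') ∨ ∃ b, D.EndsAt L b := by
  classical
  by_cases hs : D.GreenStuck L
  · by_cases hb : D.cG = D.rootG
    · exact Or.inr ⟨_, hm, hs, hb, rfl⟩
    · obtain ⟨x, -, hx, -⟩ := h.stackG.exists_pop hb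
      exact Or.inl ⟨_, .greenBacktrack D x hm hs hb hx⟩
  · simp only [DDFS.GreenStuck, not_or, not_forall, not_not] at hs
    obtain ⟨hne, u, hu, hcu⟩ := hs
    exact Or.inl ⟨_, .greenSeek D u hm hne hu hcu⟩

theorem progress (hL : IsLayered M L β i) (h : SearchInvariant M L β i tip len root D A B) :
    (∃ D', D.Step L D') ∨ (∃ b, D.EndsAt L b) ∨ D.EndsDisjoint L := by
  rcases hm : D.mode with _ | _ | _
  · exact (h.exists_step_of_normal hL hm).imp_right Or.inr
  · exact Or.inl (h.exists_step_of_redSeeks hm)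
  · exact (h.exists_step_of_greenSeeks hm).imp_right Or.inl

end SearchInvariant

end SearchInvariant

/-! ### The invariant of MAX -/

namespace Labels

variable {L : Labels V} {v b c : V}

theorem BudStar.bud_eq (h : L.BudStar v b) : L.bud b = b := by
  induction h with
  | self _ h => exact h
  | next _ _ _ _ ih => exact ih

theorem BudStar.unique (h : L.BudStar v b) (h' : L.BudStar v c) : b = c := by
  induction h with
  | self v hv =>
    cases h' with
    | self => rfl
    | next _ _ hne => exact absurd hv hne
  | next v b hne _ ih =>
    cases h' with
    | self _ hv => exact absurd hv hne
    | next _ _ _ htail => exact ih htail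

end Labels

/-- The properties of the blossoms found up to search level `i`, where `β` is `bud*`. -/
structure Blossoms (M : G.Subgraph) (i : ℕ) (L : Labels V) (β : V → V) : Prop where
  prev : ∀ j < i, ∃ β, IsBlossomBase M j β
  maxLevel_base : ∀ v, β v = v → L.maxLevel v = ⊤
  maxLevel : ∀ v, β v ≠ v → ∃ m a : ℕ, IsMinlevel M v m ∧ IsLevel M v a ∧ m % 2 ≠ a % 2 ∧
    m + a ≤ 2 * i + 1 ∧ L.maxLevel v = a
  budStar : ∀ v, L.BudStar v (β v)
  base_lt : ∀ v, β v ≠ v →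
    ∃ m n, IsMinlevel M v m ∧ IsMinlevel M (β v) n ∧ n < m ∧ n % 2 = 0
  exists_mate : ∀ v, β v ≠ v → ∃ w, M.Adj v w
  mate : ∀ v w, β v ≠ v → M.Adj v w → β w = β v ∧ β w ≠ w
  ne_of_tenacity : ∀ v t, HasTenacity M v t → t + 1 ≤ 2 * i → β v ≠ v
  edge : ∀ u v t, G.Adj u v → ¬ M.Adj u v → HasEdgeTenacity M u v t → t + 1 ≤ 2 * i → β u = β v
  predecessor : ∀ u v, β v ≠ v → IsPredecessor M u v → β u = β v
  path : ∀ v k, β v ≠ v → IsLevel M v k →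
    ∃ S, AltPath M (β v) (layer M (β v)) v k S ∧ ∀ s ∈ S, β s = β v

/-- The invariant of the labels during MAX at search level `i`. -/
structure MaxInvariant (M : G.Subgraph) (i : ℕ) (L : Labels V) (β : V → V) : Prop
    extends Blossoms M i L β where
  minLevel : ∀ v (m : ℕ), L.minLevel v = m ↔ IsMinlevel M v m ∧ m ≤ i + 1
  preds : ∀ u v, u ∈ L.preds v ↔ IsPredecessor M u v ∧ ∃ m ≤ i + 1, IsMinlevel M v m

namespace MaxInvariant

variable {L : Labels V} {β : V → V} {i a : ℕ} {v w : V}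

theorem bud_eq_iff (h : MaxInvariant M i L β) : L.bud v = v ↔ β v = v :=
  ⟨fun hv => ((Labels.BudStar.self v hv).unique (h.budStar v)).symm,
    fun hv => by simpa only [hv] using (h.budStar v).bud_eq⟩

theorem base_base (h : MaxInvariant M i L β) (v : V) : β (β v) = β v :=
  h.bud_eq_iff.1 (h.budStar v).bud_eq

theorem base_mate (h : MaxInvariant M i L β) (hvw : M.Adj v w) (hv : β v = v) : β w = w := by
  by_contra hw
  exact (h.mate w v hw hvw.symm).2 hv

theorem hEdge_iff (h : MaxInvariant M i L β) :
    L.HEdge v w ↔ (∃ m ≤ i + 1, IsMinlevel M v m) ∧ ∃ u, IsPredecessor M u v ∧ β u = w := by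
  constructor
  · rintro ⟨u, hu, hstar⟩
    obtain ⟨hpred, hmin⟩ := (h.preds u v).1 hu
    exact ⟨hmin, u, hpred, (h.budStar u).unique hstar⟩
  · rintro ⟨hmin, u, hpred, rfl⟩
    exact ⟨u, (h.preds u v).2 ⟨hpred, hmin⟩, h.budStar u⟩

theorem hEdge_base (h : MaxInvariant M i L β) (hv : Live M β i v) (hw : IsPredecessor M w v) :
    L.HEdge v (β w) :=
  h.hEdge_iff.2 ⟨⟨_, hv.2.2.trans (Nat.le_succ i), hv.2.1⟩, w, hw, rfl⟩

theorem live_base (h : MaxInvariant M i L β) (ha : IsLevel M v a) (hknown : KnownBefore M i v a) :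
    Live M β i (β v) ∧ TreePath M β (· = β v) (β v) v a := by
  by_cases hv : β v = v
  · rcases hknown with ⟨hmin, hai⟩ | ⟨t, ht, hti⟩
    · rw [hv]
      refine ⟨⟨hv, hmin.isMinlevel_layer, by rwa [hmin.layer_eq]⟩, {v}, ?_, ?_⟩
      · rw [hmin.layer_eq]
        exact .nil
      · rintro s rfl
        exact ⟨hv, Or.inl hv⟩
    · exact absurd hv (h.ne_of_tenacity v t ht hti)
  · obtain ⟨m, n, hm, hn, hlt, -⟩ := h.base_lt v hv
    obtain ⟨m', a', hm', ha', hpar, hle, -⟩ := h.maxLevel v hv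
    obtain rfl := hm.unique hm'
    have hma := hm.le ha'.hasAltPath
    refine ⟨⟨h.base_base v, hn.isMinlevel_layer, by rw [hn.layer_eq]; omega⟩, ?_⟩
    obtain ⟨S, hS, hbase⟩ := h.path v a hv ha
    exact ⟨S, hS, fun s hs => ⟨hbase s hs, Or.inl (hbase s hs)⟩⟩

theorem isLayered (h : MaxInvariant M i L β) : IsLayered M L β i where
  minLevel w hw := (h.minLevel w _).2 ⟨hw.2.1, hw.2.2.trans (Nat.le_succ i)⟩
  step w w' hw he := by
    obtain ⟨-, u, hu, rfl⟩ := h.hEdge_iff.1 he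
    obtain ⟨k, hmin, hlevel, hadj, hpar⟩ := isPredecessor_iff.1 hu
    have hk := hmin.layer_eq
    have hki := hw.2.2
    obtain ⟨hlive, S, hS, hbase⟩ := h.live_base hlevel (hlevel.knownBefore (i := i) (by omega))
    have hle := hS.le
    refine ⟨hlive, by omega, u, S, ?_, fun s hs => (hbase s hs).1, hadj, ?_⟩
    · rwa [hk, Nat.add_sub_cancel]
    · rw [hpar, hk, Nat.add_sub_cancel]
  exists_step w hw hpos := by
    obtain ⟨k, hk⟩ : ∃ k, layer M w = k + 1 := ⟨layer M w - 1, by omega⟩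
    have hmin := hw.2.1
    rw [hk] at hmin
    obtain ⟨u, hlevel, hadj, hpar⟩ := hmin.exists_adj
    exact ⟨β u, h.hEdge_base hw (isPredecessor_iff.2 ⟨k, hmin, hlevel, hadj, hpar⟩)⟩

theorem layer_base_le (h : MaxInvariant M i L β) (hlive : Live M β i (β v)) :
    IsMinlevel M v (layer M v) ∧ layer M (β v) ≤ layer M v := by
  by_cases hv : β v = v
  · rw [hv] at hlive ⊢
    exact ⟨hlive.2.1, le_rfl⟩
  · obtain ⟨m, n, hm, hn, hlt, -⟩ := h.base_lt v hv
    refine ⟨hm.isMinlevel_layer, ?_⟩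
    rw [hm.layer_eq, hn.layer_eq]
    exact hlt.le

theorem isBlossomBase (hM : M.IsMatching) (h : MaxInvariant M i L β)
    (hbridge : ∀ u v, IsBridge M u v → HasEdgeTenacity M u v (2 * i + 1) → β u = β v) :
    IsBlossomBase M i β :=
  IsSoundBase.isBlossomBase hM
    { h with
      tenacity_le := fun v hv => by
        obtain ⟨m, a, hm, ha, hpar, hle, -⟩ := h.maxLevel v hv
        exact ⟨_, ⟨m, a, hm.isLevel, ha, hpar, rfl⟩, hle⟩
      bridge := hbridge } h.prev

end MaxInvariant

/-- The other one of the two colours. -/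
def Colour.other : Colour → Colour
  | .red => .green
  | .green => .red

@[simp]
theorem Colour.other_other (c : Colour) : c.other.other = c := by cases c <;> rfl

theorem Colour.ne_other (c : Colour) : c ≠ c.other := by cases c <;> simp [Colour.other]

/-- `tip .red` and `tip .green` are the ends of an edge of tenacity `2 i + 1`, and `len` are the
levels of its ends that enter its tenacity. -/
structure BridgeEnds (M : G.Subgraph) (i : ℕ) (tip : Colour → V) (len : Colour → ℕ) : Prop where
  adj : ∀ c, G.Adj (tip c) (tip c.other)
  parity : ∀ c, M.Adj (tip c) (tip c.other) ↔ len c % 2 = 1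
  sum : ∀ c, len c + len c.other = 2 * i
  eq_of_matched : ∀ c, M.Adj (tip c) (tip c.other) → len c = len c.other

/-- The state of affairs when a double depth first search from the bases of the ends of a bridge
has ended with the bottleneck `b`. -/
structure IsBottleneck (M : G.Subgraph) (L : Labels V) (β : V → V) (i : ℕ) (tip : Colour → V)
    (len : Colour → ℕ) (D : DDFS V) (b : V) : Prop where
  forest : IsForest M L β i tip len (fun c => β (tip c)) D.colour {b}
  low : ∀ w, D.colour w ≠ none → w = b ∨ layer M b < layer M w
  path : ∀ c, TreePath M β (fun a => a = b ∨ D.colour a = some c) b (tip c) (len c)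

section Results

variable {L : Labels V} {β : V → V} {i : ℕ} {tip root : Colour → V} {len : Colour → ℕ}
  {D : DDFS V} {A B : Set V} {b : V}

theorem SearchInvariant.isBottleneck
    (hD : SearchInvariant M L β i tip len (fun c => β (tip c)) D A B) (he : D.EndsAt L b) :
    IsBottleneck M L β i tip len D b := by
  obtain ⟨hmode, hstuck, hroot, rfl⟩ := he
  obtain ⟨hbarrier, hseek⟩ := hD.greenSeeks hmode
  have hA : A = {D.cR} := by
    have := hD.stackR
    rw [hbarrier] at this
    exact this.eq_singleton
  have hB : B = {D.cG} := by
    have := hD.stackG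
    rw [hroot] at this ⊢
    exact this.eq_singleton
  refine ⟨hD.forest.shrink (by simp [hA]) ?_, hseek.low, fun c => ?_⟩
  · rintro w (hwA | hwB) hwb
    · exact absurd (hA ▸ hwA) hwb
    · obtain rfl : w = D.cG := by simpa [hB] using hwB
      exact hstuck.resolve_left hwb
  · cases c with
    | red => exact (hD.forest.tree _ _ hseek.meet).mono fun _ h _ => Or.inr h
    | green => exact hseek.path

theorem SearchInvariant.minAugLength_le (hL : IsLayered M L β i) (hends : BridgeEnds M i tip len)
    (hD : SearchInvariant M L β i tip len root D A B) (he : D.EndsDisjoint L) :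
    minAugLength M ≤ (2 * i + 1 : ℕ) := by
  obtain ⟨hmode, hne, hminR, hminG⟩ := he
  have hC := hD.normal hmode
  rw [hL.minLevel _ hD.live_cR, Nat.cast_eq_zero] at hminR
  rw [hL.minLevel _ hD.live_cG, Nat.cast_eq_zero] at hminG
  have hR : Unmatched M D.cR := (hminR ▸ hD.live_cR.2.1.hasAltPath).unmatched
  have hG : Unmatched M D.cG := (hminG ▸ hD.live_cG.2.1.hasAltPath).unmatched
  obtain ⟨S, hS, hred⟩ := hD.forest.tree _ _ (hC.own _ hD.stackR.mem)
  obtain ⟨S', hS', hgreen⟩ := hD.forest.tree _ _ (hC.other _ hD.stackG.mem)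
  rw [hminR] at hS
  rw [hminG] at hS'
  have hsum : len .red + len .green = 2 * i := hends.sum .red
  have hpath := hS.append (hends.adj .red) (hends.parity .red)
    (hS'.reverse (n := len .red + 1) (by omega)) fun s hs hs' => by
      have hcolour : some Colour.red = some .green := (hred s hs).1.symm.trans (hgreen s hs').1
      simp at hcolour
  obtain ⟨p, hp, hlength, -, halt⟩ := hpath.exists_walk
  refine iInf_le_of_le D.cR (iInf_le_of_le D.cG (iInf_le_of_le p (iInf_le_of_le
    ⟨hR, hG, hne, (isAlternatingPath_iff hR).2 ⟨hp, halt⟩⟩ ?_)))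
  exact_mod_cast (by omega : p.length ≤ 2 * i + 1)

end Results

namespace IsBottleneck

variable {L : Labels V} {β : V → V} {i k : ℕ} {tip : Colour → V} {len : Colour → ℕ} {D : DDFS V}
  {b u v w : V}

theorem visited (hE : IsBottleneck M L β i tip len D b) : D.colour b ≠ none :=
  hE.forest.visited b rfl

theorem live (hE : IsBottleneck M L β i tip len D b) : Live M β i b :=
  hE.forest.live b hE.visited

theorem live_found (hE : IsBottleneck M L β i tip len D b) (hw : w ∈ D.found b) : Live M β i w :=
  hE.forest.live w hw.1

theorem layer_lt (hE : IsBottleneck M L β i tip len D b) (hw : w ∈ D.found b) :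
    layer M b < layer M w :=
  (hE.low w hw.1).resolve_left hw.2

theorem layer_le (hE : IsBottleneck M L β i tip len D b) (hw : D.colour w ≠ none) :
    layer M b ≤ layer M w :=
  (hE.low w hw).elim (fun h => h ▸ le_rfl) le_of_lt

theorem visited_of_hEdge (hE : IsBottleneck M L β i tip len D b) (hw : w ∈ D.found b)
    (he : L.HEdge w u) : D.colour u ≠ none :=
  (hE.forest.closed w hw.1).resolve_left hw.2 u he

theorem extend_minlevel_path (hI : MaxInvariant M i L β) (hE : IsBottleneck M L β i tip len D b)
    (hw : w ∈ D.found b) (he : L.HEdge w v)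
    (h : ∃ S, AltPath M b (layer M b) v (layer M v) S ∧
      ∀ s ∈ S, D.colour (β s) ≠ none ∧ (s = v ∨ layer M (β s) < layer M v)) :
    ∃ S, AltPath M b (layer M b) w (layer M w) S ∧
      ∀ s ∈ S, D.colour (β s) ≠ none ∧ (s = w ∨ layer M (β s) < layer M w) := by
  have hlive := hE.live_found hw
  obtain ⟨hlive', hlt, u, S', hS', hbase', hadj, hpar⟩ := hI.isLayered.step w v hlive he
  obtain ⟨S, hS, hbase⟩ := h
  have hlow : ∀ s ∈ S, layer M (β s) < layer M w := fun s hs =>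
    (hbase s hs).2.elim (fun h => by rwa [h, hlive'.1]) fun h => h.trans hlt
  have hpath := hS.trans hS' fun s hs hs' =>
    (hbase s hs).2.resolve_right (by rw [hbase' s hs']; exact lt_irrefl _)
  have hlow' : ∀ s ∈ S ∪ S', layer M (β s) < layer M w := by
    rintro s (hs | hs)
    · exact hlow s hs
    · rwa [hbase' s hs]
  have hnew : w ∉ S ∪ S' := fun hmem => (hlow' w hmem).ne (by rw [hlive.1])
  refine ⟨_, show layer M w - 1 + 1 = layer M w by omega ▸ hpath.snoc hadj hpar hnew, ?_⟩
  rintro s (rfl | hs)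
  · rw [hlive.1]
    exact ⟨hw.1, Or.inl rfl⟩
  · refine ⟨hs.elim (fun hs => (hbase s hs).1) fun hs => ?_, Or.inr (hlow' s hs)⟩
    rw [hbase' s hs]
    exact hE.visited_of_hEdge hw he

theorem exists_minlevel_path (hI : MaxInvariant M i L β)
    (hE : IsBottleneck M L β i tip len D b) (hw : D.colour w ≠ none) :
    ∃ S, AltPath M b (layer M b) w (layer M w) S ∧
      ∀ s ∈ S, D.colour (β s) ≠ none ∧ (s = w ∨ layer M (β s) < layer M w) := by
  induction hn : layer M w using Nat.strong_induction_on generalizing w with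
  | _ n ih =>
    subst hn
    by_cases hwb : w = b
    · subst hwb
      refine ⟨{w}, .nil, ?_⟩
      rintro s rfl
      rw [hE.live.1]
      exact ⟨hw, Or.inl rfl⟩
    · have hmem : w ∈ D.found b := ⟨hw, hwb⟩
      obtain ⟨v, he⟩ := hI.isLayered.exists_step w (hE.live_found hmem)
        ((Nat.zero_le _).trans_lt (hE.layer_lt hmem))
      have hlt := (hI.isLayered.step w v (hE.live_found hmem) he).2.1
      exact hE.extend_minlevel_path hI hmem he
        (ih (layer M v) hlt (hE.visited_of_hEdge hmem he) rfl)

theorem exists_maxlevel_path (hends : BridgeEnds M i tip len)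
    (hE : IsBottleneck M L β i tip len D b) (hw : w ∈ D.found b) :
    ∃ S, AltPath M b (layer M b) w (2 * i + 1 - layer M w) S ∧
      ∀ s ∈ S, D.colour (β s) ≠ none := by
  have hlt := hE.layer_lt hw
  obtain ⟨c, hc⟩ := Option.ne_none_iff_exists'.1 hw.1
  obtain ⟨S, hS, hbase⟩ := hE.forest.tree w c hc
  obtain ⟨S', hS', hbase'⟩ := hE.path c.other
  have hsum := hends.sum c
  have hle := hS.le
  have hdisjoint : ∀ s ∈ S', s ∉ S := by
    intro s hs' hs
    obtain ⟨hcolour, habove⟩ := hbase s hs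
    rcases (hbase' s hs').1 with hsb | hcolour'
    · rw [hsb] at habove
      exact habove.elim (fun h => hw.2 h.symm) hlt.not_gt
    · exact c.ne_other (Option.some_injective _ (hcolour.symm.trans hcolour'))
  have hpath := hS'.append (hends.adj c).symm (by simpa using hends.parity c.other)
    (hS.reverse (n := len c.other + 1) (by omega)) hdisjoint
  refine ⟨_, show len c.other + 1 + (len c - layer M w) = 2 * i + 1 - layer M w by omega ▸ hpath,
    ?_⟩
  rintro s (hs | hs)
  · rcases (hbase' s hs).1 with hsb | hcolour
    · exact hsb ▸ hE.visited
    · exact Option.ne_none_iff_exists'.2 ⟨_, hcolour⟩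
  · exact Option.ne_none_iff_exists'.2 ⟨_, (hbase s hs).1⟩

theorem isLevel_maxlevel (hI : MaxInvariant M i L β) (hends : BridgeEnds M i tip len)
    (hE : IsBottleneck M L β i tip len D b) (hw : w ∈ D.found b) :
    IsLevel M w (2 * i + 1 - layer M w) := by
  obtain ⟨S, hS, hbase⟩ := hE.exists_maxlevel_path hends hw
  obtain ⟨f, S₀, hf, hS₀⟩ := hE.live.2.1.hasAltPath
  have hpath := hS₀.trans hS fun s hs₀ hs => by
    by_contra hsb
    obtain ⟨j, hj, -, hlt⟩ := hS₀.exists_hasAltPath hf hs₀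
    obtain ⟨hmin, hle⟩ := hI.layer_base_le (hE.forest.live _ (hbase s hs))
    exact (((hE.layer_le (hbase s hs)).trans hle).trans (hmin.le hj)).not_gt (hlt hsb)
  have hlive := hE.live_found hw
  have hwi := hlive.2.2
  obtain ⟨k, hk, hpar, hle⟩ := HasAltPath.exists_isLevel ⟨f, _, hf, hpath⟩
  have htenacity : HasTenacity M w (layer M w + k) :=
    ⟨_, k, hlive.2.1.isLevel, hk, by omega, rfl⟩
  have hge : ¬ layer M w + k + 1 ≤ 2 * i := fun h =>
    hI.ne_of_tenacity w _ htenacity h hlive.1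
  rwa [show 2 * i + 1 - layer M w = k by omega]

theorem ne_tip_of_odd (hends : BridgeEnds M i tip len) (hE : IsBottleneck M L β i tip len D b)
    (hodd : layer M b % 2 = 1) (c : Colour) : b ≠ tip c := by
  rintro rfl
  obtain ⟨S, hS, -⟩ := hE.path c
  obtain ⟨S', hS', -⟩ := hE.path c.other
  have hlen := hS.level_eq_of_eq
  have hadj := (hends.parity c).2 (by omega)
  rw [← hends.eq_of_matched c hadj, hlen] at hS'
  exact hadj.ne hS'.eq_of_level_eq.symm

theorem layer_even (hM : M.IsMatching) (hI : MaxInvariant M i L β)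
    (hends : BridgeEnds M i tip len) (hE : IsBottleneck M L β i tip len D b) :
    layer M b % 2 = 0 := by
  by_contra heven
  have hodd : layer M b % 2 = 1 := by omega
  have hmate : ∀ c, ∃ a, M.Adj b a ∧ (β a = b ∨ D.colour (β a) = some c) := fun c => by
    obtain ⟨S, hS, hbase⟩ := hE.path c
    obtain ⟨a, ha, hba⟩ := hS.exists_mate_mem (hE.ne_tip_of_odd hends hodd c) hodd
    exact ⟨a, hba, (hbase a ha).1⟩
  obtain ⟨a, hba, hred⟩ := hmate .red
  obtain ⟨a', hba', hgreen⟩ := hmate .green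
  obtain rfl := hM.eq_of_adj_left hba hba'
  have ha : β a = b := by
    by_contra h
    exact h (hred.resolve_right (by simp [hgreen.resolve_left h]))
  exact hba.ne (ha.symm.trans (hI.base_mate hba hE.live.1))

theorem mate_ne (hM : M.IsMatching) (hI : MaxInvariant M i L β) (hends : BridgeEnds M i tip len)
    (hE : IsBottleneck M L β i tip len D b) (hw : w ∈ D.found b) (hwv : M.Adj w v) : v ≠ b := by
  rintro rfl
  obtain ⟨j, hj, hlevel⟩ := hE.live.2.1.isLevel.mate_of_even hM hwv (hE.layer_even hM hI hends)
  have hlt := hE.layer_lt hw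
  have hle := (hE.live_found hw).2.1.le hlevel.hasAltPath
  omega

theorem mate_visited_of_even (hM : M.IsMatching) (hI : MaxInvariant M i L β)
    (hE : IsBottleneck M L β i tip len D b) (hw : w ∈ D.found b) (hwv : M.Adj w v)
    (heven : layer M w % 2 = 0) : D.colour v ≠ none := by
  have hlive := hE.live_found hw
  obtain ⟨k, hk, hlevel⟩ := hlive.2.1.isLevel.mate_of_even hM hwv.symm heven
  have hpred : IsPredecessor M v w :=
    isPredecessor_iff.2 ⟨k, hk ▸ hlive.2.1, hlevel, hwv.symm.adj_sub,
      iff_of_true hwv.symm (by omega)⟩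
  simpa only [hI.base_mate hwv hlive.1] using hE.visited_of_hEdge hw (hI.hEdge_base hlive hpred)

theorem mate_visited_of_odd (hM : M.IsMatching) (hI : MaxInvariant M i L β)
    (hends : BridgeEnds M i tip len) (hE : IsBottleneck M L β i tip len D b)
    (hw : w ∈ D.found b) (hwv : M.Adj w v) (hodd : layer M w % 2 = 1) : D.colour v ≠ none := by
  have hv : β v = v := hI.base_mate hwv (hE.live_found hw).1
  obtain ⟨c, hc⟩ := Option.ne_none_iff_exists'.1 hw.1
  obtain ⟨S, hS, hbase⟩ := hE.forest.tree w c hc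
  by_cases hwc : w = tip c
  · subst hwc
    have hadj := (hends.parity c).2 (hS.level_eq_of_eq ▸ hodd)
    obtain rfl := hM.eq_of_adj_left hwv hadj
    simpa only [hv] using hE.forest.root_visited c.other
  · obtain ⟨v', hv', hadj⟩ := hS.exists_mate_mem hwc hodd
    obtain rfl := hM.eq_of_adj_left hwv hadj
    exact Option.ne_none_iff_exists'.2 ⟨c, hv ▸ (hbase v hv').1⟩

theorem mate_mem_found (hM : M.IsMatching) (hI : MaxInvariant M i L β)
    (hends : BridgeEnds M i tip len) (hE : IsBottleneck M L β i tip len D b)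
    (hw : w ∈ D.found b) (hwv : M.Adj w v) : v ∈ D.found b :=
  ⟨(Nat.mod_two_eq_zero_or_one (layer M w)).elim (hE.mate_visited_of_even hM hI hw hwv)
    (hE.mate_visited_of_odd hM hI hends hw hwv), hE.mate_ne hM hI hends hw hwv⟩

end IsBottleneck

section AssignPetal

variable {L : Labels V} {P : Set V} {i : ℕ} {b w : V}

theorem assignPetal_bud_of_mem (hw : w ∈ P) : (assignPetal i P b L).bud w = b := if_pos hw

theorem assignPetal_bud_of_notMem (hw : w ∉ P) : (assignPetal i P b L).bud w = L.bud w := if_neg hw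

theorem assignPetal_maxLevel_of_mem (hw : w ∈ P) :
    (assignPetal i P b L).maxLevel w = (2 * i + 1 : ℕ∞) - L.minLevel w := if_pos hw

theorem assignPetal_maxLevel_of_notMem (hw : w ∉ P) :
    (assignPetal i P b L).maxLevel w = L.maxLevel w := if_neg hw

end AssignPetal

open Classical in
/-- `bud*` after the petal of the search `D` with bottleneck `b` has been formed: the blossoms with
visited bases become one blossom with base `b`. -/
noncomputable def petalBase (β : V → V) (D : DDFS V) (b v : V) : V :=
  if D.colour (β v) ≠ none then b else β v

section PetalBase

variable {β : V → V} {D : DDFS V} {b u v : V}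

theorem petalBase_of_visited (hv : D.colour (β v) ≠ none) : petalBase β D b v = b := if_pos hv

theorem petalBase_of_not_visited (hv : ¬ D.colour (β v) ≠ none) : petalBase β D b v = β v :=
  if_neg hv

theorem petalBase_congr (h : β u = β v) : petalBase β D b u = petalBase β D b v := by
  unfold petalBase
  rw [h]

end PetalBase

namespace IsBottleneck

variable {L : Labels V} {β : V → V} {i k : ℕ} {tip : Colour → V} {len : Colour → ℕ} {D : DDFS V}
  {b u v w : V}

theorem petalBase_of_mem (hE : IsBottleneck M L β i tip len D b) (hw : w ∈ D.found b) :
    petalBase β D b w = b :=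
  petalBase_of_visited (by rw [(hE.live_found hw).1]; exact hw.1)

theorem petalBase_ne_iff (hE : IsBottleneck M L β i tip len D b) :
    petalBase β D b v ≠ v ↔ β v ≠ v ∨ v ∈ D.found b := by
  by_cases hv : D.colour (β v) ≠ none
  · rw [petalBase_of_visited hv]
    by_cases hβ : β v = v
    · rw [hβ] at hv
      exact ⟨fun hne => Or.inr ⟨hv, hne.symm⟩, fun h => (h.resolve_left (absurd hβ)).2.symm⟩
    · refine iff_of_true ?_ (Or.inl hβ)
      rintro rfl
      exact hβ hE.live.1
  · rw [petalBase_of_not_visited hv]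
    refine ⟨Or.inl, Or.rec id fun hw => ?_⟩
    rw [(hE.live_found hw).1] at hv
    exact absurd hw.1 hv

theorem budStar_bottleneck (hI : MaxInvariant M i L β) (hE : IsBottleneck M L β i tip len D b) :
    (assignPetal i (D.found b) b L).BudStar b b :=
  .self b ((assignPetal_bud_of_notMem fun h => h.2 rfl).trans (hI.bud_eq_iff.2 hE.live.1))

open Classical in
theorem budStar_assignPetal (hI : MaxInvariant M i L β) (hE : IsBottleneck M L β i tip len D b)
    (h : L.BudStar v w) : (assignPetal i (D.found b) b L).BudStar v
      (if D.colour w ≠ none then b else w) := by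
  induction h with
  | self v hv =>
    by_cases hmem : v ∈ D.found b
    · have hbud : (assignPetal i (D.found b) b L).bud v = b := assignPetal_bud_of_mem hmem
      rw [if_pos hmem.1]
      exact .next v b (by rw [hbud]; exact hmem.2.symm)
        (by rw [hbud]; exact hE.budStar_bottleneck hI)
    · by_cases hvisited : D.colour v ≠ none
      · obtain rfl : v = b := not_not.1 fun hvb => hmem ⟨hvisited, hvb⟩
        rw [if_pos hvisited]
        exact hE.budStar_bottleneck hI
      · rw [if_neg hvisited]
        exact .self v ((assignPetal_bud_of_notMem hmem).trans hv)
  | next v w hne h ih =>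
    have hmem : v ∉ D.found b := fun hv => hne (hI.bud_eq_iff.2 (hE.live_found hv).1)
    rw [← assignPetal_bud_of_notMem (i := i) (b := b) (L := L) hmem] at hne ih
    exact .next v _ hne ih

theorem petalBase_lt (hM : M.IsMatching) (hI : MaxInvariant M i L β)
    (hends : BridgeEnds M i tip len) (hE : IsBottleneck M L β i tip len D b)
    (hv : petalBase β D b v ≠ v) :
    ∃ m n, IsMinlevel M v m ∧ IsMinlevel M (petalBase β D b v) n ∧ n < m ∧ n % 2 = 0 := by
  by_cases hvisited : D.colour (β v) ≠ none
  · rw [petalBase_of_visited hvisited] at hv ⊢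
    rcases hE.low _ hvisited with hβ | hlt
    · obtain ⟨m, n, hm, hn, hlt, heven⟩ := hI.base_lt v (hβ ▸ hv)
      exact ⟨m, n, hm, hβ ▸ hn, hlt, heven⟩
    · obtain ⟨hmin, hle⟩ := hI.layer_base_le (hE.forest.live _ hvisited)
      exact ⟨_, _, hmin, hE.live.2.1, hlt.trans_le hle, hE.layer_even hM hI hends⟩
  · rw [petalBase_of_not_visited hvisited] at hv ⊢
    exact hI.base_lt v hv

theorem exists_mate (hE : IsBottleneck M L β i tip len D b) (hw : w ∈ D.found b) :
    ∃ v, M.Adj w v := by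
  by_contra hmate
  have hunmatched : Unmatched M w := not_exists.1 hmate
  have hzero := (hE.live_found hw).2.1.le hunmatched.hasAltPath_zero
  have hlt := hE.layer_lt hw
  omega

theorem path_of_base_ne (hI : MaxInvariant M i L β) (hE : IsBottleneck M L β i tip len D b)
    (hv : β v ≠ v) (hk : IsLevel M v k) :
    ∃ S, AltPath M (petalBase β D b v) (layer M (petalBase β D b v)) v k S ∧
      ∀ s ∈ S, petalBase β D b s = petalBase β D b v := by
  obtain ⟨S, hS, hbase⟩ := hI.path v k hv hk
  by_cases hvisited : D.colour (β v) ≠ none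
  · obtain ⟨S', hS', hbase'⟩ := hE.exists_minlevel_path hI hvisited
    rw [petalBase_of_visited hvisited]
    refine ⟨_, hS'.trans hS fun s hs' hs => (hbase' s hs').2.resolve_right ?_, ?_⟩
    · rw [hbase s hs]
      exact lt_irrefl _
    · rintro s (hs | hs)
      · exact petalBase_of_visited (hbase' s hs).1
      · exact petalBase_of_visited (by rwa [hbase s hs])
  · rw [petalBase_of_not_visited hvisited]
    refine ⟨S, hS, fun s hs => ?_⟩
    rw [petalBase_of_not_visited, hbase s hs]
    rwa [hbase s hs]

theorem path_of_mem_found (hI : MaxInvariant M i L β) (hends : BridgeEnds M i tip len)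
    (hE : IsBottleneck M L β i tip len D b) (hv : v ∈ D.found b) (hk : IsLevel M v k) :
    ∃ S, AltPath M b (layer M b) v k S ∧ ∀ s ∈ S, petalBase β D b s = b := by
  have hlive := hE.live_found hv
  have hvi := hlive.2.2
  by_cases hpar : k % 2 = layer M v % 2
  · obtain rfl := hk.unique hlive.2.1.isLevel hpar
    obtain ⟨S, hS, hbase⟩ := hE.exists_minlevel_path hI hv.1
    exact ⟨S, hS, fun s hs => petalBase_of_visited (hbase s hs).1⟩
  · obtain rfl := hk.unique (hE.isLevel_maxlevel hI hends hv) (by omega)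
    obtain ⟨S, hS, hbase⟩ := hE.exists_maxlevel_path hends hv
    exact ⟨S, hS, fun s hs => petalBase_of_visited (hbase s hs)⟩

theorem assignPetal_maxLevel (hI : MaxInvariant M i L β) (hends : BridgeEnds M i tip len)
    (hE : IsBottleneck M L β i tip len D b) (hv : v ∈ D.found b) :
    ∃ m a : ℕ, IsMinlevel M v m ∧ IsLevel M v a ∧ m % 2 ≠ a % 2 ∧ m + a ≤ 2 * i + 1 ∧
      (assignPetal i (D.found b) b L).maxLevel v = a := by
  have hlive := hE.live_found hv
  have hvi := hlive.2.2
  refine ⟨layer M v, 2 * i + 1 - layer M v, hlive.2.1, hE.isLevel_maxlevel hI hends hv, by omega,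
    by omega, ?_⟩
  rw [assignPetal_maxLevel_of_mem hv, hI.isLayered.minLevel v hlive]
  norm_cast

theorem maxInvariant (hM : M.IsMatching) (hI : MaxInvariant M i L β)
    (hends : BridgeEnds M i tip len) (hE : IsBottleneck M L β i tip len D b) :
    MaxInvariant M i (assignPetal i (D.found b) b L) (petalBase β D b) where
  prev := hI.prev
  maxLevel_base v hv := by
    obtain ⟨hβ, hmem⟩ := not_or.1 (mt hE.petalBase_ne_iff.2 (not_not.2 hv))
    rw [assignPetal_maxLevel_of_notMem hmem, hI.maxLevel_base v (not_not.1 hβ)]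
  maxLevel v hv := by
    by_cases hmem : v ∈ D.found b
    · exact hE.assignPetal_maxLevel hI hends hmem
    · rw [assignPetal_maxLevel_of_notMem hmem]
      exact hI.maxLevel v ((hE.petalBase_ne_iff.1 hv).resolve_right hmem)
  budStar v := hE.budStar_assignPetal hI (hI.budStar v)
  base_lt v hv := hE.petalBase_lt hM hI hends hv
  exists_mate v hv := (hE.petalBase_ne_iff.1 hv).elim (hI.exists_mate v) hE.exists_mate
  mate v w hv hvw := by
    rcases hE.petalBase_ne_iff.1 hv with hβ | hmem
    · obtain ⟨hβw, hne⟩ := hI.mate v w hβ hvw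
      exact ⟨petalBase_congr hβw, hE.petalBase_ne_iff.2 (Or.inl hne)⟩
    · have hw := hE.mate_mem_found hM hI hends hmem hvw
      exact ⟨by rw [hE.petalBase_of_mem hw, hE.petalBase_of_mem hmem],
        hE.petalBase_ne_iff.2 (Or.inr hw)⟩
  ne_of_tenacity v t ht hle := hE.petalBase_ne_iff.2 (Or.inl (hI.ne_of_tenacity v t ht hle))
  edge u v t hadj hM ht hle := petalBase_congr (hI.edge u v t hadj hM ht hle)
  predecessor u v hv hu := by
    rcases hE.petalBase_ne_iff.1 hv with hβ | hmem
    · exact petalBase_congr (hI.predecessor u v hβ hu)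
    · rw [hE.petalBase_of_mem hmem, petalBase_of_visited]
      exact hE.visited_of_hEdge hmem (hI.hEdge_base (hE.live_found hmem) hu)
  path v k hv hk := by
    rcases hE.petalBase_ne_iff.1 hv with hβ | hmem
    · exact hE.path_of_base_ne hI hβ hk
    · rw [hE.petalBase_of_mem hmem]
      exact hE.path_of_mem_found hI hends hmem hk
  minLevel := hI.minLevel
  preds := hI.preds

end IsBottleneck

/-! ### The lists of bridges and the invariant of MIN -/

theorem Labels.BudStar.congr {L L' : Labels V} (hb : L'.bud = L.bud) {v b : V}
    (h : L.BudStar v b) : L'.BudStar v b := by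
  induction h with
  | self v hv => exact .self v (by rwa [hb])
  | next v b hv _ ih => exact .next v b (by rwa [hb]) (by rwa [hb])

theorem Blossoms.congr {L L' : Labels V} {i : ℕ} {β : V → V} (h : Blossoms M i L β)
    (hm : L'.maxLevel = L.maxLevel) (hb : L'.bud = L.bud) : Blossoms M i L' β :=
  { h with
    maxLevel_base := by rw [hm]; exact h.maxLevel_base
    maxLevel := by rw [hm]; exact h.maxLevel
    budStar := fun v => (h.budStar v).congr hb }

section Known

variable {L : Labels V} {u v : V} {a b t : ℕ}

theorem Labels.HasLevel.knownTenacity (hu : L.HasLevel u a) (hv : L.HasLevel v b)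
    (ha : M.Adj u v ↔ a % 2 = 1) (hb : M.Adj u v ↔ b % 2 = 1) :
    L.KnownTenacity M u v (a + b + 1) := by
  refine ⟨a, b, hu, hv, ?_, rfl⟩
  by_cases huv : M.Adj u v
  · exact Or.inl ⟨huv, Nat.odd_iff.2 (ha.1 huv), Nat.odd_iff.2 (hb.1 huv)⟩
  · exact Or.inr ⟨huv, by rwa [← Nat.not_odd_iff_even, Nat.odd_iff, ← ha],
      by rwa [← Nat.not_odd_iff_even, Nat.odd_iff, ← hb]⟩

theorem Labels.KnownTenacity.hasEdgeTenacity (h : L.KnownTenacity M u v t)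
    (hlevel : ∀ v k, L.HasLevel v k → IsLevel M v k) : HasEdgeTenacity M u v t := by
  obtain ⟨j, k, hj, hk, ⟨huv, hj', hk'⟩ | ⟨huv, hj', hk'⟩, rfl⟩ := h
  · exact ⟨j, k, hlevel _ _ hj, hlevel _ _ hk, iff_of_true huv (Nat.odd_iff.1 hj'),
      iff_of_true huv (Nat.odd_iff.1 hk'), rfl⟩
  · exact ⟨j, k, hlevel _ _ hj, hlevel _ _ hk,
      iff_of_false huv (by rwa [← Nat.odd_iff, Nat.not_odd_iff_even]),
      iff_of_false huv (by rwa [← Nat.odd_iff, Nat.not_odd_iff_even]), rfl⟩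

end Known

/-- The invariant of the declared props and of the lists of bridges: a bridge is in its list once
one of its ends is an inner vertex in a blossom, and the other one is in a blossom or outer with
minlevel less than `N`. -/
structure BridgeLists (M : G.Subgraph) (N : ℕ) (L : Labels V) (β : V → V) : Prop where
  props : ∀ u v, s(u, v) ∈ L.props ↔ u ∈ L.preds v ∨ v ∈ L.preds u
  sound : ∀ u v t, s(u, v) ∈ L.br t → IsBridge M u v ∧ HasEdgeTenacity M u v t
  inner : ∀ u v t, IsBridge M u v → ¬ M.Adj u v → HasEdgeTenacity M u v t → β v ≠ v →
    layer M v % 2 = 1 →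
    (β u ≠ u ∨ (IsMinlevel M u (layer M u) ∧ layer M u % 2 = 0 ∧ layer M u < N)) →
    s(u, v) ∈ L.br t

theorem BridgeLists.mem_br_of_lt {i a b : ℕ} {L : Labels V} {β : V → V} {u v : V}
    (hM : M.IsMatching) (hlists : BridgeLists M i L β) (hB : Blossoms M i L β)
    (hbridge : IsBridge M u v) (ha : IsLevel M u a) (hb : IsLevel M v b)
    (hua : M.Adj u v ↔ a % 2 = 1) (hub : M.Adj u v ↔ b % 2 = 1) (hab : a < b)
    (hsum : a + b ≤ 2 * i) : s(u, v) ∈ L.br (a + b + 1) := by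
  obtain ⟨m, hm, hma, hmb⟩ := hbridge.exists_isMinlevel_lt ha hb hua hub hab
  have hunmatched : ¬ M.Adj u v := fun huv => by
    have := hbridge.eq_of_matched hM huv ha hb (hua.1 huv) (hub.1 huv)
    omega
  have ha_even : ¬ a % 2 = 1 := hua.not.1 hunmatched
  have hb_even : ¬ b % 2 = 1 := hub.not.1 hunmatched
  refine hlists.inner u v _ hbridge hunmatched ⟨a, b, ha, hb, hua, hub, rfl⟩ ?_
    (by rw [hm.layer_eq]; omega) ?_
  · exact hB.ne_of_tenacity v _ ⟨m, b, hm.isLevel, hb, hmb, rfl⟩ (by omega)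
  · rcases ha.knownBefore (i := i) (by omega) with ⟨hmin, -⟩ | ⟨t, ht, hti⟩
    · exact Or.inr ⟨hmin.isMinlevel_layer, by rw [hmin.layer_eq]; omega,
        by rw [hmin.layer_eq]; omega⟩
    · exact Or.inl (hB.ne_of_tenacity u t ht hti)

/-- The edge `uv` has been scanned by MIN at a search level less than `N`. -/
def ScannedBefore (M : G.Subgraph) (N : ℕ) (u v : V) : Prop :=
  ∃ k < N, G.Adj u v ∧ (M.Adj u v ↔ k % 2 = 1) ∧ (IsLevel M u k ∨ IsLevel M v k)

/-- The pair `(u, v)` has been scanned by MIN at search level `i`, where `todo` consists of the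
pairs still to be scanned. -/
def ScannedAt (M : G.Subgraph) (i : ℕ) (todo : Set (V × V)) (u v : V) : Prop :=
  IsLevel M u i ∧ G.Adj u v ∧ (M.Adj u v ↔ i % 2 = 1) ∧ (u, v) ∉ todo

theorem ScannedBefore.exists_isLevel {i : ℕ} {u v : V} (h : ScannedBefore M i u v)
    (hu : IsLevel M u i) (hpar : M.Adj u v ↔ i % 2 = 1) :
    ∃ k < i, IsLevel M v k ∧ k % 2 = i % 2 := by
  obtain ⟨k, hki, -, hkpar, hk⟩ := h
  have hparity : k % 2 = 1 ↔ i % 2 = 1 := hkpar.symm.trans hpar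
  rcases hk with hk | hk
  · have := hk.unique hu (by omega)
    omega
  · exact ⟨k, hki, hk, by omega⟩

/-- The invariant of the labels during MIN at search level `i`, with the pairs in `todo` still to be
scanned. -/
structure MinInvariant (M : G.Subgraph) (i : ℕ) (L : Labels V) (β : V → V) (todo : Set (V × V)) :
    Prop extends Blossoms M i L β where
  exists_tenacity : ∀ v, β v ≠ v → ∃ t, HasTenacity M v t ∧ t + 1 ≤ 2 * i
  of_mem_todo : ∀ u v, (u, v) ∈ todo → IsLevel M u i ∧ G.Adj u v ∧ (M.Adj u v ↔ i % 2 = 1)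
  minLevel : ∀ v (m : ℕ), L.minLevel v = m ↔
    IsMinlevel M v m ∧ (m ≤ i ∨ m = i + 1 ∧ ∃ u, ScannedAt M i todo u v)
  preds : ∀ u v, u ∈ L.preds v ↔
    IsPredecessor M u v ∧ ∃ m, IsMinlevel M v m ∧ (m ≤ i ∨ m = i + 1 ∧ (u, v) ∉ todo)
  bridgeLists : BridgeLists M i L β
  scanned : ∀ u v, s(u, v) ∈ L.scanned ↔
    ScannedBefore M i u v ∨ ScannedAt M i todo u v ∨ ScannedAt M i todo v u
  bridge : ∀ u v k, ScannedAt M i todo u v → IsBridge M u v → IsLevel M v k → k % 2 = i % 2 →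
    KnownBefore M i v k → s(u, v) ∈ L.br (i + k + 1)

theorem MinInvariant.start {i : ℕ} {L : Labels V} {β : V → V} (hB : Blossoms M i L β)
    (htenacity : ∀ v, β v ≠ v → ∃ t, HasTenacity M v t ∧ t + 1 ≤ 2 * i)
    (hlevel : ∀ v, L.HasLevel v i ↔ IsLevel M v i)
    (hmin : ∀ v (m : ℕ), L.minLevel v = m ↔ IsMinlevel M v m ∧ m ≤ i)
    (hpreds : ∀ u v, u ∈ L.preds v ↔ IsPredecessor M u v ∧ ∃ m ≤ i, IsMinlevel M v m)
    (hlists : BridgeLists M i L β)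
    (hscanned : ∀ u v, s(u, v) ∈ L.scanned ↔ ScannedBefore M i u v) :
    MinInvariant M i L β (minQueue M i L) := by
  have hqueue (u v : V) : (u, v) ∈ minQueue M i L ↔
      IsLevel M u i ∧ G.Adj u v ∧ (M.Adj u v ↔ i % 2 = 1) := by
    simp only [minQueue, Set.mem_ofPred_eq, hlevel, Nat.odd_iff]
  have hnone (u v : V) : ¬ ScannedAt M i (minQueue M i L) u v := fun ⟨hu, hadj, hpar, huv⟩ =>
    huv ((hqueue u v).2 ⟨hu, hadj, hpar⟩)
  refine ⟨hB, htenacity, fun u v => (hqueue u v).1, fun v m => ?_, fun u v => ?_, hlists,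
    fun u v => ?_, fun u v k huv => absurd huv (hnone u v)⟩
  · simp only [hmin, hnone, exists_false, and_false, or_false]
  · rw [hpreds]
    refine and_congr_right fun hpred => exists_congr fun m => ?_
    rw [and_comm]
    refine and_congr_right fun hm => (or_iff_left ?_).symm
    rintro ⟨rfl, huv⟩
    obtain ⟨k, hk, hu, hadj, hpar⟩ := isPredecessor_iff.1 hpred
    obtain rfl : k = i := Nat.succ_injective (hk.unique hm)
    exact huv ((hqueue u v).2 ⟨hu, hadj, hpar⟩)
  · simp only [hscanned, hnone, or_false]

namespace MinInvariant

variable {i k : ℕ} {L : Labels V} {β : V → V} {todo : Set (V × V)} {u v : V}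

theorem isLevel (h : MinInvariant M i L β todo) (hk : L.HasLevel v k) : IsLevel M v k := by
  rcases hk with hk | hk
  · exact ((h.minLevel v k).1 hk).1.isLevel
  · by_cases hv : β v = v
    · rw [h.maxLevel_base v hv] at hk
      simp at hk
    · obtain ⟨m, a, -, ha, -, -, hmax⟩ := h.maxLevel v hv
      rw [hmax] at hk
      rwa [← Nat.cast_injective hk]

theorem hasLevel (h : MinInvariant M i L β todo) (hk : IsLevel M v k) (he : KnownBefore M i v k) :
    L.HasLevel v k := by
  rcases he with ⟨hmin, hki⟩ | ⟨t, ht, hti⟩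
  · exact Or.inl ((h.minLevel v k).2 ⟨hmin, Or.inl hki⟩)
  · obtain ⟨m, a, hm, ha, hpar, hma, hmax⟩ := h.maxLevel v (h.ne_of_tenacity v t ht hti)
    by_cases hkm : k % 2 = m % 2
    · obtain rfl := hk.unique hm.isLevel hkm
      have := hm.le ha.hasAltPath
      exact Or.inl ((h.minLevel v k).2 ⟨hm, Or.inl (by omega)⟩)
    · obtain rfl := hk.unique ha (by omega)
      exact Or.inr hmax

theorem scannedAt_diff (h : MinInvariant M i L β todo) (huv : (u, v) ∈ todo) (a b : V) :
    ScannedAt M i (todo \ {(u, v)}) a b ↔ ScannedAt M i todo a b ∨ (a = u ∧ b = v) := by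
  unfold ScannedAt
  simp only [Set.mem_sdiff, Set.mem_singleton_iff, Prod.mk.injEq]
  constructor
  · tauto
  · rintro (hab | ⟨rfl, rfl⟩)
    · tauto
    · have := h.of_mem_todo a b huv
      tauto

theorem of_mem_todo_diff (h : MinInvariant M i L β todo) (a b : V)
    (hab : (a, b) ∈ todo \ {(u, v)}) :
    IsLevel M a i ∧ G.Adj a b ∧ (M.Adj a b ↔ i % 2 = 1) := h.of_mem_todo a b hab.1

theorem minLevel_diff (h : MinInvariant M i L β todo) (huv : (u, v) ∈ todo)
    (hv : ∃ m ≤ i, IsMinlevel M v m) (w : V) (m : ℕ) : L.minLevel w = m ↔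
      IsMinlevel M w m ∧ (m ≤ i ∨ m = i + 1 ∧ ∃ a, ScannedAt M i (todo \ {(u, v)}) a w) := by
  rw [h.minLevel]
  refine and_congr_right fun hm => or_congr_right (and_congr_right fun hmi =>
    exists_congr fun a => ?_)
  rw [h.scannedAt_diff huv, iff_self_or]
  rintro ⟨-, rfl⟩
  obtain ⟨n, hni, hn⟩ := hv
  have := hm.unique hn
  omega

theorem preds_diff (h : MinInvariant M i L β todo) (hv : ∃ m ≤ i, IsMinlevel M v m) (a w : V) :
    a ∈ L.preds w ↔ IsPredecessor M a w ∧
      ∃ m, IsMinlevel M w m ∧ (m ≤ i ∨ m = i + 1 ∧ (a, w) ∉ todo \ {(u, v)}) := by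
  rw [h.preds]
  refine and_congr_right fun _ => exists_congr fun m => and_congr_right fun hm =>
    or_congr_right (and_congr_right fun hmi => ?_)
  refine ⟨fun haw haw' => haw haw'.1, fun haw haw' => haw ⟨haw', fun heq => ?_⟩⟩
  obtain ⟨-, rfl⟩ := Prod.mk.inj heq
  obtain ⟨n, hni, hn⟩ := hv
  have := hm.unique hn
  omega

theorem exists_isLevel_of_mem_scanned (h : MinInvariant M i L β todo) (huv : (u, v) ∈ todo)
    (hscanned : s(u, v) ∈ L.scanned) : ∃ k ≤ i, IsLevel M v k ∧ k % 2 = i % 2 := by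
  obtain ⟨hu, -, hpar⟩ := h.of_mem_todo u v huv
  rcases (h.scanned u v).1 hscanned with hbefore | huv' | hvu
  · obtain ⟨k, hki, hk⟩ := hbefore.exists_isLevel hu hpar
    exact ⟨k, hki.le, hk⟩
  · exact absurd huv huv'.2.2.2
  · exact ⟨i, le_rfl, hvu.1, rfl⟩

theorem mem_br_of_mem_scanned (hM : M.IsMatching) (h : MinInvariant M i L β todo)
    (huv : (u, v) ∈ todo) (hscanned : s(u, v) ∈ L.scanned) (hbridge : IsBridge M u v)
    (hv : IsLevel M v k) (hparity : k % 2 = i % 2) : s(u, v) ∈ L.br (i + k + 1) := by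
  obtain ⟨hu, -, hpar⟩ := h.of_mem_todo u v huv
  rcases (h.scanned u v).1 hscanned with hbefore | huv' | hvu
  · obtain ⟨n, hni, hn, hnpar⟩ := hbefore.exists_isLevel hu hpar
    obtain rfl := hv.unique hn (by omega)
    rw [Sym2.eq_swap, Nat.add_comm i]
    exact h.bridgeLists.mem_br_of_lt hM h.toBlossoms hbridge.symm hv hu
      (by rw [M.adj_comm, hpar, hparity]) (by rw [M.adj_comm, hpar]) hni (by omega)
  · exact absurd huv huv'.2.2.2
  · obtain rfl := hv.unique hvu.1 hparity
    rw [Sym2.eq_swap]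
    exact h.bridge v u k hvu hbridge.symm hu rfl (hu.knownBefore le_rfl)

theorem diff_of_mem_scanned (hM : M.IsMatching) (h : MinInvariant M i L β todo)
    (huv : (u, v) ∈ todo) (hscanned : s(u, v) ∈ L.scanned) :
    MinInvariant M i L β (todo \ {(u, v)}) := by
  have hv : ∃ m ≤ i, IsMinlevel M v m := by
    obtain ⟨k, hki, hk, -⟩ := h.exists_isLevel_of_mem_scanned huv hscanned
    obtain ⟨m, hm, hmk⟩ := hk.hasAltPath.exists_isMinlevel
    exact ⟨m, hmk.trans hki, hm⟩
  refine ⟨h.toBlossoms, h.exists_tenacity, h.of_mem_todo_diff, h.minLevel_diff huv hv,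
    h.preds_diff hv, h.bridgeLists, fun a b => ?_, fun a b k hab hbridge hk hparity hknown => ?_⟩
  · have habsorb : s(a, b) = s(u, v) → s(a, b) ∈ L.scanned := fun heq => heq ▸ hscanned
    rw [Sym2.eq_iff, h.scanned] at habsorb
    rw [h.scanned, h.scannedAt_diff huv, h.scannedAt_diff huv]
    tauto
  · rcases (h.scannedAt_diff huv a b).1 hab with hab | ⟨rfl, rfl⟩
    · exact h.bridge a b k hab hbridge hk hparity hknown
    · exact h.mem_br_of_mem_scanned hM huv hscanned hbridge hk hparity

theorem isMinlevel_succ (h : MinInvariant M i L β todo) (huv : (u, v) ∈ todo)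
    (hmin : (i + 1 : ℕ∞) ≤ L.minLevel v) : IsMinlevel M v (i + 1) := by
  obtain ⟨hu, hadj, hpar⟩ := h.of_mem_todo u v huv
  obtain ⟨m, hmi, hm⟩ := hu.hasAltPath.exists_isMinlevel_of_adj hadj hpar
  by_cases hlt : m ≤ i
  · rw [(h.minLevel v m).2 ⟨hm, Or.inl hlt⟩] at hmin
    have : i + 1 ≤ m := by exact_mod_cast hmin
    omega
  · rwa [show i + 1 = m by omega]

open Classical in
theorem minLevel_update (h : MinInvariant M i L β todo) (huv : (u, v) ∈ todo)
    (hmin : IsMinlevel M v (i + 1)) (w : V) (m : ℕ) :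
    Function.update L.minLevel v (i + 1) w = m ↔
      IsMinlevel M w m ∧ (m ≤ i ∨ m = i + 1 ∧ ∃ a, ScannedAt M i (todo \ {(u, v)}) a w) := by
  by_cases hw : w = v
  · subst hw
    simp only [Function.update_self]
    constructor
    · intro hm
      obtain rfl : i + 1 = m := by exact_mod_cast hm
      exact ⟨hmin, Or.inr ⟨rfl, u, (h.scannedAt_diff huv _ _).2 (Or.inr ⟨rfl, rfl⟩)⟩⟩
    · rintro ⟨hm, -⟩
      obtain rfl := hm.unique hmin
      norm_cast
  · simp only [Function.update_of_ne hw, h.minLevel]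
    refine and_congr_right fun _ => or_congr_right (and_congr_right fun _ =>
      exists_congr fun a => ?_)
    rw [h.scannedAt_diff huv, iff_self_or]
    exact fun heq => absurd heq.2 hw

open Classical in
theorem mem_update_preds {a w : V} :
    a ∈ Function.update L.preds v (insert u (L.preds v)) w ↔
      a ∈ L.preds w ∨ (a = u ∧ w = v) := by
  by_cases hw : w = v
  · subst hw
    simp [or_comm]
  · simp [hw]

open Classical in
theorem preds_update (h : MinInvariant M i L β todo) (huv : (u, v) ∈ todo)
    (hmin : IsMinlevel M v (i + 1)) (a w : V) :
    a ∈ Function.update L.preds v (insert u (L.preds v)) w ↔ IsPredecessor M a w ∧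
      ∃ m, IsMinlevel M w m ∧ (m ≤ i ∨ m = i + 1 ∧ (a, w) ∉ todo \ {(u, v)}) := by
  obtain ⟨hu, hadj, hpar⟩ := h.of_mem_todo u v huv
  rw [mem_update_preds, h.preds]
  constructor
  · rintro (⟨haw, m, hm, hmi⟩ | ⟨rfl, rfl⟩)
    · exact ⟨haw, m, hm, hmi.imp id fun hmi => ⟨hmi.1, fun haw' => hmi.2 haw'.1⟩⟩
    · exact ⟨isPredecessor_iff.2 ⟨i, hmin, hu, hadj, hpar⟩, i + 1, hmin,
        Or.inr ⟨rfl, fun haw => haw.2 rfl⟩⟩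
  · rintro ⟨haw, m, hm, hmi⟩
    by_cases heq : a = u ∧ w = v
    · exact Or.inr heq
    · exact Or.inl ⟨haw, m, hm, hmi.imp id fun hmi => ⟨hmi.1, fun haw' =>
        hmi.2 ⟨haw', by simpa using heq⟩⟩⟩

theorem scan_prop (h : MinInvariant M i L β todo) (huv : (u, v) ∈ todo)
    (hscanned : s(u, v) ∉ L.scanned) (hmin : (i + 1 : ℕ∞) ≤ L.minLevel v) :
    MinInvariant M i (MV.scan M i u v L) β (todo \ {(u, v)}) := by
  obtain ⟨hu, hadj, hpar⟩ := h.of_mem_todo u v huv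
  have hmin' := h.isMinlevel_succ huv hmin
  rw [MV.scan, if_neg hscanned, if_pos hmin]
  refine ⟨h.toBlossoms.congr rfl rfl, h.exists_tenacity, h.of_mem_todo_diff,
    h.minLevel_update huv hmin', h.preds_update huv hmin',
    ⟨fun a b => ?_, h.bridgeLists.sound, h.bridgeLists.inner⟩,
    fun a b => ?_, fun a b k hab hbridge hk hparity hknown => ?_⟩
  · simp only [mem_update_preds, Set.mem_insert_iff, h.bridgeLists.props, Sym2.eq_iff]
    tauto
  · simp only [Set.mem_insert_iff, h.scanned, h.scannedAt_diff huv, Sym2.eq_iff]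
    tauto
  · rcases (h.scannedAt_diff huv a b).1 hab with hab | ⟨rfl, rfl⟩
    · exact h.bridge a b k hab hbridge hk hparity hknown
    · exact absurd hmin' (hbridge.not_isMinlevel_succ hu hpar)

theorem exists_isMinlevel_le (h : MinInvariant M i L β todo)
    (hmin : ¬ (i + 1 : ℕ∞) ≤ L.minLevel v) : ∃ m ≤ i, IsMinlevel M v m := by
  obtain ⟨m, hm⟩ := ENat.ne_top_iff_exists.1 (not_le.1 hmin).ne_top
  rw [← hm] at hmin
  have hmi : ¬ i + 1 ≤ m := by exact_mod_cast hmin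
  exact ⟨m, by omega, ((h.minLevel v m).1 hm.symm).1⟩

theorem isBridge (h : MinInvariant M i L β todo) (huv : (u, v) ∈ todo)
    (hscanned : s(u, v) ∉ L.scanned) (hmin : ¬ (i + 1 : ℕ∞) ≤ L.minLevel v) :
    IsBridge M u v := by
  obtain ⟨hu, hadj, hpar⟩ := h.of_mem_todo u v huv
  obtain ⟨m, hmi, hm⟩ := h.exists_isMinlevel_le hmin
  refine ⟨hadj, ?_⟩
  rintro (hpred | hpred) <;> obtain ⟨k, hk, hk', -, hkpar⟩ := isPredecessor_iff.1 hpred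
  · have hparity : k % 2 = 1 ↔ i % 2 = 1 := hkpar.symm.trans hpar
    have := hk.unique hm
    have := hk'.unique hu (by omega)
    omega
  · have := hk.le hu.hasAltPath
    exact hscanned ((h.scanned u v).2 (Or.inl ⟨k, by omega, hadj, by rw [M.adj_comm, hkpar],
      Or.inr hk'⟩))

theorem scan_bridge (h : MinInvariant M i L β todo) (huv : (u, v) ∈ todo)
    (hscanned : s(u, v) ∉ L.scanned) (hmin : ¬ (i + 1 : ℕ∞) ≤ L.minLevel v) :
    MinInvariant M i (MV.scan M i u v L) β (todo \ {(u, v)}) := by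
  obtain ⟨hu, -, hpar⟩ := h.of_mem_todo u v huv
  have hv := h.exists_isMinlevel_le hmin
  have hbridge := h.isBridge huv hscanned hmin
  rw [MV.scan, if_neg hscanned, if_neg hmin]
  refine ⟨h.toBlossoms.congr rfl rfl, h.exists_tenacity, h.of_mem_todo_diff, h.minLevel_diff huv hv,
    h.preds_diff hv, ⟨h.bridgeLists.props, ?_, fun a b t hab hM' ht hb hodd ha =>
      Or.inl (h.bridgeLists.inner a b t hab hM' ht hb hodd ha)⟩,
    fun a b => ?_, fun a b k hab hbridge' hk hparity hknown => ?_⟩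
  · rintro a b t (hab | ⟨hab, ht⟩)
    · exact h.bridgeLists.sound a b t hab
    · have ht' : HasEdgeTenacity M u v t := ht.hasEdgeTenacity fun v k => h.isLevel
      rcases Sym2.eq_iff.1 hab with ⟨rfl, rfl⟩ | ⟨rfl, rfl⟩
      · exact ⟨hbridge, ht'⟩
      · exact ⟨hbridge.symm, ht'.symm⟩
  · simp only [Set.mem_insert_iff, h.scanned, h.scannedAt_diff huv, Sym2.eq_iff]
    tauto
  · rcases (h.scannedAt_diff huv a b).1 hab with hab | ⟨rfl, rfl⟩
    · exact Or.inl (h.bridge a b k hab hbridge' hk hparity hknown)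
    · exact Or.inr ⟨rfl, (h.hasLevel hu (hu.knownBefore le_rfl)).knownTenacity
        (h.hasLevel hk hknown) hpar (by rw [hpar, hparity])⟩

theorem scan (hM : M.IsMatching) (h : MinInvariant M i L β todo) (huv : (u, v) ∈ todo) :
    MinInvariant M i (MV.scan M i u v L) β (todo \ {(u, v)}) := by
  by_cases hscanned : s(u, v) ∈ L.scanned
  · rw [MV.scan, if_pos hscanned]
    exact h.diff_of_mem_scanned hM huv hscanned
  by_cases hmin : (i + 1 : ℕ∞) ≤ L.minLevel v
  · exact h.scan_prop huv hscanned hmin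
  · exact h.scan_bridge huv hscanned hmin

end MinInvariant

/-- The invariant of MAX at search level `i`, with the bridges in `done` already processed. -/
structure MaxState (M : G.Subgraph) (i : ℕ) (L : Labels V) (β : V → V) (done : Set (Sym2 V)) : Prop
    extends MaxInvariant M i L β where
  bridgeLists : BridgeLists M (i + 1) L β
  scanned : ∀ u v, s(u, v) ∈ L.scanned ↔ ScannedBefore M (i + 1) u v
  bridge : ∀ u v, IsBridge M u v → HasEdgeTenacity M u v (2 * i + 1) → s(u, v) ∈ L.br (2 * i + 1)
  base_eq : ∀ u v, s(u, v) ∈ done → β u = β v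

theorem scannedAt_empty {i : ℕ} {u v : V} :
    ScannedAt M i ∅ u v ↔ IsLevel M u i ∧ G.Adj u v ∧ (M.Adj u v ↔ i % 2 = 1) := by
  simp [ScannedAt]

theorem scannedBefore_succ {i : ℕ} {u v : V} :
    ScannedBefore M (i + 1) u v ↔
      ScannedBefore M i u v ∨ ScannedAt M i ∅ u v ∨ ScannedAt M i ∅ v u := by
  simp only [scannedAt_empty, G.adj_comm v u, M.adj_comm v u]
  constructor
  · rintro ⟨k, hk, hadj, hpar, hlevel⟩
    rcases Nat.lt_succ_iff_lt_or_eq.1 hk with hk | rfl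
    · exact Or.inl ⟨k, hk, hadj, hpar, hlevel⟩
    · exact Or.inr (hlevel.imp (fun hu => ⟨hu, hadj, hpar⟩) fun hv => ⟨hv, hadj, hpar⟩)
  · rintro (⟨k, hk, hscanned⟩ | ⟨hu, hadj, hpar⟩ | ⟨hv, hadj, hpar⟩)
    · exact ⟨k, hk.trans (Nat.lt_succ_self i), hscanned⟩
    · exact ⟨i, Nat.lt_succ_self i, hadj, hpar, Or.inl hu⟩
    · exact ⟨i, Nat.lt_succ_self i, hadj, hpar, Or.inr hv⟩

namespace MinInvariant

variable {i a b : ℕ} {L : Labels V} {β : V → V} {u v : V}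

theorem maxInvariant (h : MinInvariant M i L β ∅) : MaxInvariant M i L β := by
  refine ⟨h.toBlossoms, fun v m => ?_, fun u v => ?_⟩
  · rw [h.minLevel]
    refine and_congr_right fun hm => ⟨by omega, fun hle => ?_⟩
    rcases Nat.le_succ_iff.1 hle with hmi | rfl
    · exact Or.inl hmi
    · obtain ⟨u, hu⟩ := hm.exists_adj
      exact Or.inr ⟨rfl, u, scannedAt_empty.2 hu⟩
  · rw [h.preds]
    refine and_congr_right fun _ => exists_congr fun m => ?_
    simp only [Set.mem_empty_iff_false, not_false_eq_true, and_true, ← Nat.le_succ_iff]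
    exact and_comm

theorem bridgeLists_succ (h : MinInvariant M i L β ∅) : BridgeLists M (i + 1) L β := by
  refine ⟨h.bridgeLists.props, h.bridgeLists.sound,
    fun u v t hbridge hunmatched ht hv hodd hu => ?_⟩
  rcases hu with hu | ⟨hmin, heven, hlt⟩
  · exact h.bridgeLists.inner u v t hbridge hunmatched ht hv hodd (Or.inl hu)
  rcases Nat.lt_succ_iff_lt_or_eq.1 hlt with hlt | hui
  · exact h.bridgeLists.inner u v t hbridge hunmatched ht hv hodd (Or.inr ⟨hmin, heven, hlt⟩)
  · rw [hui] at hmin heven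
    obtain ⟨a, b, ha, hb, hua, hub, rfl⟩ := ht
    have ha_even := hua.not.1 hunmatched
    have hb_even := hub.not.1 hunmatched
    obtain rfl := hmin.isLevel.unique ha (by omega)
    exact h.bridge u v b (scannedAt_empty.2 ⟨ha, hbridge.1, hua⟩) hbridge hb (by omega)
      (Or.inr (h.exists_tenacity v hv))

theorem mem_br_of_le (hM : M.IsMatching) (h : MinInvariant M i L β ∅) (hbridge : IsBridge M u v)
    (ha : IsLevel M u a) (hb : IsLevel M v b) (hua : M.Adj u v ↔ a % 2 = 1)
    (hub : M.Adj u v ↔ b % 2 = 1) (hsum : a + b = 2 * i) (hab : a ≤ b) :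
    s(u, v) ∈ L.br (2 * i + 1) := by
  rw [← hsum]
  rcases hab.lt_or_eq with hab | rfl
  · exact h.bridgeLists.mem_br_of_lt hM h.toBlossoms hbridge ha hb hua hub hab hsum.le
  · obtain rfl : a = i := by omega
    exact h.bridge u v a (scannedAt_empty.2 ⟨ha, hbridge.1, hua⟩) hbridge hb rfl
      (hb.knownBefore le_rfl)

theorem maxState (hM : M.IsMatching) (h : MinInvariant M i L β ∅) : MaxState M i L β ∅ := by
  refine ⟨h.maxInvariant, h.bridgeLists_succ, fun u v => ?_, fun u v hbridge ht => ?_, by simp⟩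
  · rw [h.scanned, scannedBefore_succ]
  · obtain ⟨a, b, ha, hb, hua, hub, hab⟩ := ht
    rcases le_total a b with hle | hle
    · exact h.mem_br_of_le hM hbridge ha hb hua hub (by omega) hle
    · rw [Sym2.eq_swap]
      exact h.mem_br_of_le hM hbridge.symm hb ha (by rw [M.adj_comm, hub])
        (by rw [M.adj_comm, hua]) (by omega) hle

end MinInvariant

namespace MaxInvariant

variable {i k t : ℕ} {L : Labels V} {β : V → V} {P : Set V} {u v : V}

theorem isLevel (h : MaxInvariant M i L β) (hk : L.HasLevel v k) :
    IsLevel M v k ∧ ∃ m ≤ i + 1, IsMinlevel M v m := by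
  rcases hk with hk | hk
  · obtain ⟨hmin, hki⟩ := (h.minLevel v k).1 hk
    exact ⟨hmin.isLevel, k, hki, hmin⟩
  · by_cases hv : β v = v
    · rw [h.maxLevel_base v hv] at hk
      simp at hk
    · obtain ⟨m, a, hm, ha, -, hle, hmax⟩ := h.maxLevel v hv
      rw [hmax] at hk
      have := hm.le ha.hasAltPath
      rw [← Nat.cast_injective hk]
      exact ⟨ha, m, by omega, hm⟩

theorem hasLevel (h : MaxInvariant M i L β) (hk : IsLevel M v k) (hv : β v ≠ v) :
    L.HasLevel v k := by
  obtain ⟨m, a, hm, ha, hpar, hle, hmax⟩ := h.maxLevel v hv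
  by_cases hkm : k % 2 = m % 2
  · obtain rfl := hk.unique hm.isLevel hkm
    have := hm.le ha.hasAltPath
    exact Or.inl ((h.minLevel v k).2 ⟨hm, by omega⟩)
  · obtain rfl := hk.unique ha (by omega)
    exact Or.inr hmax

theorem isBridge_of_knownTenacity (h : MaxInvariant M i L β)
    (hprops : ∀ u v, s(u, v) ∈ L.props ↔ u ∈ L.preds v ∨ v ∈ L.preds u) (hadj : G.Adj u v)
    (huv : s(u, v) ∉ L.props) (ht : L.KnownTenacity M u v t) :
    IsBridge M u v ∧ HasEdgeTenacity M u v t := by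
  refine ⟨⟨hadj, ?_⟩, ht.hasEdgeTenacity fun v k hk => (h.isLevel hk).1⟩
  obtain ⟨j, k, hj, hk, -⟩ := ht
  rw [hprops, h.preds, h.preds] at huv
  exact fun hpred => huv (hpred.imp (⟨·, (h.isLevel hk).2⟩) (⟨·, (h.isLevel hj).2⟩))

theorem mem_br_insertBridges (h : MaxInvariant M i L β)
    (hprops : ∀ u v, s(u, v) ∈ L.props ↔ u ∈ L.preds v ∨ v ∈ L.preds u) (hvP : v ∈ P)
    (hinner : L.Inner v) (hv : β v ≠ v) (hbridge : IsBridge M u v)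
    (ht : HasEdgeTenacity M u v t)
    (hu : ∀ a, IsLevel M u a → (M.Adj u v ↔ a % 2 = 1) → L.HasLevel u a) :
    s(u, v) ∈ (insertBridges M P L).br t := by
  refine Or.inr ⟨v, u, Sym2.eq_swap, hvP, hinner, hbridge.1.symm, ?_, ?_⟩
  · rw [hprops, h.preds, h.preds]
    exact fun hpred => hbridge.2 (hpred.imp And.left And.left)
  · obtain ⟨a, b, ha, hb, hua, hub, rfl⟩ := ht
    rw [Nat.add_comm a b]
    exact (h.hasLevel hb hv).knownTenacity (hu a ha hua) (by rw [M.adj_comm, hub])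
      (by rw [M.adj_comm, hua])

end MaxInvariant

/-- The pair with red member `x` and green member `y`. -/
def byColour {α : Type*} (x y : α) : Colour → α
  | .red => x
  | .green => y

theorem IsBridge.exists_bridgeEnds (hM : M.IsMatching) {i : ℕ} {x y : V} (hbridge : IsBridge M x y)
    (ht : HasEdgeTenacity M x y (2 * i + 1)) :
    ∃ len, BridgeEnds M i (byColour x y) len ∧
      ∀ c, IsLevel M (byColour x y c) (len c) ∧ KnownBefore M i (byColour x y c) (len c) := by
  obtain ⟨a, b, ha, hb, hxa, hxb, hab⟩ := ht
  have hsum : a + b = 2 * i := by omega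
  have hsum' : b + a = 2 * i := by omega
  have hya : M.Adj y x ↔ a % 2 = 1 := by rw [M.adj_comm, hxa]
  have hyb : M.Adj y x ↔ b % 2 = 1 := by rw [M.adj_comm, hxb]
  refine ⟨byColour a b, ⟨?_, ?_, ?_, ?_⟩, ?_⟩ <;> rintro (_ | _)
  · exact hbridge.1
  · exact hbridge.1.symm
  · exact hxa
  · exact hyb
  · exact hsum
  · exact hsum'
  · exact fun huv => hbridge.eq_of_matched hM huv ha hb (hxa.1 huv) (hxb.1 huv)
  · exact fun huv => hbridge.symm.eq_of_matched hM huv hb ha (hyb.1 huv) (hya.1 huv)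
  · exact ⟨ha, hbridge.knownBefore ha hb hxa hxb hsum⟩
  · exact ⟨hb, hbridge.symm.knownBefore hb ha hyb hya hsum'⟩

namespace MaxState

variable {i t : ℕ} {L : Labels V} {β : V → V} {done : Set (Sym2 V)} {tip : Colour → V}
  {len : Colour → ℕ} {D : DDFS V} {A B : Set V} {b u v : V}

theorem sound_insertBridges (hM : M.IsMatching) (h : MaxState M i L β done)
    (hends : BridgeEnds M i tip len) (hE : IsBottleneck M L β i tip len D b)
    (huv : s(u, v) ∈ (insertBridges M (D.found b) (assignPetal i (D.found b) b L)).br t) :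
    IsBridge M u v ∧ HasEdgeTenacity M u v t := by
  rcases huv with huv | ⟨x, y, heq, -, -, hadj, hprop, ht⟩
  · exact h.bridgeLists.sound u v t huv
  · rw [heq] at hprop
    have hxy := (hE.maxInvariant hM h.toMaxInvariant hends).isBridge_of_knownTenacity
      h.bridgeLists.props hadj hprop ht
    rcases Sym2.eq_iff.1 heq with ⟨rfl, rfl⟩ | ⟨rfl, rfl⟩
    · exact hxy
    · exact ⟨hxy.1.symm, hxy.2.symm⟩

theorem mem_br_of_mem_found (hM : M.IsMatching) (h : MaxState M i L β done)
    (hends : BridgeEnds M i tip len) (hE : IsBottleneck M L β i tip len D b)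
    (hv : v ∈ D.found b) (hodd : layer M v % 2 = 1) (hbridge : IsBridge M u v)
    (ht : HasEdgeTenacity M u v t) (hu : ∀ a, IsLevel M u a → (M.Adj u v ↔ a % 2 = 1) →
      (assignPetal i (D.found b) b L).HasLevel u a) :
    s(u, v) ∈ (insertBridges M (D.found b) (assignPetal i (D.found b) b L)).br t :=
  (hE.maxInvariant hM h.toMaxInvariant hends).mem_br_insertBridges h.bridgeLists.props hv
    ⟨layer M v, Nat.odd_iff.2 hodd, h.isLayered.minLevel v (hE.live_found hv)⟩
    (hE.petalBase_ne_iff.2 (Or.inr hv)) hbridge ht hu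

theorem bridgeLists_endDDFS (hM : M.IsMatching) (h : MaxState M i L β done)
    (hends : BridgeEnds M i tip len) (hE : IsBottleneck M L β i tip len D b) :
    BridgeLists M (i + 1) (insertBridges M (D.found b) (assignPetal i (D.found b) b L))
      (petalBase β D b) := by
  have hI := hE.maxInvariant hM h.toMaxInvariant hends
  refine ⟨h.bridgeLists.props, fun u v t => h.sound_insertBridges hM hends hE,
    fun u v t hbridge hunmatched ht hv hodd hu => ?_⟩
  by_cases hvP : v ∈ D.found b
  · refine h.mem_br_of_mem_found hM hends hE hvP hodd hbridge ht fun a ha hua => ?_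
    rcases hu with hu | ⟨hmin, heven, hlt⟩
    · exact hI.hasLevel ha hu
    · have ha_even := hua.not.1 hunmatched
      obtain rfl := hmin.isLevel.unique ha (by omega)
      exact Or.inl ((hI.minLevel u _).2 ⟨hmin, hlt.le⟩)
  have hv' : β v ≠ v := (hE.petalBase_ne_iff.1 hv).resolve_right hvP
  by_cases huP : u ∈ D.found b
  · obtain ⟨-, hmin, hui⟩ := hE.live_found huP
    rcases Nat.mod_two_eq_zero_or_one (layer M u) with heven | hodd'
    · exact Or.inl (h.bridgeLists.inner u v t hbridge hunmatched ht hv' hodd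
        (Or.inr ⟨hmin, heven, Nat.lt_succ_of_le hui⟩))
    · rw [Sym2.eq_swap]
      exact h.mem_br_of_mem_found hM hends hE huP hodd' hbridge.symm ht.symm
        fun a ha _ => hI.hasLevel ha hv
  · exact Or.inl (h.bridgeLists.inner u v t hbridge hunmatched ht hv' hodd
      (hu.imp_left fun hu => (hE.petalBase_ne_iff.1 hu).resolve_right huP))

theorem endDDFS (hM : M.IsMatching) (h : MaxState M i L β done) (hends : BridgeEnds M i tip len)
    (hE : IsBottleneck M L β i tip len D b) :
    MaxState M i (insertBridges M (D.found b) (assignPetal i (D.found b) b L)) (petalBase β D b)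
      (insert s(tip .red, tip .green) done) := by
  have hI := hE.maxInvariant hM h.toMaxInvariant hends
  refine ⟨⟨hI.toBlossoms.congr rfl rfl, hI.minLevel, hI.preds⟩, h.bridgeLists_endDDFS hM hends hE,
    h.scanned, fun u v hbridge ht => Or.inl (h.bridge u v hbridge ht), ?_⟩
  rintro u v (huv | huv)
  · have htip (c : Colour) : petalBase β D b (tip c) = b :=
      petalBase_of_visited (hE.forest.root_visited c)
    rcases Sym2.eq_iff.1 huv with ⟨rfl, rfl⟩ | ⟨rfl, rfl⟩ <;> simp only [htip]
  · exact petalBase_congr (h.base_eq u v huv)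

theorem isBlossomBase (hM : M.IsMatching) (h : MaxState M i L β done)
    (hdone : L.br (2 * i + 1) ⊆ done) : IsBlossomBase M i β :=
  h.toMaxInvariant.isBlossomBase hM fun u v hbridge ht =>
    h.base_eq u v (hdone (h.bridge u v hbridge ht))

theorem blossoms_succ (h : MaxState M i L β done) (hbase : IsBlossomBase M i β) :
    Blossoms M (i + 1) L β :=
  { h.toBlossoms with
    prev := fun j hj => by
      rcases Nat.lt_succ_iff_lt_or_eq.1 hj with hji | rfl
      · exact h.prev j hji
      · exact ⟨β, hbase⟩
    maxLevel := fun v hv => by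
      obtain ⟨m, a, hm, ha, hpar, hle, hmax⟩ := h.maxLevel v hv
      exact ⟨m, a, hm, ha, hpar, by omega, hmax⟩
    ne_of_tenacity := fun v t ht hle => (hbase.ne_iff v).2 ⟨t, ht, by omega⟩
    edge := fun u v t hadj hunmatched ht hle => hbase.edge u v t hadj hunmatched ht (by omega) }

theorem nextLevel (hM : M.IsMatching) (h : MaxState M i L β done)
    (hdone : L.br (2 * i + 1) ⊆ done) :
    MinInvariant M (i + 1) L β (minQueue M (i + 1) L) := by
  have hbase := h.isBlossomBase hM hdone
  refine MinInvariant.start (h.blossoms_succ hbase) (fun v hv => ?_)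
    (fun v => ⟨fun hv => (h.isLevel hv).1, fun hv => ?_⟩) h.minLevel h.preds h.bridgeLists h.scanned
  · obtain ⟨t, ht, hle⟩ := (hbase.ne_iff v).1 hv
    exact ⟨t, ht, by omega⟩
  · obtain ⟨m, hm, rfl | ⟨hlt, -, ht⟩⟩ := hv.exists_isMinlevel
    · exact Or.inl ((h.minLevel v _).2 ⟨hm, le_rfl⟩)
    · exact h.hasLevel hv ((hbase.ne_iff v).2 ⟨_, ht, by omega⟩)

end MaxState

theorem isMinlevel_zero_iff {v : V} : IsMinlevel M v 0 ↔ Unmatched M v :=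
  ⟨fun h => h.hasAltPath.unmatched, fun h => ⟨h.hasAltPath_zero, fun _ _ => Nat.zero_le _⟩⟩

theorem isLevel_zero_iff {v : V} : IsLevel M v 0 ↔ Unmatched M v :=
  ⟨fun h => h.hasAltPath.unmatched, fun h => (isMinlevel_zero_iff.2 h).isLevel⟩

theorem initLabels_minLevel {v : V} {m : ℕ} :
    (initLabels M).minLevel v = m ↔ Unmatched M v ∧ m = 0 := by
  classical
  change (if Unmatched M v then 0 else ⊤) = (m : ℕ∞) ↔ _
  split_ifs with hv <;> simp [hv, eq_comm]

theorem minInvariant_init : MinInvariant M 0 (initLabels M) id (minQueue M 0 (initLabels M)) := by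
  have hid (v : V) : ¬ id v ≠ v := fun h => h rfl
  have hB : Blossoms M 0 (initLabels M) id :=
    ⟨by simp, fun _ _ => rfl, fun v h => absurd h (hid v), fun v => .self v rfl,
      fun v h => absurd h (hid v), fun v h => absurd h (hid v), fun v _ h => absurd h (hid v),
      fun _ _ _ h => by omega, fun _ _ _ _ _ _ h => by omega, fun _ v h => absurd h (hid v),
      fun v _ h => absurd h (hid v)⟩
  refine .start hB (fun v h => absurd h (hid v)) (fun v => ?_) (fun v m => ?_) (fun u v => ?_)
    ⟨fun u v => ?_, fun u v t h => absurd h (Set.notMem_empty _),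
      fun _ v _ _ _ _ h => absurd h (hid v)⟩ (fun u v => ?_)
  · unfold Labels.HasLevel
    rw [initLabels_minLevel, isLevel_zero_iff]
    change _ ∨ (⊤ : ℕ∞) = ((0 : ℕ) : ℕ∞) ↔ _
    simp
  · rw [initLabels_minLevel, Nat.le_zero]
    exact and_congr_left fun hm => by rw [hm, isMinlevel_zero_iff]
  · refine iff_of_false (Set.notMem_empty u) ?_
    rintro ⟨hpred, m, hm, hmin⟩
    obtain ⟨k, hk, -⟩ := isPredecessor_iff.1 hpred
    have := hk.unique hmin
    omega
  · refine iff_of_false (Set.notMem_empty _) ?_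
    rintro (h | h) <;> exact Set.notMem_empty _ h
  · refine iff_of_false (Set.notMem_empty _) ?_
    rintro ⟨k, hk, -⟩
    exact Nat.not_lt_zero k hk

/-! ### Correctness of the labels -/

/-- The invariant of the algorithm; the witness `β` is the function `bud*` of the current petals. -/
def Invariant (M : G.Subgraph) (s : State V) : Prop :=
  match s.control with
  | .min todo => ∃ β, MinInvariant M s.level s.labels β todo
  | .max done => ∃ β, MaxState M s.level s.labels β done
  | .ddfs done D => ∃ β done' x y len A B, MaxState M s.level s.labels β done' ∧
      done = insert s(x, y) done' ∧ BridgeEnds M s.level (byColour x y) len ∧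
      SearchInvariant M s.labels β s.level (byColour x y) len (fun c => β (byColour x y c)) D A B
  | .augment => ∃ β done, MaxState M s.level s.labels β done

namespace MaxState

variable {i : ℕ} {L : Labels V} {β : V → V} {done : Set (Sym2 V)} {x y : V}

theorem insert_done (h : MaxState M i L β done) (hxy : β x = β y) :
    MaxState M i L β (insert s(x, y) done) where
  __ := h
  base_eq u v huv := by
    rcases huv with huv | huv
    · rcases Sym2.eq_iff.1 huv with ⟨rfl, rfl⟩ | ⟨rfl, rfl⟩
      · exact hxy
      · exact hxy.symm
    · exact h.base_eq u v huv

theorem invariant_startDDFS (hM : M.IsMatching) (h : MaxState M i L β done)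
    (hxy : s(x, y) ∈ L.br (2 * i + 1)) (hne : β x ≠ β y) :
    Invariant M ⟨i, L, .ddfs (insert s(x, y) done) (DDFS.start (β x) (β y))⟩ := by
  obtain ⟨hbridge, ht⟩ := h.bridgeLists.sound x y _ hxy
  obtain ⟨len, hends, hlevel⟩ := hbridge.exists_bridgeEnds hM ht
  exact ⟨β, done, x, y, len, _, _, h, rfl, hends,
    SearchInvariant.start (root := fun c => β (byColour x y c))
      (fun c => (h.live_base (hlevel c).1 (hlevel c).2).1) hne
      fun c => (h.live_base (hlevel c).1 (hlevel c).2).2⟩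

end MaxState

theorem Invariant.step (hM : M.IsMatching) {s s' : State V} (h : Invariant M s)
    (hs : Step M s s') : Invariant M s' := by
  cases hs with
  | scan i L todo u v huv =>
    obtain ⟨β, h⟩ := h
    exact ⟨β, h.scan hM huv⟩
  | startMax i L =>
    obtain ⟨β, h⟩ := h
    exact ⟨β, h.maxState hM⟩
  | abortDDFS i L done x y b hxy hd hx hy =>
    obtain ⟨β, h⟩ := h
    exact ⟨β, h.insert_done (((h.budStar x).unique hx).trans ((h.budStar y).unique hy).symm)⟩
  | startDDFS i L done x y r g hxy hd hx hy hrg =>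
    obtain ⟨β, h⟩ := h
    obtain rfl := (h.budStar x).unique hx
    obtain rfl := (h.budStar y).unique hy
    exact h.invariant_startDDFS hM hxy hrg
  | stepDDFS i L done D D' hD =>
    obtain ⟨β, done', x, y, len, A, B, h, hdone, hends, hsearch⟩ := h
    obtain ⟨A', B', hsearch'⟩ := hsearch.step h.isLayered hD
    exact ⟨β, done', x, y, len, A', B', h, hdone, hends, hsearch'⟩
  | endDDFS i L done D b hb =>
    obtain ⟨β, done', x, y, len, A, B, h, rfl, hends, hsearch⟩ := h
    exact ⟨_, h.endDDFS hM hends (hsearch.isBottleneck hb)⟩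
  | foundPaths i L done D hb =>
    obtain ⟨β, done', x, y, len, A, B, h, -⟩ := h
    exact ⟨β, done', h⟩
  | nextLevel i L done hd =>
    obtain ⟨β, h⟩ := h
    exact ⟨β, h.nextLevel hM hd⟩

theorem Reachable.invariant (hM : M.IsMatching) {s : State V} (h : Reachable M s) :
    Invariant M s := by
  induction h with
  | refl => exact ⟨id, minInvariant_init⟩
  | tail _ hs ih => exact ih.step hM hs

theorem Invariant.exists_blossoms {s : State V} (h : Invariant M s) :
    ∃ β, Blossoms M s.level s.labels β ∧
      ∀ v m, IsMinlevel M v m → m ≤ s.level → s.labels.minLevel v = m := by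
  have of_maxState {i L β done} (h : MaxState M i L β done) : ∃ β, Blossoms M i L β ∧
      ∀ v m, IsMinlevel M v m → m ≤ i → L.minLevel v = m :=
    ⟨_, h.toBlossoms, fun v m hm hle => (h.minLevel v m).2 ⟨hm, Nat.le_succ_of_le hle⟩⟩
  obtain ⟨i, L, _ | _ | _ | _⟩ := s
  · obtain ⟨β, h⟩ := h
    exact ⟨β, h.toBlossoms, fun v m hm hle => (h.minLevel v m).2 ⟨hm, Or.inl hle⟩⟩
  · exact h.elim fun _ => of_maxState
  · obtain ⟨β, done', x, y, len, A, B, h, -⟩ := h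
    exact of_maxState h
  · obtain ⟨β, done, h⟩ := h
    exact of_maxState h

theorem Step.level_le {s s' : State V} (h : Step M s s') : s.level ≤ s'.level := by
  cases h <;> simp

theorem level_le_of_reflTransGen {s s' : State V} (h : Relation.ReflTransGen (Step M) s s') :
    s.level ≤ s'.level := by
  induction h with
  | refl => exact le_rfl
  | tail _ hs ih => exact ih.trans hs.level_le

theorem minlevel_le_iff {v : V} {n : ℕ} :
    minlevel M v ≤ n ↔ ∃ m ≤ n, IsMinlevel M v m := by
  simp only [ENat.le_natCast_iff, minlevel_eq_iff, and_comm]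

theorem tenacity_le_iff {v : V} {n : ℕ} :
    tenacity M v ≤ n ↔ ∃ t, HasTenacity M v t ∧ t ≤ n := by
  simp only [ENat.le_natCast_iff, tenacity_eq_iff]

theorem Blossoms.maxLevel_eq {i : ℕ} {L : Labels V} {β : V → V} (h : Blossoms M i L β) {v : V}
    (hv : β v ≠ v) : L.maxLevel v = maxlevel M v := by
  obtain ⟨m, a, hm, ha, hpar, -, hmax⟩ := h.maxLevel v hv
  rw [hmax, maxlevel_eq hm ha hpar]

namespace MaxState

variable {i : ℕ} {L : Labels V} {β : V → V} {done : Set (Sym2 V)}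

theorem minCorrect (h : MaxState M i L β done) : MinCorrect M i L := by
  have hcast : (i + 1 : ℕ∞) = (i + 1 : ℕ) := by norm_cast
  have hpreds (u v : V) : u ∈ L.preds v ↔ IsPredecessor M u v ∧ minlevel M v ≤ (i + 1 : ℕ∞) := by
    rw [h.preds, hcast, minlevel_le_iff]
  refine ⟨fun v => ?_, hpreds, fun u v => by rw [h.bridgeLists.props, hpreds, hpreds]⟩
  rw [hcast]
  split_ifs with hle
  · obtain ⟨m, hmi, hm⟩ := minlevel_le_iff.1 hle
    rw [minlevel_eq_iff.2 hm]
    exact (h.minLevel v m).2 ⟨hm, hmi⟩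
  · by_contra hne
    obtain ⟨m, hm⟩ := ENat.ne_top_iff_exists.1 hne
    obtain ⟨hmin, hmi⟩ := (h.minLevel v m).1 hm.symm
    exact hle (minlevel_le_iff.2 ⟨m, hmi, hmin⟩)

theorem bridgesCollected (h : MaxState M i L β done) : BridgesCollected M i L := by
  intro u v
  have hcast : (2 * i + 1 : ℕ∞) = (2 * i + 1 : ℕ) := by norm_cast
  rw [hcast, edgeTenacity_eq_iff]
  exact ⟨h.bridgeLists.sound u v _, fun huv => h.bridge u v huv.1 huv.2⟩

theorem maxCorrect (hM : M.IsMatching) (h : MaxState M i L β done)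
    (hdone : L.br (2 * i + 1) ⊆ done) : MaxCorrect M i L := by
  intro v
  have hcast : (2 * i + 1 : ℕ∞) = (2 * i + 1 : ℕ) := by norm_cast
  have hbase := (h.isBlossomBase hM hdone).ne_iff v
  rw [hcast]
  split_ifs with hle
  · exact h.maxLevel_eq (hbase.2 (tenacity_le_iff.1 hle))
  · refine h.maxLevel_base v ?_
    by_contra hv
    exact hle (tenacity_le_iff.2 (hbase.1 hv))

end MaxState

theorem EndOfMin.correct (hM : M.IsMatching) {i : ℕ} {s : State V} (hs : EndOfMin i s)
    (hr : Reachable M s) : MinCorrect M i s.labels ∧ BridgesCollected M i s.labels := by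
  obtain ⟨j, L, c⟩ := s
  obtain ⟨rfl, rfl : c = .min ∅⟩ := hs
  obtain ⟨β, h⟩ := hr.invariant hM
  exact ⟨(h.maxState hM).minCorrect, (h.maxState hM).bridgesCollected⟩

theorem EndOfMax.maxCorrect (hM : M.IsMatching) {i : ℕ} {s : State V} (hs : EndOfMax i s)
    (hr : Reachable M s) : MaxCorrect M i s.labels := by
  obtain ⟨j, L, c⟩ := s
  obtain ⟨rfl, done, rfl : c = .max done, hdone⟩ := hs
  obtain ⟨β, h⟩ := hr.invariant hM
  exact h.maxCorrect hM hdone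

theorem EndOfMax.minCorrect (hM : M.IsMatching) {i : ℕ} {s : State V} (hs : EndOfMax i s)
    (hr : Reachable M s) : MinCorrect M i s.labels := by
  obtain ⟨j, L, c⟩ := s
  obtain ⟨rfl, done, rfl : c = .max done, -⟩ := hs
  obtain ⟨β, h⟩ := hr.invariant hM
  exact h.minCorrect

theorem EndOfMax.step_eq {i : ℕ} {s s' : State V} (hs : EndOfMax i s) (h : Step M s s') :
    s' = ⟨i + 1, s.labels, .min (minQueue M (i + 1) s.labels)⟩ := by
  obtain ⟨j, L, c⟩ := s
  obtain ⟨rfl, done, rfl : c = .max done, hdone⟩ := hs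
  cases h with
  | abortDDFS _ _ _ x y b hxy hxd hx hy => exact absurd (hdone hxy) hxd
  | startDDFS _ _ _ x y r g hxy hxd hx hy hrg => exact absurd (hdone hxy) hxd
  | nextLevel => rfl

theorem EndOfMax.exists_step {i : ℕ} {s : State V} (hs : EndOfMax i s) : ∃ s', Step M s s' := by
  obtain ⟨j, L, c⟩ := s
  obtain ⟨rfl, done, rfl : c = .max done, hdone⟩ := hs
  exact ⟨_, .nextLevel j L done hdone⟩

theorem EndOfMin.step_eq {i : ℕ} {s s' : State V} (hs : EndOfMin i s) (h : Step M s s') :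
    s' = ⟨i, s.labels, .max ∅⟩ := by
  obtain ⟨j, L, c⟩ := s
  obtain ⟨rfl, rfl : c = .min ∅⟩ := hs
  cases h with
  | scan _ _ _ u v huv => exact absurd huv (Set.notMem_empty _)
  | startMax => rfl

theorem EndOfMin.exists_step {i : ℕ} {s : State V} (hs : EndOfMin i s) : ∃ s', Step M s s' := by
  obtain ⟨j, L, c⟩ := s
  obtain ⟨rfl, rfl : c = .min ∅⟩ := hs
  exact ⟨_, .startMax j L⟩

theorem EndOfMax.labels_eq (hM : M.IsMatching) {i t : ℕ} {s s' : State V} {v : V}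
    (hs : EndOfMax i s) (hr : Reachable M s) (hss' : Relation.ReflTransGen (Step M) s s')
    (ht : HasTenacity M v t) (hti : t ≤ 2 * i + 1) :
    s'.labels.minLevel v = minlevel M v ∧ s'.labels.maxLevel v = maxlevel M v := by
  have hminle : minlevel M v ≤ i := by
    obtain ⟨a, b, ha, hb, -, rfl⟩ := ht
    obtain ⟨m, hm, -⟩ := ha.exists_isMinlevel
    have := hm.le ha.hasAltPath
    have := hm.le hb.hasAltPath
    exact minlevel_le_iff.2 ⟨m, by omega, hm⟩
  rcases hss'.cases_head with rfl | ⟨s₁, hstep, hrest⟩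
  · constructor
    · rw [(hs.minCorrect hM hr).1 v, if_pos (hminle.trans (by simp))]
    · rw [hs.maxCorrect hM hr v, if_pos (by exact_mod_cast tenacity_le_iff.2 ⟨t, ht, hti⟩)]
  · have hlevel : i + 1 ≤ s'.level := by
      simpa [hs.step_eq hstep] using level_le_of_reflTransGen hrest
    obtain ⟨β, hB, hmin⟩ := (Reachable.invariant hM (hr.trans hss')).exists_blossoms
    obtain ⟨m, hmi, hm⟩ := minlevel_le_iff.1 hminle
    exact ⟨by rw [hmin v m hm (by omega), minlevel_eq_iff.2 hm],
      hB.maxLevel_eq (hB.ne_of_tenacity v t ht (by omega))⟩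

/-! ### Termination -/

namespace Inevitably

variable {P Q : State V → Prop} {s : State V}

theorem and_reachable (h : Inevitably M P s) (hs : Reachable M s) :
    Inevitably M (fun s => P s ∧ Reachable M s) s := by
  induction h with
  | now s h => exact .now s ⟨h, hs⟩
  | later s hex _ ih => exact .later s hex fun s' hs' => ih s' hs' (hs.tail hs')

theorem bind (h : Inevitably M P s) (hPQ : ∀ s, P s → Inevitably M Q s) : Inevitably M Q s := by
  induction h with
  | now s h => exact hPQ s h
  | later s hex _ ih => exact .later s hex ih

end Inevitably

/-- The rank of the modes in the order in which they follow each other without a new vertex being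
visited. -/
def Mode.rank : Mode → ℕ
  | .normal => 2
  | .redSeeks => 1
  | .greenSeeks => 0

/-- How far the search that is backtracking is below the level `i + 1`. -/
noncomputable def gap (M : G.Subgraph) (i : ℕ) (D : DDFS V) : ℕ :=
  match D.mode with
  | .normal => 0
  | .redSeeks => i + 1 - layer M D.cR
  | .greenSeeks => i + 1 - layer M D.cG

/-- A measure that decreases in every step of a double depth first search: a step visits a new
vertex, or changes the mode, or backtracks to a higher layer. -/
noncomputable def searchMeasure (M : G.Subgraph) (i : ℕ) (D : DDFS V) : ℕ ×ₗ ℕ ×ₗ ℕ :=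
  toLex ({w | D.colour w = none}.ncard, toLex (D.mode.rank, gap M i D))

section Update

variable [DecidableEq V] {colour : V → Option Colour} {u : V}

theorem setOf_update_eq_none (c : Colour) :
    {w | Function.update colour u (some c) w = none} = {w | colour w = none} \ {u} := by
  ext w
  by_cases h : w = u <;> simp [h]

theorem ncard_unvisited_lt [Finite V] (hu : colour u = none) (c : Colour) :
    {w | Function.update colour u (some c) w = none}.ncard < {w | colour w = none}.ncard := by
  rw [setOf_update_eq_none]
  exact Set.ncard_sdiff_singleton_lt_of_mem hu (Set.toFinite _)

theorem ncard_unvisited_eq (hu : colour u ≠ none) (c : Colour) :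
    {w | Function.update colour u (some c) w = none}.ncard = {w | colour w = none}.ncard := by
  rw [setOf_update_eq_none, Set.sdiff_singleton_eq_self (s := {w | colour w = none}) hu]

end Update

theorem SearchInvariant.searchMeasure_lt [Finite V] {L : Labels V} {β : V → V} {i : ℕ}
    {tip root : Colour → V} {len : Colour → ℕ} {D D' : DDFS V} {A B : Set V}
    (h : SearchInvariant M L β i tip len root D A B) (hs : D.Step L D') :
    searchMeasure M i D' < searchMeasure M i D := by
  classical
  unfold searchMeasure
  rw [Prod.Lex.toLex_lt_toLex, Prod.Lex.toLex_lt_toLex]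
  cases hs with
  | redMove u hm hl he hu => exact Or.inl (ncard_unvisited_lt hu _)
  | greenMove u hm hl he hu => exact Or.inl (ncard_unvisited_lt hu _)
  | redMeets hm hl he =>
    exact Or.inr ⟨ncard_unvisited_eq h.visited_cG _, Or.inl (by simp [hm, Mode.rank])⟩
  | greenMeets hm hl he =>
    exact Or.inr ⟨ncard_unvisited_eq h.visited_cR _, Or.inl (by simp [hm, Mode.rank])⟩
  | redSeek u hm hc he hu => exact Or.inl (ncard_unvisited_lt hu _)
  | redBacktrack x hm hs hb hx =>
    obtain ⟨A', h'⟩ := h.redBacktrack hm hs hb hx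
    obtain ⟨x', B', hx', hlt, -⟩ := h.stackR.exists_pop hb
    obtain rfl : x' = x := Option.some.inj (hx'.symm.trans hx)
    have hle : layer M x' ≤ i := h'.live_cR.2.2
    refine Or.inr ⟨rfl, Or.inr ⟨rfl, ?_⟩⟩
    simp only [gap, hm]
    omega
  | redFail hm hs hb =>
    exact Or.inr ⟨ncard_unvisited_eq h.visited_cG _, Or.inl (by simp [hm, Mode.rank])⟩
  | greenSeek u hm hc he hu => exact Or.inl (ncard_unvisited_lt hu _)
  | greenBacktrack x hm hs hb hx =>
    obtain ⟨B', h'⟩ := h.greenBacktrack hm hs hb hx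
    obtain ⟨x', A', hx', hlt, -⟩ := h.stackG.exists_pop hb
    obtain rfl : x' = x := Option.some.inj (hx'.symm.trans hx)
    have hle : layer M x' ≤ i := h'.live_cG.2.2
    refine Or.inr ⟨rfl, Or.inr ⟨rfl, ?_⟩⟩
    simp only [gap, hm]
    omega

section Termination

variable [Finite V] {i : ℕ} {L : Labels V}

theorem inevitably_of_ddfs (hM : M.IsMatching) (hi : (2 * i + 1 : ℕ) < minAugLength M)
    {P : State V → Prop} {done : Set (Sym2 V)} {D : DDFS V}
    (h : Invariant M ⟨i, L, .ddfs done D⟩)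
    (hnext : ∀ L', Invariant M ⟨i, L', .max done⟩ → Inevitably M P ⟨i, L', .max done⟩) :
    Inevitably M P ⟨i, L, .ddfs done D⟩ := by
  induction hn : searchMeasure M i D using WellFoundedLT.induction generalizing D with
  | _ n ih =>
    obtain ⟨β, done', x, y, len, A, B, hmax, -, hends, hsearch⟩ := id h
    have hdisjoint : ¬ D.EndsDisjoint L := fun hD =>
      hi.not_ge (hsearch.minAugLength_le hmax.isLayered hends hD)
    refine .later _ ?_ fun s' hs => ?_
    · rcases hsearch.progress hmax.isLayered with ⟨D', hD'⟩ | ⟨b, hb⟩ | hD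
      · exact ⟨_, .stepDDFS i L done D D' hD'⟩
      · exact ⟨_, .endDDFS i L done D b hb⟩
      · exact absurd hD hdisjoint
    · have h' := h.step hM hs
      cases hs with
      | stepDDFS _ _ _ _ D' hD' => exact ih _ (hn ▸ hsearch.searchMeasure_lt hD') h' rfl
      | endDDFS _ _ _ _ b hb => exact hnext _ h'
      | foundPaths _ _ _ _ hD => exact absurd hD hdisjoint

theorem inevitably_endOfMax (hM : M.IsMatching) (hi : (2 * i + 1 : ℕ) < minAugLength M)
    {done : Set (Sym2 V)} (h : Invariant M ⟨i, L, .max done⟩) :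
    Inevitably M (EndOfMax i) ⟨i, L, .max done⟩ := by
  induction hn : (doneᶜ).ncard using Nat.strong_induction_on generalizing L done with
  | _ n ih =>
    have hlt (e : Sym2 V) (he : e ∉ done) : ((insert e done)ᶜ).ncard < n :=
      hn ▸ Set.ncard_lt_ncard (compl_lt_compl_iff_lt.2 (Set.ssubset_insert he)) (Set.toFinite _)
    by_cases hdone : L.br (2 * i + 1) ⊆ done
    · exact .now _ ⟨rfl, done, rfl, hdone⟩
    refine .later _ ?_ fun s' hs => ?_
    · obtain ⟨⟨x, y⟩, hxy, hxyd⟩ := Set.not_subset.1 hdone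
      obtain ⟨β, hmax⟩ := h
      by_cases hβ : β x = β y
      · exact ⟨_, .abortDDFS i L done x y _ hxy hxyd (hmax.budStar x) (hβ ▸ hmax.budStar y)⟩
      · exact ⟨_, .startDDFS i L done x y _ _ hxy hxyd (hmax.budStar x) (hmax.budStar y) hβ⟩
    · have h' := h.step hM hs
      cases hs with
      | abortDDFS _ _ _ x y b hxy hxyd hx hy => exact ih _ (hlt _ hxyd) h' rfl
      | startDDFS _ _ _ x y r g hxy hxyd hx hy hrg =>
        exact inevitably_of_ddfs hM hi h' fun L' hL' => ih _ (hlt _ hxyd) hL' rfl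
      | nextLevel _ _ _ hdone' => exact absurd hdone' hdone

theorem inevitably_endOfMin {todo : Set (V × V)} :
    Inevitably M (EndOfMin i) ⟨i, L, .min todo⟩ := by
  induction hn : todo.ncard using Nat.strong_induction_on generalizing L todo with
  | _ n ih =>
    rcases todo.eq_empty_or_nonempty with rfl | ⟨⟨u, v⟩, huv⟩
    · exact .now _ ⟨rfl, rfl⟩
    · refine .later _ ⟨_, .scan i L todo u v huv⟩ fun s' hs => ?_
      cases hs with
      | scan _ _ _ a b hab =>
        exact ih _ (hn ▸ Set.ncard_sdiff_singleton_lt_of_mem hab (Set.toFinite _)) rfl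
      | startMax => exact absurd huv (Set.notMem_empty _)

theorem EndOfMin.inevitably_endOfMax (hM : M.IsMatching) (hi : (2 * i + 1 : ℕ) < minAugLength M)
    {s : State V} (hs : EndOfMin i s) (hr : Reachable M s) : Inevitably M (EndOfMax i) s :=
  .later _ hs.exists_step fun _ hs' => by
    obtain rfl := hs.step_eq hs'
    exact MV.inevitably_endOfMax hM hi (Reachable.invariant hM (hr.tail hs'))

theorem EndOfMax.inevitably_endOfMin {s : State V} (hs : EndOfMax i s) :
    Inevitably M (EndOfMin (i + 1)) s :=
  .later _ hs.exists_step fun _ hs' => by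
    obtain rfl := hs.step_eq hs'
    exact MV.inevitably_endOfMin

theorem init_inevitably_endOfMin (hM : M.IsMatching) (i : ℕ)
    (hi : (2 * i + 1 : ℕ) ≤ minAugLength M) : Inevitably M (EndOfMin i) (init M) := by
  induction i with
  | zero => exact inevitably_endOfMin
  | succ i ih =>
    have hi' : (2 * i + 1 : ℕ) < minAugLength M :=
      lt_of_lt_of_le (by exact_mod_cast (by omega)) hi
    exact (((ih hi'.le).and_reachable .refl).bind fun s hs =>
      hs.1.inevitably_endOfMax hM hi' hs.2).bind fun s hs => hs.inevitably_endOfMin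

theorem init_inevitably_endOfMax (hM : M.IsMatching)
    (hi : (2 * i + 1 : ℕ) < minAugLength M) : Inevitably M (EndOfMax i) (init M) :=
  ((init_inevitably_endOfMin hM i hi.le).and_reachable .refl).bind fun _ hs =>
    hs.1.inevitably_endOfMax hM hi hs.2

theorem init_inevitably_labels_eq (hM : M.IsMatching) {v : V}
    (hv : tenacity M v < minAugLength M) :
    Inevitably M (fun s => ∀ s', Relation.ReflTransGen (Step M) s s' →
      s'.labels.minLevel v = minlevel M v ∧ s'.labels.maxLevel v = maxlevel M v) (init M) := by
  obtain ⟨t, ht⟩ := ENat.ne_top_iff_exists.1 hv.ne_top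
  have hten : HasTenacity M v t := tenacity_eq_iff.1 ht.symm
  have hodd := hten.odd
  obtain ⟨i, rfl⟩ : ∃ i, t = 2 * i + 1 := ⟨t / 2, by omega⟩
  rw [← ht] at hv
  exact ((init_inevitably_endOfMax hM hv).and_reachable .refl).bind fun s hs =>
    .now s fun s' hss' => hs.1.labels_eq hM hs.2 hss' hten le_rfl

end Termination

end MV

theorem mainTheorem2 {V : Type*} [Finite V] (G : SimpleGraph V) (M : G.Subgraph)
    (hM : M.IsMatching) :
    (∀ v : V, MV.tenacity M v < MV.minAugLength M →
      MV.Inevitably M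
        (fun s => ∀ s', Relation.ReflTransGen (MV.Step M) s s' →
          s'.labels.minLevel v = MV.minlevel M v ∧ s'.labels.maxLevel v = MV.maxlevel M v)
        (MV.init M)) ∧
    (∀ i : ℕ, (2 * i + 1 : ℕ∞) ≤ MV.minAugLength M →
      MV.Inevitably M (MV.EndOfMin i) (MV.init M) ∧
      ∀ s, MV.Reachable M s → MV.EndOfMin i s →
        MV.MinCorrect M i s.labels ∧ MV.BridgesCollected M i s.labels) ∧
    (∀ i : ℕ, (2 * i + 1 : ℕ∞) < MV.minAugLength M →
      MV.Inevitably M (MV.EndOfMax i) (MV.init M) ∧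
      ∀ s, MV.Reachable M s → MV.EndOfMax i s → MV.MaxCorrect M i s.labels) := by
  have hcast (i : ℕ) : (2 * i + 1 : ℕ∞) = (2 * i + 1 : ℕ) := by norm_cast
  refine ⟨fun v hv => MV.init_inevitably_labels_eq hM hv,
    fun i hi => ⟨MV.init_inevitably_endOfMin hM i (hcast i ▸ hi), fun s hr hs => hs.correct hM hr⟩,
    fun i hi => ⟨MV.init_inevitably_endOfMax hM (hcast i ▸ hi), fun s hr hs =>
      hs.maxCorrect hM hr⟩⟩
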